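/- A trinity is a triangulation of a connected closed oriented surface (several edges may join the same two vertices) whose vertices are colored red, green, blue so that adjacent vertices have different colors; an edge gets the color not occurring at its endpoints. A triangle is black if its vertices are red, green, blue in counter-clockwise order, and white otherwise. A planar trinity $\mathcal T$ is a trinity on the sphere with a fixed outer white triangle, whose vertices are called the roots. A state (Tutte matching) is a perfect matching between the non-outer white triangles and the non-root vertices in which matched objects are incident. Consider a cycle formed by a red, a green and a blue edge of $\mathcal T$; it bounds a disk on the side opposite to the three white triangles that are incident to its edges. (The boundary of a black triangle is an example.) If a state matches these three white triangles with the three vertices of the cycle, each with an endpoint of its edge on the cycle, then there are two ways to do so. In the clockwise one, the white triangles at the red, green, blue edge are matched to the green, blue, red vertex, respectively; in the counter-clockwise one, to the blue, red, green vertex. A clockwise move changes the clockwise position to the counter-clockwise one and leaves all other matches unchanged. The state transition graph has the states as its vertices, with an edge between two states if a clockwise move leads from one to the other. For each color $X$ and each white triangle $w$ there is an arrow of color $X$ across $w$: it ends at the vertex of color $X$ of $w$ and starts at the vertex of color $X$ of the black triangle on the other side of the edge of color $X$ of $w$. These arrows are the edges of a directed graph on the vertices of color $X$, the dual of the graph formed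 by the edges of color $X$. Its clocked arborescence is built by a greedy search, started at the root of color $X$ in the outer triangle: turn counter-clockwise about the current vertex; whenever the initial end of an arrow is met whose terminal point has not been reached before, select that arrow and continue at its terminal point, starting next to the arrow; after a full turn about a vertex, backtrack along the arrow that led to it and continue the turn about the preceding vertex. Theorem. Let $\mathcal T$ be a planar trinity. (1) The state transition graph of $\mathcal T$ is connected (in particular, states exist). (2) The relation "$t$ can be reached from $s$ by clockwise moves" is a partial order on the set of states that makes it a distributive lattice. It has a minimum $a$, which is the only state into which no clockwise move leads. For each state $s$, all sequences of clockwise moves from $a$ to $s$ contain the move about each given cycle the same number of times; let $\varphi_s$ denote the resulting function on the set of cycles of the above kind. Then $s\mapsto\varphi_s$ is injective, $s\le t$ if and only if $\varphi_s\le\varphi_t$, and the meet and the join of $s$ and $t$ are the states described by $\min\{\varphi_s,\varphi_t\}$ and $\max\{\varphi_s,\varphi_t\}$, respectively. (3) The lattice has a maximum, which is the only state that admits no clockwise move. It is the clocked state: for each color $X$, the clocked arborescence of color $X$ is a spanning arborescence rooted at the root of color $X$, and the white triangles matched to vertices of color $X$ are those carrying its arrows. (4) If $\mathcal T$ is irreducible,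 then all clock moves are about (boundaries of) black triangles, so that $\varphi_s$ is a function on the set of black triangles. Here the connected sum of a trinity with a spherical trinity is formed by replacing a black triangle of the former with the latter minus one of its white triangles, and $\mathcal T$ is irreducible if it has at least two white triangles and, whenever it is presented as a connected sum, one of the summands has only one white and one black triangle. -/

import Mathlib

/-- The three colours of vertices: `0` is red, `1` is green, `2` is blue. -/
abbrev Color : Type := ZMod 3

/-- A closed oriented surface obtained by gluing white triangles (the elements of `W`) to black
triangles (the elements of `B`). Every triangle has one vertex and one edge of each colour, and the
edge of colour `c` is the one opposite to the vertex of colour `c`. In counter-clockwise order the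
vertices of a black triangle are red, green, blue, and those of a white triangle are
blue, green, red. The edge of colour `c` of the white triangle `w` is glued, respecting the
colours of its endpoints, to the edge of colour `c` of the black triangle `glue c w`. Edges of
colour `c` thus correspond to white triangles, and to black triangles. -/
structure Gluing (W B : Type*) where
  glue : Color → W ≃ B

namespace Gluing

variable {W B W₀ B₀ : Type*} (T : Gluing W B)

/-- The counter-clockwise turn about vertices of colour `c`, from one white triangle to the next:
one leaves the white triangle through its edge of colour `c + 2` and the following black triangle
through its edge of colour `c + 1`. -/
def rot (c : Color) : Equiv.Perm W :=
  (T.glue (c + 2)).trans (T.glue (c + 1)).symm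

/-- The vertices of colour `c` are the cycles of the turn `rot c`. -/
def Vertex : Type _ :=
  Σ c : Color, Quotient (Equiv.Perm.SameCycle.setoid (T.rot c))

/-- The vertex of colour `c` of the white triangle `w`. -/
def vertex (c : Color) (w : W) : T.Vertex :=
  ⟨c, Quotient.mk (Equiv.Perm.SameCycle.setoid (T.rot c)) w⟩

/-- The vertex of colour `c` of the black triangle `b`: it is also a vertex of the white triangle
on the other side of the edge of colour `c + 1` of `b`. -/
def blackVertex (c : Color) (b : B) : T.Vertex :=
  T.vertex c ((T.glue (c + 1)).symm b)

/-- The surface is connected: it is nonempty, and one can get between any two white triangles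
through triangles that share edges. -/
def Connected : Prop :=
  Nonempty W ∧ ∀ w w' : W, Relation.ReflTransGen (fun x y => ∃ c d, T.glue c x = T.glue d y) w w'

/-- The Euler characteristic is `2`. The surface has `3 n` edges and `2 n` triangles, where `n` is
the number of white triangles. -/
def EulerTwo : Prop :=
  (Nat.card T.Vertex : ℤ) - 3 * Nat.card W + 2 * Nat.card W = 2

/-- Isomorphism, preserving the orientation and all colours. -/
def Iso (T : Gluing W B) (T₀ : Gluing W₀ B₀) : Prop :=
  ∃ (f : W ≃ W₀) (g : B ≃ B₀), ∀ c w, g (T.glue c w) = T₀.glue c (f w)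

open Classical in
/-- Connected sum: the black triangle `Δ` of `T` is replaced by `T₀` minus its white triangle `o`. -/
noncomputable def connectedSum (T : Gluing W B) (Δ : B) (T₀ : Gluing W₀ B₀) (o : W₀) :
    Gluing (W ⊕ {w : W₀ // w ≠ o}) ({b : B // b ≠ Δ} ⊕ B₀) where
  glue c :=
    { toFun := Sum.elim
        (fun w => if h : T.glue c w = Δ then Sum.inr (T₀.glue c o) else Sum.inl ⟨T.glue c w, h⟩)
        (fun w => Sum.inr (T₀.glue c w))
      invFun := Sum.elim
        (fun b => Sum.inl ((T.glue c).symm b))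
        (fun b => if h : (T₀.glue c).symm b = o then Sum.inl ((T.glue c).symm Δ)
          else Sum.inr ⟨(T₀.glue c).symm b, h⟩)
      left_inv := by
        rintro (w | ⟨w, hw⟩)
        · by_cases h : T.glue c w = Δ
          · subst h
            simp
          · simp [h]
        · simp [hw]
      right_inv := by
        rintro (⟨b, hb⟩ | b)
        · simp [hb]
        · by_cases h : (T₀.glue c).symm b = o
          · subst h
            simp
          · simp [h] }

/-- Irreducible: there are at least two white triangles, and in every presentation as a connected
sum of a trinity (on any surface) with a spherical one, one summand is the trivial trinity, which
consists of one white and one black triangle. -/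
def Irreducible (T : Gluing W B) : Prop :=
  2 ≤ Nat.card W ∧
    ∀ (W₁ B₁ W₂ B₂ : Type) (T₁ : Gluing W₁ B₁) (Δ : B₁) (T₂ : Gluing W₂ B₂) (o : W₂),
      Finite W₁ → Finite W₂ → T₁.Connected → T₂.Connected → T₂.EulerTwo →
        Iso T (connectedSum T₁ Δ T₂ o) → Nat.card W₁ = 1 ∨ Nat.card W₂ = 1

end Gluing

/-- A planar trinity: a properly three-coloured triangulation of the sphere, with a fixed outer
white triangle. -/
structure PlanarTrinity (W B : Type*) extends Gluing W B where
  connected : toGluing.Connected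
  eulerTwo : toGluing.EulerTwo
  outer : W

namespace PlanarTrinity

variable {W B : Type*} (T : PlanarTrinity W B)

/-- The root of colour `c`. -/
def root (c : Color) : T.Vertex := T.vertex c T.outer

/-- A state, or Tutte matching: a perfect matching between the non-outer white triangles and the
non-root vertices in which matched objects are incident. -/
structure State where
  toEquiv : {w : W // w ≠ T.outer} ≃ {v : T.Vertex // ∀ c, v ≠ T.root c}
  incident : ∀ w, ∃ c, (toEquiv w : T.Vertex) = T.vertex c w

variable {T} in
/-- The white triangle `w` is matched to the vertex `v`. -/
def State.Matches (s : T.State) (w : W) (v : T.Vertex) : Prop :=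
  ∃ h : w ≠ T.outer, (s.toEquiv ⟨w, h⟩ : T.Vertex) = v

/-- The place of a clock move: a red, a green and a blue edge forming a cycle of length three. The
edge of colour `c` is recorded by the white triangle `tri c` that is incident to it, and the
condition says that the edges of colours `c + 1` and `c + 2` have the same endpoint of colour `c`.
When the cycle is traversed in the order red, green, blue of its vertices, the three white
triangles lie to its right; on the sphere the cycle bounds a disk to its left. -/
@[ext] structure Site where
  tri : Color → W
  cycle : ∀ c, T.vertex c (tri (c + 1)) = T.vertex c (tri (c + 2))

/-- The site given by the boundary of a black triangle. -/
def blackSite (b : B) : T.Site where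
  tri c := (T.glue c).symm b
  cycle c := by
    refine congrArg (Sigma.mk c) (Quotient.sound ?_)
    refine Equiv.Perm.SameCycle.symm ⟨1, ?_⟩
    simp [Gluing.rot]

/-- The clockwise move at the site `σ` leads from `s` to `t`. At each of the three edges, of
colour `c`, the incident white triangle is matched to the endpoint of colour `c + 1` in the
clockwise position and to the endpoint of colour `c + 2` in the counter-clockwise position. -/
def ClockwiseMove (σ : T.Site) (s t : T.State) : Prop :=
  (∀ c, s.Matches (σ.tri c) (T.vertex (c + 1) (σ.tri c))) ∧
  (∀ c, t.Matches (σ.tri c) (T.vertex (c + 2) (σ.tri c))) ∧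
  ∀ w, (∀ c, w ≠ σ.tri c) → ∀ v, s.Matches w v ↔ t.Matches w v

/-- The state transition graph. -/
def transitionGraph : SimpleGraph T.State :=
  SimpleGraph.fromRel fun s t => ∃ σ, T.ClockwiseMove σ s t

/-- `T.ClockwisePath s l t`: performing clockwise moves at the sites listed in `l` (in this order)
leads from `s` to `t`. -/
inductive ClockwisePath : T.State → List T.Site → T.State → Prop
  | nil (s : T.State) : ClockwisePath s [] s
  | cons {σ : T.Site} {l : List T.Site} {s t u : T.State} :
      T.ClockwiseMove σ s t → ClockwisePath t l u → ClockwisePath s (σ :: l) u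

open Classical in
/-- `φ` records, for every state `s`, how many times the clockwise move at each site is performed
on the way from `a` to `s`: there are clockwise paths from `a` to `s`, and all of them have
the multiplicities `φ s`. -/
def IsMultiplicity (a : T.State) (φ : T.State → T.Site → ℕ) : Prop :=
  ∀ s, (∃ l, T.ClockwisePath a l s) ∧ ∀ l, T.ClockwisePath a l s → ∀ σ, l.count σ = φ s σ

/-! The arrows of colour `c` are the edges of the dual, with respect to the sphere, of the graph
formed by the edges of colour `c`. There is one across each white triangle `w`: it starts
at the vertex of colour `c` of the black triangle `glue c w`, crosses the edge of colour `c`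
and `w`, and ends at the vertex of colour `c` of `w`. -/

/-- The initial point of the arrow of colour `c` across `w`. -/
def arrowTail (c : Color) (w : W) : T.Vertex := T.blackVertex c (T.glue c w)

/-- The terminal point of the arrow of colour `c` across `w`. -/
def arrowHead (c : Color) (w : W) : T.Vertex := T.vertex c w

/-- The arrows of colour `c` across the triangles in `A` form a spanning arborescence rooted at the
root of colour `c`: every vertex of colour `c` is reached from the root along `A`, exactly one
arrow of `A` points to each non-root vertex of colour `c`, and none to the root. -/
def IsSpanningArborescence (c : Color) (A : Set W) : Prop :=
  (∀ v : T.Vertex, v.1 = c →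
    Relation.ReflTransGen (fun x y => ∃ w ∈ A, T.arrowTail c w = x ∧ T.arrowHead c w = y)
      (T.root c) v) ∧
  (∀ v : T.Vertex, v.1 = c → v ≠ T.root c → ∃! w, w ∈ A ∧ T.arrowHead c w = v) ∧
  ∀ w ∈ A, T.arrowHead c w ≠ T.root c

open Classical in
/-- One step of the greedy construction of the clocked arborescence of colour `c`, whose arrows
selected so far are those across the triangles in `A`. One turns counter-clockwise about a vertex
of colour `c`, meeting white triangles, which contain terminal ends of arrows, and black
triangles, which contain initial ends of arrows, alternately.

* At a white triangle `w` whose arrow is selected, the full turn about its head is complete: one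
  backtracks along the arrow and continues the turn about its tail.
* At any other white triangle one continues the turn.
* At a black triangle `b` containing the initial end of the arrow across `a`, if the head of
  that arrow is the root or the head of a selected arrow, one continues the turn.
* Otherwise the arrow is selected, and one begins the turn about its head, next to the arrow. -/
noncomputable def clockedStep (c : Color) : (W ⊕ B) × Set W → (W ⊕ B) × Set W
  | (Sum.inl w, A) =>
      if w ∈ A then (Sum.inl ((T.glue (c + 1)).symm (T.glue c w)), A)
      else (Sum.inr (T.glue (c + 2) w), A)
  | (Sum.inr b, A) =>
      let a := (T.glue c).symm b
      if T.arrowHead c a = T.root c ∨ ∃ a' ∈ A, T.arrowHead c a' = T.arrowHead c a then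
        (Sum.inl ((T.glue (c + 1)).symm b), A)
      else (Sum.inr (T.glue (c + 2) a), insert a A)

/-- The clocked arborescence of colour `c`: the arrows that get selected when one starts at the
root, in the outer triangle, with no arrow selected. (Nothing is selected any more after the first
full turn about the root.) -/
def clockedArborescence (c : Color) : Set W :=
  {w | ∃ k : ℕ, w ∈ ((T.clockedStep c)^[k] (Sum.inl T.outer, ∅)).2}

/-- The clocked state: for each colour `c`, the triangles matched to vertices of colour `c` are the
ones that carry the arrows of the clocked arborescence of colour `c`. -/
def IsClockedState (s : T.State) : Prop :=
  ∀ c w, s.Matches w (T.vertex c w) ↔ w ∈ T.clockedArborescence c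

end PlanarTrinity

/-! ### Orthogonal linear maps -/

section Orthogonal

variable {E F V : Type*} [Fintype E]

theorem disjoint_range_of_orthogonal (δ : (F → ℚ) →ₗ[ℚ] (E → ℚ)) (d : (V → ℚ) →ₗ[ℚ] (E → ℚ))
    (orth : ∀ h u, ∑ e, δ h e * d u e = 0) :
    Disjoint (LinearMap.range δ) (LinearMap.range d) := by
  rw [Submodule.disjoint_def]
  rintro x ⟨h, rfl⟩ ⟨u, hu⟩
  have h0 := orth h u
  rw [hu] at h0
  rw [Finset.sum_eq_zero_iff_of_nonneg (fun e _ => mul_self_nonneg _)] at h0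
  ext e
  simpa using h0 e (Finset.mem_univ e)

variable [Finite F] [Finite V]

/-- Rank-nullity for both maps. The ranges meet trivially because a vector orthogonal to itself is
zero over `ℚ`. -/
theorem finrank_sup_range_of_orthogonal (δ : (F → ℚ) →ₗ[ℚ] (E → ℚ))
    (d : (V → ℚ) →ₗ[ℚ] (E → ℚ)) (orth : ∀ h u, ∑ e, δ h e * d u e = 0) {a b : ℕ}
    (hδ : Module.finrank ℚ (LinearMap.ker δ) ≤ a) (hd : Module.finrank ℚ (LinearMap.ker d) ≤ b) :
    Nat.card F + Nat.card V ≤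
      Module.finrank ℚ (LinearMap.range δ ⊔ LinearMap.range d : Submodule ℚ (E → ℚ)) + a + b := by
  have := Fintype.ofFinite F
  have := Fintype.ofFinite V
  have h1 := LinearMap.finrank_range_add_finrank_ker δ
  have h2 := LinearMap.finrank_range_add_finrank_ker d
  rw [Module.finrank_pi] at h1 h2
  have h3 := Submodule.finrank_sup_add_finrank_inf_eq (LinearMap.range δ) (LinearMap.range d)
  rw [(disjoint_range_of_orthogonal δ d orth).eq_bot, finrank_bot] at h3
  rw [Nat.card_eq_fintype_card, Nat.card_eq_fintype_card]
  omega

theorem card_add_card_le_of_orthogonal (δ : (F → ℚ) →ₗ[ℚ] (E → ℚ))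
    (d : (V → ℚ) →ₗ[ℚ] (E → ℚ)) (orth : ∀ h u, ∑ e, δ h e * d u e = 0) {a b : ℕ}
    (hδ : Module.finrank ℚ (LinearMap.ker δ) ≤ a) (hd : Module.finrank ℚ (LinearMap.ker d) ≤ b) :
    Nat.card F + Nat.card V ≤ Nat.card E + a + b := by
  have h1 := finrank_sup_range_of_orthogonal δ d orth hδ hd
  have h2 := Submodule.finrank_le (LinearMap.range δ ⊔ LinearMap.range d)
  rw [Module.finrank_pi] at h2
  rw [Nat.card_eq_fintype_card (α := E)]
  omega

/-- When the dimensions add up, the two ranges span the space. The component of `x` in the range of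
`d` is then orthogonal to itself, so it vanishes. -/
theorem mem_range_of_orthogonal (δ : (F → ℚ) →ₗ[ℚ] (E → ℚ)) (d : (V → ℚ) →ₗ[ℚ] (E → ℚ))
    (orth : ∀ h u, ∑ e, δ h e * d u e = 0) {a b : ℕ}
    (hδ : Module.finrank ℚ (LinearMap.ker δ) ≤ a) (hd : Module.finrank ℚ (LinearMap.ker d) ≤ b)
    (hcard : Nat.card E + a + b ≤ Nat.card F + Nat.card V) {x : E → ℚ}
    (hx : ∀ u, ∑ e, x e * d u e = 0) : ∃ h, δ h = x := by
  have h1 := finrank_sup_range_of_orthogonal δ d orth hδ hd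
  have h2 : LinearMap.range δ ⊔ LinearMap.range d = ⊤ := by
    apply Submodule.eq_top_of_finrank_eq
    have h2 := Submodule.finrank_le (LinearMap.range δ ⊔ LinearMap.range d)
    rw [Module.finrank_pi] at h2 ⊢
    rw [Nat.card_eq_fintype_card (α := E)] at hcard
    omega
  have hx' : x ∈ LinearMap.range δ ⊔ LinearMap.range d := h2 ▸ Submodule.mem_top
  obtain ⟨_, ⟨h, rfl⟩, _, ⟨u, rfl⟩, rfl⟩ := Submodule.mem_sup.1 hx'
  refine ⟨h, ?_⟩
  have h3 : ∑ e, d u e * d u e = 0 := by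
    have := hx u
    simpa [add_mul, Finset.sum_add_distrib, orth h u] using this
  rw [Finset.sum_eq_zero_iff_of_nonneg (fun e _ => mul_self_nonneg _)] at h3
  ext e
  have := h3 e (Finset.mem_univ e)
  simp at this
  simp [this]

end Orthogonal

/-! ### Colours -/

theorem Color.sum_eq {M : Type*} [AddCommMonoid M] (f : Color → M) (c : Color) :
    ∑ e, f e = f c + f (c + 1) + f (c + 2) := by
  have h : (Finset.univ : Finset Color) = {c, c + 1, c + 2} := by revert c; decide
  have h1 : c ∉ ({c + 1, c + 2} : Finset Color) := by revert c; decide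
  have h2 : c + 1 ∉ ({c + 2} : Finset Color) := by revert c; decide
  rw [h, Finset.sum_insert h1, Finset.sum_insert h2, Finset.sum_singleton, add_assoc]

theorem Color.cases (c d : Color) : d = c ∨ d = c + 1 ∨ d = c + 2 := by
  revert c d; decide

@[simp] theorem Color.add_one_add_one (c : Color) : c + 1 + 1 = c + 2 := by revert c; decide
@[simp] theorem Color.add_one_add_two (c : Color) : c + 1 + 2 = c := by revert c; decide
@[simp] theorem Color.add_two_add_one (c : Color) : c + 2 + 1 = c := by revert c; decide
@[simp] theorem Color.add_two_add_two (c : Color) : c + 2 + 2 = c + 1 := by revert c; decide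
@[simp] theorem Color.two_ne_zero : (2 : Color) ≠ 0 := by decide
@[simp] theorem Color.one_ne_two : (1 : Color) ≠ 2 := by decide
@[simp] theorem Color.two_ne_one : (2 : Color) ≠ 1 := by decide

theorem Color.exists_ne_ne (c d : Color) : ∃ e, c ≠ e ∧ d ≠ e := by revert c d; decide

namespace Gluing

variable {W B : Type*} (T : Gluing W B)

/-! ### Vertices -/

instance [Finite W] : Finite T.Vertex := by
  unfold Gluing.Vertex; infer_instance

@[simp] theorem vertex_fst (c : Color) (w : W) : (T.vertex c w).1 = c := rfl

theorem vertex_eq_iff {c : Color} {w w' : W} :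
    T.vertex c w = T.vertex c w' ↔ (T.rot c).SameCycle w w' := by
  constructor
  · intro h
    exact Quotient.exact (eq_of_heq (Sigma.mk.inj h).2)
  · intro h
    exact congrArg (Sigma.mk c) (Quotient.sound h)

theorem color_eq_of_vertex_eq {c c' : Color} {w w' : W} (h : T.vertex c w = T.vertex c' w') :
    c = c' := congrArg Sigma.fst h

theorem exists_vertex_eq (v : T.Vertex) : ∃ w, T.vertex v.1 w = v := by
  obtain ⟨c, q⟩ := v
  induction q using Quotient.inductionOn with
  | h w => exact ⟨w, rfl⟩

@[simp] theorem glue_rot (c : Color) (w : W) :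
    T.glue (c + 1) (T.rot c w) = T.glue (c + 2) w := by simp [rot]

@[simp] theorem vertex_rot (c : Color) (w : W) : T.vertex c (T.rot c w) = T.vertex c w :=
  T.vertex_eq_iff.2 (Equiv.Perm.SameCycle.symm ⟨1, by simp⟩)

/-- The edge of colour `d ≠ c` of a white triangle contains its vertex of colour `c`. -/
theorem blackVertex_glue {c d : Color} (h : d ≠ c) (w : W) :
    T.blackVertex c (T.glue d w) = T.vertex c w := by
  rcases Color.cases c d with rfl | rfl | rfl
  · exact absurd rfl h
  · simp [blackVertex]
  · rw [← glue_rot, blackVertex, Equiv.symm_apply_apply, vertex_rot]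

theorem vertex_glue_symm {c d : Color} (h : d ≠ c) (b : B) :
    T.vertex c ((T.glue d).symm b) = T.blackVertex c b := by
  rw [← T.blackVertex_glue h]; simp

theorem exists_blackVertex_eq (v : T.Vertex) : ∃ b, T.blackVertex v.1 b = v := by
  obtain ⟨w, hw⟩ := T.exists_vertex_eq v
  exact ⟨T.glue (v.1 + 1) w, by rw [T.blackVertex_glue (by simp), hw]⟩

/-- A property of white triangles that passes between neighbours passes everywhere. -/
theorem Connected.induction {T : Gluing W B} (hT : T.Connected) {p : W → Prop}
    (h : ∀ b c d, p ((T.glue c).symm b) → p ((T.glue d).symm b)) {w : W} (hw : p w) (w' : W) :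
    p w' := by
  induction hT.2 w w' with
  | refl => exact hw
  | tail _ hyz ih =>
    obtain ⟨c, d, hcd⟩ := hyz
    have := h (T.glue c _) c d (by rwa [Equiv.symm_apply_apply])
    rwa [hcd, Equiv.symm_apply_apply] at this

theorem connected_of_induction [Nonempty W]
    (hT : ∀ p : W → Prop, (∀ b c d, p ((T.glue c).symm b) → p ((T.glue d).symm b)) →
      ∀ w w', p w → p w') : T.Connected := by
  refine ⟨inferInstance, fun w w' => ?_⟩
  refine hT (fun w' => Relation.ReflTransGen (fun x y => ∃ c d, T.glue c x = T.glue d y) w w')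
    (fun b c d h => h.tail ⟨c, d, by simp⟩) w w' Relation.ReflTransGen.refl

/-- A function of black triangles that agrees on the neighbours of each white triangle is
constant. -/
theorem Connected.eq_of_forall_glue {T : Gluing W B} (hT : T.Connected) {α : Type*} {h : B → α}
    (hh : ∀ w c d, h (T.glue c w) = h (T.glue d w)) (b b' : B) : h b = h b' := by
  have key := hT.induction (p := fun w => ∀ c, h (T.glue c w) = h b)
    (fun b₁ c d h₁ e => by
      rw [hh _ e d]
      have := h₁ c
      simp only [Equiv.apply_symm_apply] at this ⊢
      exact this) (w := (T.glue 0).symm b)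
    (fun c => by rw [hh _ c 0]; simp) ((T.glue 0).symm b') 0
  simpa using key.symm

/-! ### Chains -/

/-- The difference of a function of black triangles across the edges between white triangles and
their vertices. -/
def faceDiff : (B → ℚ) →ₗ[ℚ] (W × Color → ℚ) where
  toFun h e := h (T.glue (e.2 + 1) e.1) - h (T.glue (e.2 + 2) e.1)
  map_add' h h' := by ext e; simp; ring
  map_smul' a h := by ext e; simp; ring

/-- The sum of a function of white triangles and vertices over the ends of the edges between white
triangles and their vertices. -/
def endSum : (W ⊕ T.Vertex → ℚ) →ₗ[ℚ] (W × Color → ℚ) where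
  toFun u e := u (Sum.inl e.1) + u (Sum.inr (T.vertex e.2 e.1))
  map_add' h h' := by ext e; simp; ring
  map_smul' a h := by ext e; simp; ring

theorem faceDiff_apply (h : B → ℚ) (w : W) (c : Color) :
    T.faceDiff h (w, c) = h (T.glue (c + 1) w) - h (T.glue (c + 2) w) := rfl

theorem endSum_apply (u : W ⊕ T.Vertex → ℚ) (w : W) (c : Color) :
    T.endSum u (w, c) = u (Sum.inl w) + u (Sum.inr (T.vertex c w)) := rfl

/-- The boundary of a face is an alternating sum around each node. At a white triangle the three
differences cancel cyclically; at a vertex they telescope along the permutation `rot c`. -/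
theorem sum_faceDiff_mul_endSum [Fintype W] (h : B → ℚ) (u : W ⊕ T.Vertex → ℚ) :
    ∑ e, T.faceDiff h e * T.endSum u e = 0 := by
  rw [Fintype.sum_prod_type]
  simp only [faceDiff_apply, endSum_apply, mul_add, Finset.sum_add_distrib]
  have h1 : ∀ w, ∑ c : Color, (h (T.glue (c + 1) w) - h (T.glue (c + 2) w)) * u (Sum.inl w) = 0 := by
    intro w
    rw [Color.sum_eq _ 0]
    simp only [Color.add_one_add_one, Color.add_one_add_two, Color.add_two_add_one,
      Color.add_two_add_two]
    ring
  rw [Finset.sum_congr rfl fun w _ => h1 w, Finset.sum_const_zero, zero_add, Finset.sum_comm]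
  refine Finset.sum_eq_zero fun c _ => ?_
  simp only [sub_mul, Finset.sum_sub_distrib]
  rw [sub_eq_zero, ← Equiv.sum_comp (T.rot c)]
  simp

theorem eq_of_faceDiff_eq_zero {h : B → ℚ} {w : W} (hw : ∀ c, T.faceDiff h (w, c) = 0)
    (c d : Color) : h (T.glue c w) = h (T.glue d w) := by
  have h0 := hw (c + 2)
  have h1 := hw (c + 1)
  simp only [faceDiff_apply, Color.add_one_add_one, Color.add_one_add_two, Color.add_two_add_one,
      Color.add_two_add_two] at h0 h1
  rcases Color.cases c d with rfl | rfl | rfl <;> linarith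

theorem eq_of_faceDiff_eq {h h' : B → ℚ} (hT : T.Connected) (hh : T.faceDiff h = T.faceDiff h')
    {b₀ : B} (h₀ : h b₀ = h' b₀) : h = h' := by
  have h1 : T.faceDiff (h - h') = 0 := by rw [map_sub, hh, sub_self]
  ext b
  have := hT.eq_of_forall_glue (h := h - h')
    (fun w c d => T.eq_of_faceDiff_eq_zero (fun c => by rw [h1]; rfl) c d) b b₀
  simp only [Pi.sub_apply, h₀, sub_self] at this
  linarith

theorem finrank_ker_faceDiff_le (hT : T.Connected) :
    Module.finrank ℚ (LinearMap.ker T.faceDiff) ≤ 1 := by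
  obtain ⟨w⟩ := hT.1
  refine finrank_le_one (⟨fun _ => 1, ?_⟩ : LinearMap.ker T.faceDiff) ?_
  · rw [LinearMap.mem_ker]; ext e; simp [faceDiff]
  · rintro ⟨h, hh⟩
    refine ⟨h (T.glue 0 w), Subtype.ext ?_⟩
    ext b
    rw [LinearMap.mem_ker] at hh
    simpa using hT.eq_of_forall_glue
      (fun w c d => T.eq_of_faceDiff_eq_zero (fun c => by rw [hh]; rfl) c d) (T.glue 0 w) b

theorem finrank_ker_endSum_le (hT : T.Connected) :
    Module.finrank ℚ (LinearMap.ker T.endSum) ≤ 1 := by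
  obtain ⟨w⟩ := hT.1
  refine finrank_le_one
    (⟨Sum.elim (fun _ => 1) (fun _ => -1), ?_⟩ : LinearMap.ker T.endSum) ?_
  · rw [LinearMap.mem_ker]; ext e; simp [endSum]
  · rintro ⟨u, hu⟩
    rw [LinearMap.mem_ker] at hu
    have hu' : ∀ w c, u (Sum.inr (T.vertex c w)) = - u (Sum.inl w) := by
      intro w c
      have := congrFun hu (w, c)
      rw [endSum_apply] at this
      simp only [Pi.zero_apply] at this
      linarith
    have key := hT.induction (p := fun w' => u (Sum.inl w') = u (Sum.inl w))
      (fun b c d h => by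
        by_cases hcd : c = d
        · rwa [← hcd]
        -- Two white neighbours of a black triangle share its vertex of the third colour, where both
        -- values are the negative of the value at that vertex.
        · obtain ⟨e, hec, hed⟩ : ∃ e, c ≠ e ∧ d ≠ e := Color.exists_ne_ne c d
          have h1 := hu' ((T.glue c).symm b) e
          have h2 := hu' ((T.glue d).symm b) e
          rw [T.vertex_glue_symm hec] at h1
          rw [T.vertex_glue_symm hed] at h2
          linarith) (w := w) rfl
    refine ⟨u (Sum.inl w), Subtype.ext ?_⟩
    ext x
    rcases x with w' | v
    · simpa using (key w').symm
    · obtain ⟨w', hw'⟩ := T.exists_vertex_eq v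
      rw [← hw']
      simp [hu', key w']

/-- The Euler characteristic of a connected surface is at most `2`. -/
theorem card_vertex_le [Finite W] (hT : T.Connected) : Nat.card T.Vertex ≤ Nat.card W + 2 := by
  have := Fintype.ofFinite W
  have : Finite B := Finite.of_equiv W (T.glue 0)
  have h := card_add_card_le_of_orthogonal T.faceDiff T.endSum T.sum_faceDiff_mul_endSum
    (T.finrank_ker_faceDiff_le hT) (T.finrank_ker_endSum_le hT)
  rw [Nat.card_sum, Nat.card_prod, ← Nat.card_congr (T.glue 0)] at h
  simp at h
  simp
  omega

/-- On the sphere, cycles are boundaries. -/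
theorem exists_faceDiff_eq [Fintype W] (hT : T.Connected) (hT' : T.EulerTwo) {x : W × Color → ℚ}
    (hx : ∀ u, ∑ e, x e * T.endSum u e = 0) : ∃ h, T.faceDiff h = x := by
  have : Finite B := Finite.of_equiv W (T.glue 0)
  refine mem_range_of_orthogonal T.faceDiff T.endSum T.sum_faceDiff_mul_endSum
    (T.finrank_ker_faceDiff_le hT) (T.finrank_ker_endSum_le hT) ?_ hx
  unfold EulerTwo at hT'
  rw [Nat.card_sum, Nat.card_prod, ← Nat.card_congr (T.glue 0)]
  simp at hT' ⊢
  omega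

/-- If the boundary chain of `h` is nonnegative around a vertex, except at one white triangle, then
`h` is maximal around this vertex next to this triangle. -/
theorem le_of_faceDiff_nonneg [Finite W] {h : B → ℚ} {c : Color} {w : W}
    (hx : ∀ u, T.vertex c u = T.vertex c w → u ≠ w → 0 ≤ T.faceDiff h (u, c)) {b : B}
    (hb : T.blackVertex c b = T.vertex c w) : h b ≤ h (T.glue (c + 2) w) := by
  have key : ∀ i : ℕ, h (T.glue (c + 2) ((T.rot c ^ i) w)) ≤ h (T.glue (c + 2) w) := by
    intro i
    induction i with
    | zero => simp
    | succ i ih =>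
      rw [pow_succ', Equiv.Perm.mul_apply]
      -- Turning away from `w`, the values of `h` never increase until the turn comes back to `w`,
      -- where it starts anew.
      by_cases hi : T.rot c ((T.rot c ^ i) w) = w
      · rw [hi]
      · have h1 := hx (T.rot c ((T.rot c ^ i) w)) (T.vertex_eq_iff.2
          (Equiv.Perm.SameCycle.symm ⟨i + 1, by
            rw [← Equiv.Perm.mul_apply, ← pow_succ']; norm_cast⟩)) hi
        rw [faceDiff_apply, glue_rot] at h1
        linarith
  rw [← T.vertex_glue_symm (d := c + 2) (by simp), eq_comm, T.vertex_eq_iff] at hb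
  obtain ⟨i, hi⟩ := hb.exists_nat_pow_eq
  have := key i
  rw [hi] at this
  simpa using this

end Gluing

namespace Gluing

variable {W B : Type*} (T : Gluing W B)

/-! ### Regions -/

/-- The white triangles with an edge on a black triangle of the region `D`. -/
def regionTriangles (D : Set B) : Set W := {w | ∃ c, T.glue c w ∈ D}

/-- The vertices of the black triangles of the region `D`. -/
def regionVertices (D : Set B) : Set T.Vertex := {v | ∃ b ∈ D, T.blackVertex v.1 b = v}

/-- The edges between white triangles and their vertices that are incident to the region `D`. -/
def regionEdges (D : Set B) : Set (W × Color) :=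
  {e | T.glue (e.2 + 1) e.1 ∈ D ∨ T.glue (e.2 + 2) e.1 ∈ D}

/-- A region `D` of black triangles bounded by a cycle that follows the white triangles in `K`: of
such a triangle, only the edge of colour `col w + 2` is incident to `D`, and it connects the
vertices of colours `col w` and `col w + 1`; the cycle continues with the triangle `f w`. -/
structure IsRegion (D : Set B) (K : Finset W) (col : W → Color) (f : W → W) : Prop where
  nonempty : K.Nonempty
  glue_mem_iff : ∀ w ∈ K, ∀ d, T.glue d w ∈ D ↔ d = col w + 2
  glue_mem : ∀ w ∉ K, ∀ c d, T.glue c w ∈ D → T.glue d w ∈ D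
  vertex_eq : ∀ w ∈ K, T.vertex (col (f w)) (f w) = T.vertex (col w + 1) w
  mapsTo : ∀ w ∈ K, f w ∈ K
  trans : ∀ w ∈ K, ∀ w' ∈ K, ∃ n, f^[n] w = w'

variable {T} {D : Set B} {K : Finset W} {col : W → Color} {f : W → W}

theorem IsRegion.exists_notMem (hD : T.IsRegion D K col f) : ∃ b, b ∉ D := by
  obtain ⟨w, hw⟩ := hD.nonempty
  exact ⟨T.glue (col w) w, by simp [hD.glue_mem_iff w hw]⟩

theorem vertex_mem_regionVertices {w : W} {c : Color} (h : (w, c) ∈ T.regionEdges D) :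
    T.vertex c w ∈ T.regionVertices D := by
  rcases h with h | h
  · exact ⟨_, h, T.blackVertex_glue (by simp) w⟩
  · exact ⟨_, h, T.blackVertex_glue (by simp) w⟩

theorem mem_regionTriangles_of_mem_regionEdges {w : W} {c : Color}
    (h : (w, c) ∈ T.regionEdges D) : w ∈ T.regionTriangles D :=
  h.elim (fun h => ⟨_, h⟩) fun h => ⟨_, h⟩

theorem mem_regionEdges_of_ne {w : W} {c d : Color} (hd : d ≠ c) (h : T.glue d w ∈ D) :
    (w, c) ∈ T.regionEdges D := by
  rcases Color.cases c d with rfl | rfl | rfl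
  · exact absurd rfl hd
  · exact Or.inl h
  · exact Or.inr h

theorem IsRegion.mem_regionEdges (hD : T.IsRegion D K col f) {w : W} (hw : w ∈ K) :
    (w, col w) ∈ T.regionEdges D ∧ (w, col w + 1) ∈ T.regionEdges D :=
  ⟨Or.inr ((hD.glue_mem_iff w hw _).2 rfl), Or.inl ((hD.glue_mem_iff w hw _).2 (by simp))⟩

theorem IsRegion.mem_regionTriangles (hD : T.IsRegion D K col f) {w : W} (hw : w ∈ K) :
    w ∈ T.regionTriangles D := ⟨_, (hD.glue_mem_iff w hw _).2 rfl⟩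

/-- Counted at the white triangles: an interior one contributes three edges, one on the boundary
cycle only two. -/
theorem IsRegion.card_edges (hD : T.IsRegion D K col f) [Finite W] :
    (T.regionEdges D).ncard + K.card = 3 * (T.regionTriangles D).ncard := by
  classical
  have := Fintype.ofFinite W
  have h1 : (T.regionEdges D).ncard = ∑ w, ∑ c, if (w, c) ∈ T.regionEdges D then 1 else 0 := by
    rw [← Fintype.sum_prod_type' (f := fun w c => if (w, c) ∈ T.regionEdges D then 1 else 0),
      Set.ncard_eq_toFinset_card', Finset.card_eq_sum_ones, ← Finset.sum_filter]
    exact Finset.sum_congr (by ext; simp) fun _ _ => rfl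
  have h2 : (T.regionTriangles D).ncard = ∑ w, if w ∈ T.regionTriangles D then 1 else 0 := by
    rw [Set.ncard_eq_toFinset_card', Finset.card_eq_sum_ones, ← Finset.sum_filter]
    exact Finset.sum_congr (by ext; simp) fun _ _ => rfl
  have h3 : K.card = ∑ w, if w ∈ K then 1 else 0 := by simp
  rw [h1, h2, h3, Finset.mul_sum, ← Finset.sum_add_distrib]
  refine Finset.sum_congr rfl fun w _ => ?_
  by_cases hw : w ∈ K
  · rw [Color.sum_eq _ (col w), if_pos (hD.mem_regionEdges hw).1, if_pos (hD.mem_regionEdges hw).2,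
      if_neg (by simp [regionEdges, hD.glue_mem_iff w hw]), if_pos hw,
      if_pos (hD.mem_regionTriangles hw)]
    rfl
  · by_cases hw' : w ∈ T.regionTriangles D
    · obtain ⟨c, hc⟩ := hw'
      have h : ∀ c, (w, c) ∈ T.regionEdges D := fun d => Or.inl (hD.glue_mem w hw c _ hc)
      simp only [h, hw, if_true, if_false, if_pos (show w ∈ T.regionTriangles D from ⟨c, hc⟩)]
      simp
    · have h : ∀ c, (w, c) ∉ T.regionEdges D :=
        fun c h => hw' (mem_regionTriangles_of_mem_regionEdges h)
      simp [h, hw, hw']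

/-- Adjacencies of black and white triangles are counted twice: three for each black triangle of
`D`, and at the white triangles three in the interior but one on the boundary cycle. -/
theorem IsRegion.card_faces (hD : T.IsRegion D K col f) [Finite W] :
    3 * D.ncard + 2 * K.card = 3 * (T.regionTriangles D).ncard := by
  classical
  have := Fintype.ofFinite W
  have : Finite B := Finite.of_equiv W (T.glue 0)
  have h1 : ∀ c, D.ncard = ∑ w, if T.glue c w ∈ D then 1 else 0 := by
    intro c
    have := Fintype.ofFinite B
    rw [Equiv.sum_comp (T.glue c) (fun b => if b ∈ D then 1 else 0),
      Set.ncard_eq_toFinset_card', Finset.card_eq_sum_ones, ← Finset.sum_filter]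
    exact Finset.sum_congr (by ext; simp) fun _ _ => rfl
  have h1' : 3 * D.ncard = ∑ w, ∑ c, if T.glue c w ∈ D then 1 else 0 := by
    rw [Finset.sum_comm, ← Finset.sum_congr rfl fun c _ => h1 c]
    simp
  have h2 : (T.regionTriangles D).ncard = ∑ w, if w ∈ T.regionTriangles D then 1 else 0 := by
    rw [Set.ncard_eq_toFinset_card', Finset.card_eq_sum_ones, ← Finset.sum_filter]
    exact Finset.sum_congr (by ext; simp) fun _ _ => rfl
  have h3 : K.card = ∑ w, if w ∈ K then 1 else 0 := by simp
  rw [h1', h2, h3, Finset.mul_sum, Finset.mul_sum, ← Finset.sum_add_distrib]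
  refine Finset.sum_congr rfl fun w _ => ?_
  by_cases hw : w ∈ K
  · simp [hD.glue_mem_iff w hw, hw, hD.mem_regionTriangles hw]
  · by_cases hw' : w ∈ T.regionTriangles D
    · obtain ⟨c, hc⟩ := hw'
      have h : ∀ c, T.glue c w ∈ D := fun d => hD.glue_mem w hw c _ hc
      simp only [h, hw, if_true, if_false, if_pos (show w ∈ T.regionTriangles D from ⟨c, hc⟩)]
      simp
    · have h : ∀ c, T.glue c w ∉ D := fun c h => hw' ⟨c, h⟩
      simp [h, hw, hw']

theorem extend_val_apply {α : Type*} {s : Set α} (h : s → ℚ) {x : α} (hx : x ∈ s) :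
    Function.extend Subtype.val h (0 : α → ℚ) x = h ⟨x, hx⟩ :=
  Subtype.val_injective.extend_apply h (0 : α → ℚ) ⟨x, hx⟩

theorem extend_val_apply_of_notMem {α : Type*} {s : Set α} (h : s → ℚ) {x : α} (hx : x ∉ s) :
    Function.extend Subtype.val h (0 : α → ℚ) x = 0 :=
  Function.extend_apply' h (0 : α → ℚ) x fun ⟨y, hy⟩ => hx (hy ▸ y.2)

/-- White triangles and vertices that are incident to the region `D`. -/
def regionNodes (T : Gluing W B) (D : Set B) : Set (W ⊕ T.Vertex) :=
  Sum.inl '' T.regionTriangles D ∪ Sum.inr '' T.regionVertices D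

theorem card_regionNodes [Finite W] : (T.regionNodes D).ncard =
    (T.regionTriangles D).ncard + (T.regionVertices D).ncard := by
  rw [regionNodes, Set.ncard_union_eq (by
    rw [Set.disjoint_left]; rintro _ ⟨x, -, rfl⟩ ⟨y, -, h⟩; cases h),
    Set.ncard_image_of_injective _ Sum.inl_injective,
    Set.ncard_image_of_injective _ Sum.inr_injective]

/-- The Euler characteristic of a region bounded by a cycle is at most `1`. -/
theorem IsRegion.euler_le (hD : T.IsRegion D K col f) (hT : T.Connected) [Finite W] :
    D.ncard + ((T.regionTriangles D).ncard + (T.regionVertices D).ncard) ≤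
      (T.regionEdges D).ncard + 1 := by
  classical
  have := Fintype.ofFinite W
  have : Finite B := Finite.of_equiv W (T.glue 0)
  let r : (W × Color → ℚ) →ₗ[ℚ] (T.regionEdges D → ℚ) := LinearMap.funLeft ℚ ℚ Subtype.val
  let δ : (D → ℚ) →ₗ[ℚ] (T.regionEdges D → ℚ) :=
    r ∘ₗ T.faceDiff ∘ₗ Function.ExtendByZero.linearMap ℚ Subtype.val
  let d : (T.regionNodes D → ℚ) →ₗ[ℚ] (T.regionEdges D → ℚ) :=
    r ∘ₗ T.endSum ∘ₗ Function.ExtendByZero.linearMap ℚ Subtype.val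
  have hδ : ∀ h e, δ h e = T.faceDiff (Function.extend Subtype.val h 0) e := fun h e => rfl
  have hd : ∀ u e, d u e = T.endSum (Function.extend Subtype.val u 0) e := fun u e => rfl
  have hout : ∀ (h : D → ℚ) e, e ∉ T.regionEdges D →
      T.faceDiff (Function.extend Subtype.val h 0) e = 0 := by
    rintro h ⟨w, c⟩ he
    simp only [regionEdges, Set.mem_ofPred_eq, not_or] at he
    rw [faceDiff_apply, extend_val_apply_of_notMem h he.1, extend_val_apply_of_notMem h he.2,
      sub_zero]
  have orth : ∀ h u, ∑ e, δ h e * d u e = 0 := by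
    intro h u
    have h1 := T.sum_faceDiff_mul_endSum (Function.extend Subtype.val h 0)
      (Function.extend Subtype.val u 0)
    rw [← Finset.sum_filter_of_ne (p := (· ∈ T.regionEdges D))] at h1
    · rw [← h1]
      simp only [hδ, hd]
      exact (Finset.sum_subtype (p := (· ∈ T.regionEdges D)) _ (by simp)
        (fun e => T.faceDiff (Function.extend Subtype.val h 0) e *
          T.endSum (Function.extend Subtype.val u 0) e)).symm
    · intro e _ he
      by_contra hne
      exact he (by rw [hout h e hne, zero_mul])
  -- A function in the kernel, extended by zero, is constant on the whole connected surface, and it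
  -- vanishes at a black triangle outside `D`.
  have kδ : Module.finrank ℚ (LinearMap.ker δ) ≤ 0 := by
    rw [Nat.le_zero, Submodule.finrank_eq_zero, LinearMap.ker_eq_bot']
    intro h hh
    obtain ⟨b₀, hb₀⟩ := hD.exists_notMem
    have h1 : T.faceDiff (Function.extend Subtype.val h 0) = T.faceDiff 0 := by
      ext e
      by_cases he : e ∈ T.regionEdges D
      · rw [map_zero]
        exact congrFun hh ⟨e, he⟩
      · rw [map_zero, hout h e he]; rfl
    have h2 := T.eq_of_faceDiff_eq hT h1 (b₀ := b₀) (extend_val_apply_of_notMem h hb₀)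
    ext ⟨b, hb⟩
    rw [← extend_val_apply h hb, h2]; rfl
  have kd : Module.finrank ℚ (LinearMap.ker d) ≤ 1 := by
    have hl : ∀ {w c}, (w, c) ∈ T.regionEdges D → Sum.inl w ∈ T.regionNodes D :=
      fun h => Or.inl ⟨_, mem_regionTriangles_of_mem_regionEdges h, rfl⟩
    have hr : ∀ {w c}, (w, c) ∈ T.regionEdges D → Sum.inr (T.vertex c w) ∈ T.regionNodes D :=
      fun h => Or.inr ⟨_, vertex_mem_regionVertices h, rfl⟩
    refine finrank_le_one (⟨fun x => Sum.elim (fun _ => 1) (fun _ => -1) x.1, ?_⟩ :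
      LinearMap.ker d) ?_
    · rw [LinearMap.mem_ker]
      ext ⟨⟨w, c⟩, he⟩
      rw [hd, endSum_apply, extend_val_apply _ (hl he), extend_val_apply _ (hr he)]
      simp
    · rintro ⟨u, hu⟩
      rw [LinearMap.mem_ker] at hu
      set u' := Function.extend Subtype.val u 0 with hu'
      have h1 : ∀ {w c}, (w, c) ∈ T.regionEdges D →
          u' (Sum.inr (T.vertex c w)) = - u' (Sum.inl w) := by
        intro w c he
        have := congrFun hu ⟨(w, c), he⟩
        rw [hd, endSum_apply] at this
        simp only [Pi.zero_apply] at this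
        linarith
      obtain ⟨w₀, hw₀⟩ := hD.nonempty
      -- The boundary cycle connects its own triangles inside the region.
      have hK : ∀ w ∈ K, u' (Sum.inl w) = u' (Sum.inl w₀) := by
        intro w hw
        obtain ⟨n, rfl⟩ := hD.trans w₀ hw₀ w hw
        clear hw
        have hm : ∀ n, f^[n] w₀ ∈ K := by
          intro n
          induction n with
          | zero => exact hw₀
          | succ n ih => rw [Function.iterate_succ_apply']; exact hD.mapsTo _ ih
        induction n with
        | zero => rfl
        | succ n ih =>
          rw [Function.iterate_succ_apply', ← ih]
          have e1 := h1 (hD.mem_regionEdges (hm n)).2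
          have e2 := h1 (hD.mem_regionEdges (hD.mapsTo _ (hm n))).1
          rw [hD.vertex_eq _ (hm n)] at e2
          linarith
      -- The region inherits connectedness from the surface, since a chain of triangles can leave
      -- and reenter it only through `K`, where the value is already known.
      have key := hT.induction
        (p := fun w => w ∈ T.regionTriangles D → u' (Sum.inl w) = u' (Sum.inl w₀))
        (fun b c d h hd => by
          by_cases hdK : (T.glue d).symm b ∈ K
          · exact hK _ hdK
          by_cases hcd : c = d
          · subst hcd; exact h hd
          have hb : b ∈ D := by
            obtain ⟨e, he⟩ := hd
            simpa using hD.glue_mem _ hdK e d he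
          obtain ⟨e, hec, hed⟩ : ∃ e, c ≠ e ∧ d ≠ e := Color.exists_ne_ne c d
          have m1 : T.glue c ((T.glue c).symm b) ∈ D := by simpa using hb
          have m2 : T.glue d ((T.glue d).symm b) ∈ D := by simpa using hb
          have e1 := h1 (mem_regionEdges_of_ne hec m1)
          have e2 := h1 (mem_regionEdges_of_ne hed m2)
          rw [T.vertex_glue_symm hec] at e1
          rw [T.vertex_glue_symm hed] at e2
          have := h ⟨c, m1⟩
          linarith) (w := w₀) (fun _ => rfl)
      refine ⟨u' (Sum.inl w₀), Subtype.ext ?_⟩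
      ext ⟨x, hx⟩
      change u' (Sum.inl w₀) * Sum.elim (fun _ => (1 : ℚ)) (fun _ => -1) x = u ⟨x, hx⟩
      rw [← extend_val_apply u hx, ← hu']
      rcases x with w | v
      · have hw : w ∈ T.regionTriangles D := by
          rcases hx with ⟨_, h, h'⟩ | ⟨_, h, h'⟩
          · cases h'; exact h
          · cases h'
        simpa using (key w hw).symm
      · obtain ⟨b, hb, hv⟩ : v ∈ T.regionVertices D := by
          rcases hx with ⟨_, h, h'⟩ | ⟨_, h, h'⟩
          · cases h'
          · cases h'; exact h
        have hb' : T.glue (v.1 + 1) ((T.glue (v.1 + 1)).symm b) ∈ D := by simpa using hb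
        have e1 := h1 (mem_regionEdges_of_ne (c := v.1) (by simp) hb')
        rw [T.vertex_glue_symm (by simp), hv, key _ ⟨_, hb'⟩] at e1
        simp [e1]
  have h := card_add_card_le_of_orthogonal δ d orth kδ kd
  rw [Nat.card_coe_set_eq, Nat.card_coe_set_eq, Nat.card_coe_set_eq, card_regionNodes] at h
  exact h

theorem IsRegion.card_vertices_le (hD : T.IsRegion D K col f) (hT : T.Connected) [Finite W] :
    3 * (T.regionVertices D).ncard + K.card ≤ 3 * (T.regionTriangles D).ncard + 3 := by
  have h1 := hD.euler_le hT
  have h2 := hD.card_faces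
  have h3 := hD.card_edges
  omega

end Gluing

namespace PlanarTrinity

variable {W B : Type*} {T : PlanarTrinity W B}

/-! ### States -/

theorem root_injective (T : PlanarTrinity W B) : Function.Injective T.root :=
  fun _ _ h => T.color_eq_of_vertex_eq h

namespace State

open Classical in
/-- The colour of the vertex matched to a non-outer white triangle. -/
noncomputable def color (s : T.State) (w : W) : Color :=
  if h : w ≠ T.outer then (s.incident ⟨w, h⟩).choose else 0

theorem matches_color (s : T.State) {w : W} (h : w ≠ T.outer) :
    s.Matches w (T.vertex (s.color w) w) := by
  refine ⟨h, ?_⟩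
  rw [color, dif_pos h]
  exact (s.incident ⟨w, h⟩).choose_spec

variable {s t : T.State} {w w' : W} {v v' : T.Vertex} {c : Color}

theorem Matches.ne_outer (h : s.Matches w v) : w ≠ T.outer := h.1

theorem Matches.ne_root (h : s.Matches w v) (c : Color) : v ≠ T.root c := by
  obtain ⟨h1, h2⟩ := h
  rw [← h2]
  exact (s.toEquiv ⟨w, h1⟩).2 c

theorem Matches.vertex_eq (h : s.Matches w v) (h' : s.Matches w v') : v = v' := by
  obtain ⟨h1, rfl⟩ := h
  obtain ⟨h1', rfl⟩ := h'
  rfl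

theorem Matches.triangle_eq (h : s.Matches w v) (h' : s.Matches w' v) : w = w' := by
  obtain ⟨h1, h2⟩ := h
  obtain ⟨h1', h2'⟩ := h'
  have := s.toEquiv.injective (Subtype.ext (h2.trans h2'.symm))
  exact congrArg Subtype.val this

theorem Matches.eq_vertex_color (h : s.Matches w v) : v = T.vertex (s.color w) w :=
  h.vertex_eq (s.matches_color h.ne_outer)

theorem matches_vertex_iff : s.Matches w (T.vertex c w) ↔ w ≠ T.outer ∧ s.color w = c := by
  constructor
  · intro h
    exact ⟨h.ne_outer, (T.color_eq_of_vertex_eq h.eq_vertex_color).symm⟩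
  · rintro ⟨h, rfl⟩
    exact s.matches_color h

theorem Matches.color_eq (h : s.Matches w (T.vertex c w')) : s.color w = c :=
  (T.color_eq_of_vertex_eq h.eq_vertex_color).symm

theorem exists_matches (s : T.State) (hv : ∀ c, v ≠ T.root c) : ∃ w, s.Matches w v :=
  ⟨s.toEquiv.symm ⟨v, hv⟩, (s.toEquiv.symm ⟨v, hv⟩).2, by simp⟩

theorem ext_matches (h : ∀ w v, s.Matches w v → t.Matches w v) : s = t := by
  have : s.toEquiv = t.toEquiv := by
    ext ⟨w, hw⟩
    exact (h w _ ⟨hw, rfl⟩).2.symm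
  cases s; cases t; cases this; rfl

theorem ext_color (h : ∀ w, w ≠ T.outer → s.color w = t.color w) : s = t :=
  ext_matches fun w v hv => by
    rw [hv.eq_vertex_color, h w hv.ne_outer]
    exact t.matches_color hv.ne_outer

instance [Finite W] : Finite T.State :=
  Finite.of_injective (fun s : T.State => s.toEquiv) fun s t h => by cases s; cases t; cases h; rfl

/-- A permutation of the white triangles that moves them to matching triangles of incident vertices
gives a state. -/
theorem exists_of_perm (s : T.State) (p : Equiv.Perm {w : W // w ≠ T.outer})
    (hp : ∀ w, ∃ c, (s.toEquiv (p w) : T.Vertex) = T.vertex c w) :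
    ∃ t : T.State, ∀ w v, s.Matches (p w : W) v → t.Matches w v :=
  ⟨⟨p.trans s.toEquiv, hp⟩, fun w _ h => ⟨w.2, h.2⟩⟩

/-! ### Heights -/

open Classical in
/-- The characteristic function of a state on the edges between white triangles and their
vertices. -/
noncomputable def chain (s : T.State) (e : W × Color) : ℚ :=
  if s.Matches e.1 (T.vertex e.2 e.1) then 1 else 0

theorem chain_apply_color (s : T.State) (hw : w ≠ T.outer) (c : Color) :
    s.chain (w, c) = if s.color w = c then 1 else 0 := by
  simp [chain, matches_vertex_iff, hw]

theorem chain_outer (s : T.State) (c : Color) : s.chain (T.outer, c) = 0 := by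
  simp [chain, matches_vertex_iff]

/-- A perfect matching covers each admissible node once, so this pairing does not depend on `s`.
Differences of states are therefore orthogonal to the range of `endSum`. -/
theorem sum_chain_mul_endSum [Fintype W] (s : T.State) (u : W ⊕ T.Vertex → ℚ) :
    ∑ e, s.chain e * T.endSum u e =
      ∑ᶠ w : {w : W // w ≠ T.outer}, u (Sum.inl w.1) +
        ∑ᶠ v : {v : T.Vertex // ∀ c, v ≠ T.root c}, u (Sum.inr v.1) := by
  classical
  have h1 : ∀ w, ∑ c, s.chain (w, c) * T.endSum u (w, c) =
      if w ≠ T.outer then u (Sum.inl w) + u (Sum.inr (T.vertex (s.color w) w)) else 0 := by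
    intro w
    by_cases hw : w = T.outer
    · subst hw; simp [chain_outer]
    · simp [chain_apply_color s hw, Gluing.endSum_apply, hw]
  rw [Fintype.sum_prod_type, Finset.sum_congr rfl fun w _ => h1 w, ← Finset.sum_filter,
    Finset.sum_subtype (p := fun w => w ≠ T.outer) _ (by simp), Finset.sum_add_distrib,
    finsum_eq_sum_of_fintype, ← finsum_comp_equiv s.toEquiv, finsum_eq_sum_of_fintype]
  congr 1
  refine Finset.sum_congr rfl fun w _ => ?_
  rw [(s.matches_color w.2).vertex_eq ⟨w.2, rfl⟩]

end State

/-- The function `h` of black triangles is the height of the state `t` relative to `s`. -/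
structure IsHeight (s t : T.State) (h : B → ℚ) : Prop where
  faceDiff_eq : T.faceDiff h = t.chain - s.chain
  outer : h (T.glue 0 T.outer) = 0

theorem exists_isHeight [Finite W] (s t : T.State) : ∃ h, IsHeight s t h := by
  have := Fintype.ofFinite W
  obtain ⟨h, hh⟩ := T.exists_faceDiff_eq T.connected T.eulerTwo (x := t.chain - s.chain) (by
    intro u
    simp only [Pi.sub_apply, sub_mul, Finset.sum_sub_distrib, State.sum_chain_mul_endSum, sub_self])
  -- Constants lie in the kernel of `faceDiff`, so the height may be normalized.
  refine ⟨h - fun _ => h (T.glue 0 T.outer), ?_, by simp⟩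
  rw [map_sub, hh, sub_eq_self]
  ext e; simp [Gluing.faceDiff]

namespace IsHeight

variable {s t u : T.State} {h h' : B → ℚ}

theorem unique (hh : IsHeight s t h) (hh' : IsHeight s t h') : h = h' :=
  T.eq_of_faceDiff_eq T.connected (hh.faceDiff_eq.trans hh'.faceDiff_eq.symm)
    (hh.outer.trans hh'.outer.symm)

theorem add (hh : IsHeight s t h) (hh' : IsHeight t u h') : IsHeight s u (h + h') :=
  ⟨by rw [map_add, hh.faceDiff_eq, hh'.faceDiff_eq]; abel, by simp [hh.outer, hh'.outer]⟩

theorem neg (hh : IsHeight s t h) : IsHeight t s (-h) :=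
  ⟨by rw [map_neg, hh.faceDiff_eq]; abel, by simp [hh.outer]⟩

theorem eq_of_eq_zero (hh : IsHeight s t 0) : s = t := by
  have h1 := hh.faceDiff_eq
  rw [map_zero] at h1
  refine State.ext_color fun w hw => ?_
  have h2 := congrFun h1 (w, t.color w)
  simp only [Pi.zero_apply, Pi.sub_apply, State.chain_apply_color _ hw] at h2
  by_contra hne
  simp [hne] at h2

theorem glue_outer (hh : IsHeight s t h) (c : Color) : h (T.glue c T.outer) = 0 := by
  rw [← hh.outer]
  refine T.eq_of_faceDiff_eq_zero (fun c => ?_) c 0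
  rw [hh.faceDiff_eq]
  simp [State.chain_outer]

/-- No state uses an edge at a root, so the height does not change around the root and is compared
with its value next to the outer triangle. The other inequality comes from exchanging `s` and `t`.
-/
theorem nonpos_of_blackVertex_eq_root [Finite W] (hh : IsHeight s t h) {c : Color} {b : B}
    (hb : T.blackVertex c b = T.root c) : h b ≤ 0 := by
  rw [← hh.glue_outer (c + 2)]
  refine T.le_of_faceDiff_nonneg (fun u hu _ => ?_) hb
  rw [hh.faceDiff_eq]
  have h1 : ∀ s : T.State, s.chain (u, c) = 0 := fun s => by
    rw [State.chain, if_neg]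
    exact fun h => h.ne_root c hu
  simp [h1]

/-- Heights vanish at the roots. -/
theorem eq_zero_of_blackVertex_eq_root [Finite W] (hh : IsHeight s t h) {c : Color} {b : B}
    (hb : T.blackVertex c b = T.root c) : h b = 0 := by
  have h1 := hh.nonpos_of_blackVertex_eq_root hb
  have h2 := hh.neg.nonpos_of_blackVertex_eq_root hb
  simp only [Pi.neg_apply] at h2
  linarith

theorem apply_sub_apply (hh : IsHeight s t h) (w : W) (c : Color) :
    h (T.glue (c + 1) w) - h (T.glue (c + 2) w) = t.chain (w, c) - s.chain (w, c) := by
  rw [← Gluing.faceDiff_apply, hh.faceDiff_eq]; rfl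

end IsHeight

/-! ### Turning cycles -/

/-- A cycle in which every white triangle `w` is followed by the triangle `f w` that the state `s`
matches to the vertex of `w` whose colour comes after that of the vertex matched to `w`. -/
structure IsTurn (s : T.State) (K : Finset W) (f : W → W) : Prop where
  nonempty : K.Nonempty
  mapsTo : ∀ w ∈ K, f w ∈ K
  matches_vertex : ∀ w ∈ K, s.Matches (f w) (T.vertex (s.color w + 1) w)
  trans : ∀ w ∈ K, ∀ w' ∈ K, ∃ n, f^[n] w = w'

namespace IsTurn

variable {s : T.State} {K : Finset W} {f : W → W}

theorem iterate_mem (hK : IsTurn s K f) {w : W} (hw : w ∈ K) (n : ℕ) : f^[n] w ∈ K := by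
  induction n with
  | zero => exact hw
  | succ n ih => rw [Function.iterate_succ_apply']; exact hK.mapsTo _ ih

theorem surjOn (hK : IsTurn s K f) {w : W} (hw : w ∈ K) : ∃ u ∈ K, f u = w := by
  obtain ⟨n, hn⟩ := hK.trans _ (hK.mapsTo w hw) w hw
  refine ⟨_, hK.iterate_mem hw n, ?_⟩
  rwa [← Function.iterate_succ_apply, Function.iterate_succ_apply'] at hn

theorem injOn (hK : IsTurn s K f) : Set.InjOn f K :=
  Finset.injOn_of_surjOn_of_card_le f hK.mapsTo (fun _ hw => hK.surjOn hw) le_rfl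

theorem ne_outer (hK : IsTurn s K f) {w : W} (hw : w ∈ K) : w ≠ T.outer := by
  obtain ⟨u, hu, rfl⟩ := hK.surjOn hw
  exact (hK.matches_vertex u hu).ne_outer

theorem color_apply (hK : IsTurn s K f) {w : W} (hw : w ∈ K) : s.color (f w) = s.color w + 1 :=
  (hK.matches_vertex w hw).color_eq

theorem vertex_eq (hK : IsTurn s K f) {w : W} (hw : w ∈ K) :
    T.vertex (s.color (f w)) (f w) = T.vertex (s.color w + 1) w :=
  (hK.matches_vertex w hw).eq_vertex_color.symm

open Classical in
/-- The change of the chain of a state by the shift along a turning cycle. -/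
noncomputable def chain (s : T.State) (K : Finset W) (e : W × Color) : ℚ :=
  if e.1 ∈ K then (if e.2 = s.color e.1 + 1 then 1 else 0) - (if e.2 = s.color e.1 then 1 else 0)
  else 0

theorem chain_of_mem {w : W} (hw : w ∈ K) (c : Color) : chain s K (w, c) =
    (if c = s.color w + 1 then 1 else 0) - (if c = s.color w then 1 else 0) := by
  simp [chain, hw]

theorem chain_of_notMem {w : W} (hw : w ∉ K) (c : Color) : chain s K (w, c) = 0 := by
  simp [chain, hw]

/-- Shifting the matching along the cycle removes one edge and adds one edge at every node of it.
Since `f` permutes `K`, the total at each node is zero. -/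
theorem exists_faceDiff_eq_chain (hK : IsTurn s K f) [Finite W] :
    ∃ h, T.faceDiff h = chain s K := by
  classical
  have := Fintype.ofFinite W
  refine T.exists_faceDiff_eq T.connected T.eulerTwo fun u => ?_
  have h1 : ∀ w, ∑ c, chain s K (w, c) * T.endSum u (w, c) =
      if w ∈ K then u (Sum.inr (T.vertex (s.color (f w)) (f w))) -
        u (Sum.inr (T.vertex (s.color w) w)) else 0 := by
    intro w
    by_cases hw : w ∈ K
    · simp [chain_of_mem hw, Gluing.endSum_apply, hw, sub_mul, hK.vertex_eq hw]
    · simp [chain_of_notMem hw, hw]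
  rw [Fintype.sum_prod_type, Finset.sum_congr rfl fun w _ => h1 w, ← Finset.sum_filter,
    Finset.filter_mem_eq_inter, Finset.univ_inter, Finset.sum_sub_distrib, sub_eq_zero]
  exact Finset.sum_nbij f hK.mapsTo hK.injOn (fun w hw => hK.surjOn hw) fun _ _ => rfl

variable {h : B → ℚ}

/-- Around the vertex matched to `f w`, the only negative entry of the chain is at `f w`, so `h` is
maximal right after `f w`. The black triangle on the left-hand side touches this vertex too. -/
theorem le_apply (hK : IsTurn s K f) [Finite W] (hh : T.faceDiff h = chain s K) {w : W}
    (hw : w ∈ K) : h (T.glue (s.color w + 2) w) ≤ h (T.glue (s.color (f w) + 2) (f w)) := by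
  refine T.le_of_faceDiff_nonneg (fun u hu huw => ?_) ?_
  · rw [hh]
    by_cases huK : u ∈ K
    · rw [chain_of_mem huK, if_neg (c := s.color (f w) = s.color u)]
      · split_ifs <;> norm_num
      · intro hc
        refine huw ?_
        have h1 := s.matches_color (hK.ne_outer huK)
        rw [← hc, hu] at h1
        exact h1.triangle_eq (s.matches_color (hK.ne_outer (hK.mapsTo w hw)))
    · rw [chain_of_notMem huK]
  · rw [hK.vertex_eq hw, hK.color_apply hw]
    exact T.blackVertex_glue (by simp) w

/-- A function that does not decrease along a cycle is constant on it. -/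
theorem apply_eq (hK : IsTurn s K f) [Finite W] (hh : T.faceDiff h = chain s K) {w w' : W}
    (hw : w ∈ K) (hw' : w' ∈ K) :
    h (T.glue (s.color w + 2) w) = h (T.glue (s.color w' + 2) w') := by
  have key : ∀ w ∈ K, ∀ w' ∈ K,
      h (T.glue (s.color w + 2) w) ≤ h (T.glue (s.color w' + 2) w') := by
    intro w hw w' hw'
    obtain ⟨n, rfl⟩ := hK.trans w hw w' hw'
    clear hw'
    induction n with
    | zero => exact le_rfl
    | succ n ih =>
      rw [Function.iterate_succ_apply']
      exact ih.trans (hK.le_apply hh (hK.iterate_mem hw n))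
  exact le_antisymm (key w hw w' hw') (key w' hw' w hw)

theorem apply_glue_of_mem (hh : T.faceDiff h = chain s K) {w : W} (hw : w ∈ K) :
    h (T.glue (s.color w) w) = h (T.glue (s.color w + 2) w) - 1 ∧
      h (T.glue (s.color w + 1) w) = h (T.glue (s.color w + 2) w) - 1 := by
  have h1 := congrFun hh (w, s.color w)
  have h2 := congrFun hh (w, s.color w + 1)
  rw [Gluing.faceDiff_apply, chain_of_mem hw] at h1 h2
  simp at h1 h2
  constructor <;> linarith

theorem apply_glue_of_notMem (hh : T.faceDiff h = chain s K) {w : W} (hw : w ∉ K) (c d : Color) :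
    h (T.glue c w) = h (T.glue d w) :=
  T.eq_of_faceDiff_eq_zero (fun c => by rw [hh, chain_of_notMem hw]) c d

/-- The function `h` changes only across triangles of `K`, where it has the common level of
`apply_eq` on one edge and is lower by one on the other two. The level set is thus one side of the
cycle. -/
theorem isRegion (hK : IsTurn s K f) [Finite W] (hh : T.faceDiff h = chain s K) {w : W}
    (hw : w ∈ K) : T.IsRegion {b | h b = h (T.glue (s.color w + 2) w)} K s.color f where
  nonempty := hK.nonempty
  glue_mem_iff u hu d := by
    have h1 := apply_glue_of_mem hh hu
    rw [hK.apply_eq hh hw hu]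
    rcases Color.cases (s.color u) d with rfl | rfl | rfl
    · simp [h1]
    · simp [h1]
    · simp
  glue_mem u hu c d hc := by
    rw [Set.mem_ofPred_eq] at hc ⊢
    rw [← hc]
    exact apply_glue_of_notMem hh hu d c
  vertex_eq u hu := hK.vertex_eq hu
  mapsTo := hK.mapsTo
  trans := hK.trans

/-- The region enclosed by a turning cycle has at least as many vertices as white triangles, and
more if it contains the outer triangle. -/
theorem card_regionTriangles_le (hK : IsTurn s K f) [Finite W] {D : Set B}
    (hD : T.IsRegion D K s.color f) :
    (T.regionTriangles D).ncard ≤ (T.regionVertices D).ncard ∧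
      (T.outer ∈ T.regionTriangles D →
        (T.regionTriangles D).ncard + 2 ≤ (T.regionVertices D).ncard) := by
  classical
  have hedge : ∀ w ∈ T.regionTriangles D, w ≠ T.outer →
      T.vertex (s.color w) w ∈ T.regionVertices D := by
    intro w hw hwo
    by_cases hwK : w ∈ K
    · exact Gluing.vertex_mem_regionVertices (hD.mem_regionEdges hwK).1
    · obtain ⟨c, hc⟩ := hw
      exact Gluing.vertex_mem_regionVertices (Or.inl (hD.glue_mem w hwK c _ hc))
  have hinj : Set.InjOn (fun w => T.vertex (s.color w) w) {w | w ≠ T.outer} := by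
    intro w hw w' hw' hww'
    have h1 := s.matches_color hw
    dsimp only at hww'
    rw [hww'] at h1
    exact h1.triangle_eq (s.matches_color hw')
  by_cases ho : T.outer ∈ T.regionTriangles D
  · refine (fun h => ⟨by omega, fun _ => h⟩ : _ + 2 ≤ _ → _) ?_
    -- The outer triangle is unmatched, but it brings three unmatched roots into the region: a
    -- surplus of two vertices.
    have hroots : Set.range T.root ⊆ T.regionVertices D := by
      rintro _ ⟨c, rfl⟩
      obtain ⟨d, hd⟩ := ho
      have hoK : T.outer ∉ K := fun h => hK.ne_outer h rfl
      exact Gluing.vertex_mem_regionVertices (Or.inl (hD.glue_mem _ hoK d _ hd))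
    have hsub : (fun w => T.vertex (s.color w) w) '' (T.regionTriangles D \ {T.outer}) ∪
        Set.range T.root ⊆ T.regionVertices D := by
      refine Set.union_subset ?_ hroots
      rintro _ ⟨w, ⟨hw, hwo⟩, rfl⟩
      exact hedge w hw hwo
    have hdisj : Disjoint ((fun w => T.vertex (s.color w) w) ''
        (T.regionTriangles D \ {T.outer})) (Set.range T.root) := by
      rw [Set.disjoint_left]
      rintro _ ⟨w, ⟨hw, hwo⟩, rfl⟩ ⟨c, hc⟩
      exact (s.matches_color hwo).ne_root c hc.symm
    have hle := Set.ncard_le_ncard hsub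
    rw [Set.ncard_union_eq hdisj, Set.InjOn.ncard_image (hinj.mono fun w hw => hw.2)] at hle
    have h3 : (Set.range T.root).ncard = 3 := by
      rw [← Set.image_univ, Set.ncard_image_of_injective _ T.root_injective, Set.ncard_univ]
      simp
    have h4 := Set.ncard_sdiff_singleton_add_one ho
    omega
  · refine ⟨?_, fun h => absurd h ho⟩
    refine Set.ncard_le_ncard_of_injOn (fun w => T.vertex (s.color w) w) (fun w hw => ?_)
      (hinj.mono fun w hw (h : w = T.outer) => ho (h ▸ hw))
    exact hedge w hw fun (h : w = T.outer) => ho (h ▸ hw)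

/-- A surplus of two vertices contradicts the Euler bound `card_vertices_le`, which permits a
surplus of less than one when `K` is nonempty. -/
theorem outer_notMem (hK : IsTurn s K f) [Finite W] {D : Set B}
    (hD : T.IsRegion D K s.color f) : T.outer ∉ T.regionTriangles D := fun h => by
  have h1 := (hK.card_regionTriangles_le hD).2 h
  have h2 := hD.card_vertices_le T.connected
  omega

/-- Turning cycles have length three. -/
theorem card_le (hK : IsTurn s K f) [Finite W] : K.card ≤ 3 := by
  obtain ⟨h, hh⟩ := hK.exists_faceDiff_eq_chain
  obtain ⟨w, hw⟩ := hK.nonempty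
  have hD := hK.isRegion hh hw
  have h1 := (hK.card_regionTriangles_le hD).1
  have h2 := hD.card_vertices_le T.connected
  omega

end IsTurn

end PlanarTrinity

namespace PlanarTrinity

variable {W B : Type*} {T : PlanarTrinity W B} {s t u : T.State} {σ τ : T.Site}

/-! ### Moves -/

/-- Performs a move on three triangles: the shift `k = 1` is the clockwise move and `k = 2` its
inverse. -/
theorem State.exists_shift (s : T.State) (k : Color) {ι : Color → W} (hι : Function.Injective ι)
    (hk : ∀ c, ∃ d, s.Matches (ι (c + k)) (T.vertex d (ι c))) :
    ∃ t : T.State, (∀ c v, s.Matches (ι (c + k)) v → t.Matches (ι c) v) ∧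
      ∀ w, (∀ c, w ≠ ι c) → ∀ v, s.Matches w v ↔ t.Matches w v := by
  have hout : ∀ c, ι c ≠ T.outer := fun c => by
    obtain ⟨d, hd⟩ := hk (c - k)
    rw [sub_add_cancel] at hd
    exact hd.ne_outer
  let ι' : Color ↪ {w : W // w ≠ T.outer} :=
    ⟨fun c => ⟨ι c, hout c⟩, fun c d h => hι (congrArg Subtype.val h)⟩
  let p := (Equiv.addRight k : Equiv.Perm Color).viaEmbedding ι'
  have hp1 : ∀ c, p (ι' c) = ι' (c + k) := fun c =>
    Equiv.Perm.viaEmbedding_apply _ _ _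
  have hp2 : ∀ w, (∀ c, w.1 ≠ ι c) → p w = w := fun w hw =>
    Equiv.Perm.viaEmbedding_apply_of_notMem _ _ _ fun ⟨c, hc⟩ => hw c (by rw [← hc]; rfl)
  obtain ⟨t, ht⟩ := s.exists_of_perm p (by
    intro w
    by_cases hw : ∃ c, w = ι' c
    · obtain ⟨c, rfl⟩ := hw
      rw [hp1]
      obtain ⟨d, hd⟩ := hk c
      exact ⟨d, hd.2⟩
    · rw [hp2 w fun c hc => hw ⟨c, Subtype.ext hc⟩]
      exact s.incident w)
  have h2 : ∀ w, (∀ c, w ≠ ι c) → ∀ v, s.Matches w v → t.Matches w v := by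
    intro w hw v hv
    refine ht ⟨w, hv.ne_outer⟩ v ?_
    rwa [hp2 ⟨w, hv.ne_outer⟩ hw]
  refine ⟨t, fun c v hv => ht (ι' c) v ?_, fun w hw v => ⟨h2 w hw v, fun hv => ?_⟩⟩
  · rw [hp1]; exact hv
  · have h3 := s.matches_color hv.ne_outer
    rwa [hv.vertex_eq (h2 w hw _ h3)]

theorem Site.vertex_succ (σ : T.Site) (c : Color) :
    T.vertex (c + 2) (σ.tri (c + 1)) = T.vertex (c + 2) (σ.tri c) := by
  have := σ.cycle (c + 2)
  simp only [Color.add_two_add_one, Color.add_two_add_two] at this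
  exact this.symm

theorem Site.vertex_pred (σ : T.Site) (c : Color) :
    T.vertex (c + 1) (σ.tri (c + 2)) = T.vertex (c + 1) (σ.tri c) := by
  have := σ.cycle (c + 1)
  simpa only [Color.add_one_add_one, Color.add_one_add_two] using this

/-- The state `s` is in clockwise position at the site `σ`. -/
def IsClockwise (s : T.State) (σ : T.Site) : Prop :=
  ∀ c, s.Matches (σ.tri c) (T.vertex (c + 1) (σ.tri c))

/-- The state `s` is in counter-clockwise position at the site `σ`. -/
def IsCounterclockwise (s : T.State) (σ : T.Site) : Prop :=
  ∀ c, s.Matches (σ.tri c) (T.vertex (c + 2) (σ.tri c))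

theorem IsClockwise.color_tri (h : IsClockwise s σ) (c : Color) : s.color (σ.tri c) = c + 1 :=
  (h c).color_eq

theorem IsCounterclockwise.color_tri (h : IsCounterclockwise s σ) (c : Color) :
    s.color (σ.tri c) = c + 2 :=
  (h c).color_eq

theorem IsClockwise.tri_injective (h : IsClockwise s σ) : Function.Injective σ.tri :=
  fun c d hcd => by
    have := h.color_tri c
    rw [hcd, h.color_tri d] at this
    exact (add_right_cancel this).symm

theorem IsCounterclockwise.tri_injective (h : IsCounterclockwise s σ) :
    Function.Injective σ.tri :=
  fun c d hcd => by
    have := h.color_tri c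
    rw [hcd, h.color_tri d] at this
    exact (add_right_cancel this).symm

theorem IsClockwise.matches_succ (h : IsClockwise s σ) (c : Color) :
    s.Matches (σ.tri (c + 1)) (T.vertex (c + 2) (σ.tri c)) := by
  rw [← σ.vertex_succ]
  simpa using h (c + 1)

theorem IsCounterclockwise.matches_pred (h : IsCounterclockwise s σ) (c : Color) :
    s.Matches (σ.tri (c + 2)) (T.vertex (c + 1) (σ.tri c)) := by
  rw [← σ.vertex_pred]
  simpa using h (c + 2)

theorem IsClockwise.exists_move (h : IsClockwise s σ) : ∃ t, T.ClockwiseMove σ s t := by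
  obtain ⟨t, h1, h2⟩ := s.exists_shift 1 h.tri_injective fun c => ⟨_, h.matches_succ c⟩
  exact ⟨t, h, fun c => h1 c _ (h.matches_succ c), h2⟩

theorem IsCounterclockwise.exists_move (h : IsCounterclockwise t σ) :
    ∃ s, T.ClockwiseMove σ s t := by
  obtain ⟨s, h1, h2⟩ := t.exists_shift 2 h.tri_injective fun c => ⟨_, h.matches_pred c⟩
  exact ⟨s, fun c => h1 c _ (h.matches_pred c), h, fun w hw v => (h2 w hw v).symm⟩

/-- The colour of the vertex matched to a common triangle determines its index, and each further
triangle is the partner of a vertex of the preceding one. Distinct available moves therefore use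
disjoint triangles, which makes them commute. -/
theorem IsClockwise.site_eq (hσ : IsClockwise s σ) (hτ : IsClockwise s τ) {c d : Color}
    (h : σ.tri c = τ.tri d) : σ = τ := by
  have hcd : c = d := by
    have := hσ.color_tri c
    rw [h, hτ.color_tri d] at this
    exact (add_right_cancel this).symm
  subst hcd
  have step : ∀ c, σ.tri c = τ.tri c → σ.tri (c + 1) = τ.tri (c + 1) := by
    intro c h
    have h1 := hσ.matches_succ c
    rw [h] at h1
    exact h1.triangle_eq (hτ.matches_succ c)
  have h1 := step _ h
  have h2 := step _ h1
  rw [Color.add_one_add_one] at h2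
  ext d
  rcases Color.cases c d with rfl | rfl | rfl
  exacts [h, h1, h2]

theorem IsCounterclockwise.site_eq (hσ : IsCounterclockwise s σ) (hτ : IsCounterclockwise s τ)
    {c d : Color} (h : σ.tri c = τ.tri d) : σ = τ := by
  have hcd : c = d := by
    have := hσ.color_tri c
    rw [h, hτ.color_tri d] at this
    exact (add_right_cancel this).symm
  subst hcd
  have step : ∀ c, σ.tri c = τ.tri c → σ.tri (c + 2) = τ.tri (c + 2) := by
    intro c h
    have h1 := hσ.matches_pred c
    rw [h] at h1
    exact h1.triangle_eq (hτ.matches_pred c)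
  have h1 := step _ h
  have h2 := step _ h1
  rw [Color.add_two_add_two] at h2
  ext d
  rcases Color.cases c d with rfl | rfl | rfl
  exacts [h, h2, h1]

namespace ClockwiseMove

theorem isClockwise (h : T.ClockwiseMove σ s t) : IsClockwise s σ := h.1

theorem isCounterclockwise (h : T.ClockwiseMove σ s t) : IsCounterclockwise t σ := h.2.1

theorem matches_iff (h : T.ClockwiseMove σ s t) {w : W} (hw : ∀ c, w ≠ σ.tri c) (v : T.Vertex) :
    s.Matches w v ↔ t.Matches w v := h.2.2 w hw v

theorem target_eq (h : T.ClockwiseMove σ s t) (h' : T.ClockwiseMove σ s u) : t = u :=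
  State.ext_matches fun w v hv => by
    by_cases hw : ∃ c, w = σ.tri c
    · obtain ⟨c, rfl⟩ := hw
      rw [hv.vertex_eq (h.isCounterclockwise c)]
      exact h'.isCounterclockwise c
    · push Not at hw
      exact (h'.matches_iff hw v).1 ((h.matches_iff hw v).2 hv)

theorem source_eq (h : T.ClockwiseMove σ s u) (h' : T.ClockwiseMove σ t u) : s = t :=
  State.ext_matches fun w v hv => by
    by_cases hw : ∃ c, w = σ.tri c
    · obtain ⟨c, rfl⟩ := hw
      rw [hv.vertex_eq (h.isClockwise c)]
      exact h'.isClockwise c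
    · push Not at hw
      exact (h'.matches_iff hw v).2 ((h.matches_iff hw v).1 hv)

/-- Different moves from the same state commute. -/
theorem exists_join (hσ : T.ClockwiseMove σ s t) (hτ : T.ClockwiseMove τ s u) (hne : σ ≠ τ) :
    ∃ v, T.ClockwiseMove τ t v ∧ T.ClockwiseMove σ u v := by
  have hdis : ∀ c d, σ.tri c ≠ τ.tri d :=
    fun c d h => hne (hσ.isClockwise.site_eq hτ.isClockwise h)
  have h1 : IsClockwise t τ := fun c =>
    (hσ.matches_iff (fun d => (hdis d c).symm) _).1 (hτ.isClockwise c)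
  obtain ⟨v, hv⟩ := h1.exists_move
  refine ⟨v, hv, fun c => ?_, fun c => ?_, fun w hw x => ?_⟩
  · exact (hτ.matches_iff (hdis c) _).1 (hσ.isClockwise c)
  · exact (hv.matches_iff (hdis c) _).1 (hσ.isCounterclockwise c)
  · by_cases hwτ : ∃ c, w = τ.tri c
    · obtain ⟨c, rfl⟩ := hwτ
      constructor
      · intro hx
        rw [hx.vertex_eq (hτ.isCounterclockwise c)]
        exact hv.isCounterclockwise c
      · intro hx
        rw [hx.vertex_eq (hv.isCounterclockwise c)]
        exact hτ.isCounterclockwise c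
    · push Not at hwτ
      rw [← hτ.matches_iff hwτ, hσ.matches_iff hw, hv.matches_iff hwτ]

/-- Different moves to the same state commute. -/
theorem exists_meet (hσ : T.ClockwiseMove σ s u) (hτ : T.ClockwiseMove τ t u) (hne : σ ≠ τ) :
    ∃ v, T.ClockwiseMove τ v s ∧ T.ClockwiseMove σ v t := by
  have hdis : ∀ c d, σ.tri c ≠ τ.tri d :=
    fun c d h => hne (hσ.isCounterclockwise.site_eq hτ.isCounterclockwise h)
  have h1 : IsCounterclockwise s τ := fun c =>
    (hσ.matches_iff (fun d => (hdis d c).symm) _).2 (hτ.isCounterclockwise c)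
  obtain ⟨v, hv⟩ := h1.exists_move
  refine ⟨v, hv, fun c => ?_, fun c => ?_, fun w hw x => ?_⟩
  · exact (hv.matches_iff (hdis c) _).2 (hσ.isClockwise c)
  · exact (hτ.matches_iff (hdis c) _).2 (hσ.isCounterclockwise c)
  · by_cases hwτ : ∃ c, w = τ.tri c
    · obtain ⟨c, rfl⟩ := hwτ
      constructor
      · intro hx
        rw [hx.vertex_eq (hv.isClockwise c)]
        exact hτ.isClockwise c
      · intro hx
        rw [hx.vertex_eq (hτ.isClockwise c)]
        exact hv.isClockwise c
    · push Not at hwτ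
      rw [hv.matches_iff hwτ, hσ.matches_iff hw, hτ.matches_iff hwτ]

end ClockwiseMove

/-- The three white triangles of a site. -/
def Site.triangles [DecidableEq W] (σ : T.Site) : Finset W := Finset.univ.image σ.tri

theorem Site.mem_triangles [DecidableEq W] {w : W} : w ∈ σ.triangles ↔ ∃ c, w = σ.tri c := by
  simp [Site.triangles, eq_comm]

theorem IsClockwise.isTurn [DecidableEq W] (h : IsClockwise s σ) :
    IsTurn s σ.triangles (fun w => σ.tri (s.color w)) where
  nonempty := ⟨σ.tri 0, Site.mem_triangles.2 ⟨0, rfl⟩⟩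
  mapsTo w _ := Site.mem_triangles.2 ⟨_, rfl⟩
  matches_vertex w hw := by
    obtain ⟨c, rfl⟩ := Site.mem_triangles.1 hw
    rw [h.color_tri]
    simpa using h.matches_succ c
  trans w hw w' hw' := by
    obtain ⟨c, rfl⟩ := Site.mem_triangles.1 hw
    obtain ⟨d, rfl⟩ := Site.mem_triangles.1 hw'
    rcases Color.cases c d with rfl | rfl | rfl
    · exact ⟨0, rfl⟩
    · exact ⟨1, by simp [h.color_tri]⟩
    · exact ⟨2, by simp [h.color_tri]⟩

theorem ClockwiseMove.chain_sub [DecidableEq W] (h : T.ClockwiseMove σ s t) :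
    t.chain - s.chain = IsTurn.chain s σ.triangles := by
  ext ⟨w, c⟩
  rw [Pi.sub_apply]
  by_cases hw : w ∈ σ.triangles
  · rw [IsTurn.chain_of_mem hw]
    obtain ⟨d, rfl⟩ := Site.mem_triangles.1 hw
    rw [State.chain_apply_color _ (h.isClockwise d).ne_outer,
      State.chain_apply_color _ (h.isClockwise d).ne_outer, h.isClockwise.color_tri,
      h.isCounterclockwise.color_tri]
    simp [eq_comm]
  · rw [IsTurn.chain_of_notMem hw]
    simp only [State.chain]
    rw [h.matches_iff fun d hd => hw (Site.mem_triangles.2 ⟨d, hd⟩), sub_self]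

/-- A clockwise move raises the height by one inside the cycle. -/
theorem ClockwiseMove.exists_isHeight [DecidableEq W] [Finite W] (hm : T.ClockwiseMove σ s t) :
    ∃ h : B → ℚ, IsHeight s t h ∧ (∀ b, h b = 0 ∨ h b = 1) ∧
      T.IsRegion {b | h b = 1} σ.triangles s.color (fun w => σ.tri (s.color w)) := by
  have hK := hm.isClockwise.isTurn
  obtain ⟨h, hh⟩ := PlanarTrinity.exists_isHeight s t
  have hc : T.faceDiff h = IsTurn.chain s σ.triangles := hh.faceDiff_eq.trans hm.chain_sub
  obtain ⟨w, hw⟩ := hK.nonempty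
  have hD := hK.isRegion hc hw
  have hout := hK.outer_notMem hD
  set l := h (T.glue (s.color w + 2) w) with hl
  have key : ∀ w c, h (T.glue c w) = l - 1 ∨ h (T.glue c w) = l := by
    have hmem : ∀ u ∈ σ.triangles, ∀ c, h (T.glue c u) = l - 1 ∨ h (T.glue c u) = l := by
      intro u hu c
      have h1 := IsTurn.apply_glue_of_mem hc hu
      have h2 := hK.apply_eq hc hw hu
      rw [← hl] at h2
      rw [← h2] at h1
      rcases Color.cases (s.color u) c with rfl | rfl | rfl
      exacts [Or.inl h1.1, Or.inl h1.2, Or.inr h2.symm]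
    refine T.connected.induction (fun b c d hp e => ?_) (hmem w hw)
    by_cases hu : (T.glue d).symm b ∈ σ.triangles
    · exact hmem _ hu e
    · rw [IsTurn.apply_glue_of_notMem hc hu e d, Equiv.apply_symm_apply]
      simpa using hp c
  -- The outer triangle lies outside the region, where the value is `l - 1`, and the height is
  -- normalized to zero there.
  have hl1 : l = 1 := by
    have h1 := (key T.outer 0).resolve_right fun h => hout ⟨0, h⟩
    rw [hh.outer] at h1
    linarith
  rw [hl1] at key hD
  refine ⟨h, hh, fun b => ?_, hD⟩
  simpa using key ((T.glue 0).symm b) 0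

open Classical in
/-- The white triangle that comes after `w` when one turns from the vertex matched to `w` to its
next vertex. -/
noncomputable def State.next (s : T.State) (w : W) : W :=
  if h : ∃ w', s.Matches w' (T.vertex (s.color w + 1) w) then h.choose else w

theorem State.matches_next {w : W} (h : ∀ c, T.vertex (s.color w + 1) w ≠ T.root c) :
    s.Matches (s.next w) (T.vertex (s.color w + 1) w) := by
  rw [next, dif_pos (s.exists_matches h)]
  exact (s.exists_matches h).choose_spec

/-- A turning cycle gives a clockwise move. -/
theorem IsTurn.exists_isClockwise [Finite W] {K : Finset W} {f : W → W} (hK : IsTurn s K f) :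
    ∃ σ, IsClockwise s σ := by
  classical
  obtain ⟨w, hw⟩ := hK.nonempty
  have h1 := hK.color_apply hw
  have h2 := hK.color_apply (hK.mapsTo _ hw)
  have h3 := hK.color_apply (hK.mapsTo _ (hK.mapsTo _ hw))
  rw [h1, Color.add_one_add_one] at h2
  rw [h2, Color.add_two_add_one] at h3
  have hne1 : w ≠ f w := fun h => by rw [← h] at h1; simp at h1
  have hne2 : w ≠ f (f w) := fun h => by rw [← h] at h2; simp at h2
  have hne3 : f w ≠ f (f w) := fun h => by rw [← h, h1] at h2; simp at h2
  have hKeq : {w, f w, f (f w)} = K := by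
    refine Finset.eq_of_subset_of_card_le ?_ ?_
    · intro x hx
      simp only [Finset.mem_insert, Finset.mem_singleton] at hx
      rcases hx with rfl | rfl | rfl
      exacts [hw, hK.mapsTo _ hw, hK.mapsTo _ (hK.mapsTo _ hw)]
    · rw [Finset.card_eq_three.2 ⟨_, _, _, hne1, hne2, hne3, rfl⟩]
      exact hK.card_le
  have hper : f (f (f w)) = w := by
    have := hK.mapsTo _ (hK.mapsTo _ (hK.mapsTo _ hw))
    rw [← hKeq] at this
    simp only [Finset.mem_insert, Finset.mem_singleton] at this
    rcases this with h | h | h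
    · exact h
    · rw [h, h1] at h3; simp at h3
    · rw [h, h2] at h3; simp at h3
  obtain ⟨a, ha⟩ : ∃ a, a = s.color w := ⟨_, rfl⟩
  let tri' : Color → W := fun x => f^[x.val] w
  have htri : ∀ x, tri' (x + 1) = f (tri' x) := by
    intro x
    fin_cases x
    · rfl
    · rfl
    · exact hper.symm
  have hmem : ∀ x, tri' x ∈ K := fun x => hK.iterate_mem hw _
  have hcol : ∀ x, s.color (tri' x) = a + x := by
    have e0 : s.color (tri' 0) = a := ha.symm
    have e1 : s.color (tri' 1) = a + 1 := by rw [ha]; exact h1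
    have e2 : s.color (tri' 2) = a + 2 := by rw [ha]; exact h2
    intro x
    fin_cases x
    · exact e0.trans (add_zero a).symm
    · exact e1
    · exact e2
  have hmt : ∀ x, s.Matches (tri' (x + 1)) (T.vertex (a + x + 1) (tri' x)) := fun x => by
    rw [htri, ← hcol]
    exact hK.matches_vertex _ (hmem x)
  have hself : ∀ x, s.Matches (tri' x) (T.vertex (a + x) (tri' x)) := fun x => by
    rw [← hcol]
    exact s.matches_color (hK.ne_outer (hmem x))
  -- In clockwise position the triangle with index `c` is matched to colour `c + 1`, and `tri' x` is
  -- matched to colour `a + x`.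
  refine ⟨⟨fun c => tri' (c - a + 1), fun c => ?_⟩, fun c => ?_⟩
  · have e1 := hmt (c - a + 2)
    have e2 := hself (c - a + 2 + 1)
    rw [show a + (c - a + 2) + 1 = c + 2 + 1 by ring, Color.add_two_add_one c] at e1
    rw [show a + (c - a + 2 + 1) = c + 2 + 1 by ring, Color.add_two_add_one c] at e2
    have e3 := e1.vertex_eq e2
    rw [show c + 1 - a + 1 = c - a + 2 by ring, show c + 2 - a + 1 = c - a + 2 + 1 by ring]
    exact e3
  · have := hself (c - a + 1)
    rwa [show a + (c - a + 1) = c + 1 by ring] at this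

/-- If the height of `t` relative to `s` is positive somewhere, then `s` admits a clockwise move. -/
theorem IsHeight.exists_move [Finite W] {h : B → ℚ} (hh : IsHeight s t h) {b : B} (hb : 0 < h b) :
    ∃ σ u, T.ClockwiseMove σ s u := by
  classical
  have : Finite B := Finite.of_equiv W (T.glue 0)
  have : Nonempty B := ⟨b⟩
  obtain ⟨b₁, hb₁⟩ := Finite.exists_max h
  have hpos : 0 < h b₁ := hb.trans_le (hb₁ b)
  -- Around a vertex, `t.chain - s.chain` is nonnegative except at the triangle that `s` matches to
  -- it. So if the maximum occurs around the vertex, it also occurs right after that triangle.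
  have hmax : ∀ {w c b}, s.Matches w (T.vertex c w) → T.blackVertex c b = T.vertex c w →
      h b = h b₁ → h (T.glue (c + 2) w) = h b₁ := by
    intro w c b hw hbw hb
    refine le_antisymm (hb₁ _) ?_
    rw [← hb]
    refine T.le_of_faceDiff_nonneg (fun u hu huw => ?_) hbw
    rw [hh.faceDiff_eq, Pi.sub_apply]
    have h1 : s.chain (u, c) = 0 := by
      rw [State.chain, if_neg]
      intro h1
      rw [hu] at h1
      exact huw (h1.triangle_eq hw)
    rw [h1, sub_zero, State.chain]
    split_ifs <;> norm_num
  have hroot : ∀ {c b}, h b = h b₁ → ∀ d, T.blackVertex c b ≠ T.root d := by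
    intro c b hb d hd
    have hcd : c = d := T.color_eq_of_vertex_eq hd
    subst hcd
    exact hpos.ne' (hb ▸ hh.eq_zero_of_blackVertex_eq_root hd)
  let p : W → Prop := fun w => w ≠ T.outer ∧ h (T.glue (s.color w + 2) w) = h b₁
  -- The next vertex touches the maximal level, so it is not a root, where heights vanish; its
  -- partner again has the property `p`.
  have hstep : ∀ w, p w → s.Matches (s.next w) (T.vertex (s.color w + 1) w) ∧ p (s.next w) := by
    intro w hw
    have hbv : T.blackVertex (s.color w + 1) (T.glue (s.color w + 2) w) =
        T.vertex (s.color w + 1) w := T.blackVertex_glue (by simp) w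
    have h1 := State.matches_next (s := s) (w := w) (hbv ▸ hroot hw.2)
    refine ⟨h1, h1.ne_outer, ?_⟩
    have h2 := h1.color_eq
    have h3 := h1.eq_vertex_color
    rw [h2] at h3 ⊢
    rw [h3] at h1
    exact hmax h1 (hbv.trans h3) hw.2
  obtain ⟨w₀, hw₀⟩ : ∃ w, p w := by
    obtain ⟨w, hw⟩ := s.exists_matches (hroot (c := 0) rfl)
    have h1 := hw.eq_vertex_color
    have h2 : s.color w = 0 := (T.color_eq_of_vertex_eq h1).symm
    refine ⟨w, hw.ne_outer, ?_⟩
    rw [h1] at hw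
    rw [h2] at hw h1 ⊢
    exact hmax hw h1 rfl
  have hp : ∀ w, p w → ∀ n, p (s.next^[n] w) := by
    intro w hw n
    induction n with
    | zero => exact hw
    | succ n ih => rw [Function.iterate_succ_apply']; exact (hstep _ ih).2
  obtain ⟨i, j, hij, hij'⟩ :=
    Finite.exists_ne_map_eq_of_infinite fun n => s.next^[n] w₀
  wlog hlt : i < j generalizing i j
  · exact this j i hij.symm hij'.symm (lt_of_le_of_ne (not_lt.1 hlt) hij.symm)
  have hper : Function.IsPeriodicPt s.next (j - i) (s.next^[i] w₀) := by
    change s.next^[j - i] (s.next^[i] w₀) = s.next^[i] w₀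
    rw [← Function.iterate_add_apply, Nat.sub_add_cancel hlt.le]
    exact hij'.symm
  set w₁ := s.next^[i] w₀ with hw₁
  have hpw₁ : ∀ n, p (s.next^[n] w₁) := hp w₁ (hp w₀ hw₀ i)
  have hK : IsTurn s (Set.range fun n => s.next^[n] w₁).toFinite.toFinset s.next := by
    refine ⟨⟨w₁, by simpa using ⟨0, rfl⟩⟩, ?_, ?_, ?_⟩
    · intro w hw
      simp only [Set.Finite.mem_toFinset, Set.mem_range] at hw ⊢
      obtain ⟨n, rfl⟩ := hw
      exact ⟨n + 1, Function.iterate_succ_apply' _ _ _⟩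
    · intro w hw
      simp only [Set.Finite.mem_toFinset, Set.mem_range] at hw
      obtain ⟨n, rfl⟩ := hw
      exact (hstep _ (hpw₁ n)).1
    · intro w hw w' hw'
      simp only [Set.Finite.mem_toFinset, Set.mem_range] at hw hw'
      obtain ⟨n, rfl⟩ := hw
      obtain ⟨m, rfl⟩ := hw'
      -- After the `n` steps from `w₁` already made, `n * (j - i - 1)` more complete `n` full
      -- periods, and `m` steps then lead to the target.
      refine ⟨m + n * (j - i - 1), ?_⟩
      rw [← Function.iterate_add_apply]
      have : m + n * (j - i - 1) + n = m + n * (j - i) := by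
        obtain ⟨k, hk⟩ : ∃ k, j - i = k + 1 := ⟨j - i - 1, by omega⟩
        rw [hk]; simp; ring
      rw [this, Function.iterate_add_apply, hper.const_mul n]
  obtain ⟨σ, hσ⟩ := hK.exists_isClockwise
  exact ⟨σ, hσ.exists_move⟩

/-- At most one state admits no clockwise move. -/
theorem eq_of_forall_not_move [Finite W] (hs : ∀ σ u, ¬ T.ClockwiseMove σ s u)
    (ht : ∀ σ u, ¬ T.ClockwiseMove σ t u) : s = t := by
  obtain ⟨h, hh⟩ := exists_isHeight s t
  have h0 : h = 0 := by
    ext b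
    refine le_antisymm (not_lt.1 fun hb => ?_) (not_lt.1 fun hb => ?_)
    · obtain ⟨σ, u, hu⟩ := hh.exists_move hb
      exact hs σ u hu
    · obtain ⟨σ, u, hu⟩ := hh.neg.exists_move (b := b) (by simpa using hb)
      exact ht σ u hu
  subst h0
  exact hh.eq_of_eq_zero

/-- A function of states that increases with every clockwise move. -/
theorem exists_strictMono_moves [Finite W] :
    ∃ r : T.State → ℚ, ∀ σ s t, T.ClockwiseMove σ s t → r s < r t := by
  classical
  rcases isEmpty_or_nonempty T.State with hE | ⟨⟨s₀⟩⟩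
  · exact ⟨fun _ => 0, fun _ s => (hE.false s).elim⟩
  have : Finite B := Finite.of_equiv W (T.glue 0)
  have := Fintype.ofFinite B
  choose H hH using fun s => exists_isHeight s₀ s
  refine ⟨fun s => ∑ b, H s b, fun σ s t hm => ?_⟩
  obtain ⟨h, hh, h01, hD⟩ := hm.exists_isHeight
  -- Heights add along moves, and a move contributes a function with values `0` and `1` that is not
  -- zero.
  have h1 : H t = H s + h := (hH t).unique ((hH s).add hh)
  have h2 : ∃ b, h b = 1 :=
    ⟨_, (hD.glue_mem_iff (σ.tri 0) (Site.mem_triangles.2 ⟨0, rfl⟩) _).2 rfl⟩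
  obtain ⟨b, hb⟩ := h2
  dsimp only
  rw [h1]
  refine Finset.sum_lt_sum (fun b _ => ?_) ⟨b, Finset.mem_univ b, ?_⟩
  · rcases h01 b with h0 | h0 <;> simp [h0]
  · simp [hb]

end PlanarTrinity

namespace PlanarTrinity

variable {W B : Type*} (T : PlanarTrinity W B) (c : Color)

/-! ### The greedy search -/

/-- The position of the greedy search after `k` steps. -/
noncomputable def clockedPos (k : ℕ) : W ⊕ B := ((T.clockedStep c)^[k] (Sum.inl T.outer, ∅)).1

/-- The arrows that the greedy search has selected after `k` steps. -/
noncomputable def clockedSet (k : ℕ) : Set W := ((T.clockedStep c)^[k] (Sum.inl T.outer, ∅)).2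

/-- The vertex about which the greedy search turns. -/
def center : W ⊕ B → T.Vertex := Sum.elim (T.vertex c) (T.blackVertex c)

/-- The vertices reached by the greedy search after `k` steps. -/
def Reached (k : ℕ) (v : T.Vertex) : Prop :=
  v = T.root c ∨ ∃ a ∈ T.clockedSet c k, T.vertex c a = v

/-- The vertex `y` follows `x` on an arrow selected after `k` steps. -/
def SelectedArrow (k : ℕ) (x y : T.Vertex) : Prop :=
  ∃ w ∈ T.clockedSet c k, T.arrowTail c w = x ∧ T.arrowHead c w = y

theorem clockedPos_zero : T.clockedPos c 0 = Sum.inl T.outer := rfl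

theorem clockedSet_zero : T.clockedSet c 0 = ∅ := rfl

variable {T c}

theorem clocked_succ (k : ℕ) :
    (T.clockedPos c (k + 1), T.clockedSet c (k + 1)) =
      T.clockedStep c (T.clockedPos c k, T.clockedSet c k) :=
  Function.iterate_succ_apply' _ _ _

/-- The four kinds of steps of the greedy search. -/
theorem clocked_cases (k : ℕ) :
    (∃ w, T.clockedPos c k = Sum.inl w ∧ w ∈ T.clockedSet c k ∧
      T.clockedPos c (k + 1) = Sum.inl ((T.glue (c + 1)).symm (T.glue c w)) ∧
      T.clockedSet c (k + 1) = T.clockedSet c k) ∨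
    (∃ w, T.clockedPos c k = Sum.inl w ∧ w ∉ T.clockedSet c k ∧
      T.clockedPos c (k + 1) = Sum.inr (T.glue (c + 2) w) ∧
      T.clockedSet c (k + 1) = T.clockedSet c k) ∨
    (∃ a, T.clockedPos c k = Sum.inr (T.glue c a) ∧ T.Reached c k (T.vertex c a) ∧
      T.clockedPos c (k + 1) = Sum.inl ((T.glue (c + 1)).symm (T.glue c a)) ∧
      T.clockedSet c (k + 1) = T.clockedSet c k) ∨
    (∃ a, T.clockedPos c k = Sum.inr (T.glue c a) ∧ ¬ T.Reached c k (T.vertex c a) ∧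
      T.clockedPos c (k + 1) = Sum.inr (T.glue (c + 2) a) ∧
      T.clockedSet c (k + 1) = insert a (T.clockedSet c k)) := by
  have h := clocked_succ (T := T) (c := c) k
  rcases hp : T.clockedPos c k with w | b
  · rw [hp, clockedStep] at h
    by_cases hw : w ∈ T.clockedSet c k
    · rw [if_pos hw, Prod.mk.injEq] at h
      exact Or.inl ⟨w, rfl, hw, h.1, h.2⟩
    · rw [if_neg hw, Prod.mk.injEq] at h
      exact Or.inr (Or.inl ⟨w, rfl, hw, h.1, h.2⟩)
  · obtain ⟨a, rfl⟩ := (T.glue c).surjective b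
    rw [hp, clockedStep] at h
    have hR : (T.arrowHead c ((T.glue c).symm (T.glue c a)) = T.root c ∨ ∃ a' ∈ T.clockedSet c k,
        T.arrowHead c a' = T.arrowHead c ((T.glue c).symm (T.glue c a))) ↔
          T.Reached c k (T.vertex c a) := by rw [Equiv.symm_apply_apply]; rfl
    by_cases ha : T.Reached c k (T.vertex c a)
    · rw [if_pos (hR.2 ha), Prod.mk.injEq] at h
      exact Or.inr (Or.inr (Or.inl ⟨a, rfl, ha, h.1, h.2⟩))
    · rw [if_neg (mt hR.1 ha), Equiv.symm_apply_apply, Prod.mk.injEq] at h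
      exact Or.inr (Or.inr (Or.inr ⟨a, rfl, ha, h.1, h.2⟩))

theorem clockedSet_mono : Monotone (T.clockedSet c) := by
  refine monotone_nat_of_le_succ fun k => ?_
  rcases clocked_cases (T := T) (c := c) k with ⟨_, _, _, _, h⟩ | ⟨_, _, _, _, h⟩ | ⟨_, _, _, _, h⟩ |
    ⟨a, _, _, _, h⟩
  · exact h.ge
  · exact h.ge
  · exact h.ge
  · rw [h]; exact Set.subset_insert _ _

theorem Reached.mono {k l : ℕ} (hkl : k ≤ l) {v : T.Vertex} (h : T.Reached c k v) :
    T.Reached c l v :=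
  h.imp id fun ⟨a, ha, h⟩ => ⟨a, clockedSet_mono hkl ha, h⟩

theorem center_backtrack (w : W) :
    T.center c (Sum.inl ((T.glue (c + 1)).symm (T.glue c w))) = T.arrowTail c w := rfl

theorem center_turn (w : W) :
    T.center c (Sum.inr (T.glue (c + 2) w)) = T.vertex c w :=
  T.blackVertex_glue (by simp) w

theorem reached_center_and_tail (k : ℕ) : T.Reached c k (T.center c (T.clockedPos c k)) ∧
    ∀ a ∈ T.clockedSet c k, T.Reached c k (T.arrowTail c a) := by
  induction k with
  | zero => exact ⟨Or.inl rfl, fun a ha => ha.elim⟩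
  | succ k ih =>
    obtain ⟨h1, h2⟩ := ih
    have h1' := h1.mono k.le_succ
    have h2' := fun a ha => (h2 a ha).mono k.le_succ
    rcases clocked_cases (T := T) (c := c) k with ⟨w, hp, hw, hp', h⟩ | ⟨w, hp, hw, hp', h⟩ |
      ⟨a, hp, ha, hp', h⟩ | ⟨a, hp, ha, hp', h⟩
    · rw [hp', center_backtrack]
      exact ⟨h2' w hw, by rw [h]; exact h2'⟩
    · rw [hp', center_turn]
      rw [hp] at h1'
      exact ⟨h1', by rw [h]; exact h2'⟩
    · rw [hp', center_backtrack]
      rw [hp] at h1'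
      exact ⟨h1', by rw [h]; exact h2'⟩
    · rw [hp', center_turn]
      refine ⟨Or.inr ⟨a, by rw [h]; exact Set.mem_insert _ _, rfl⟩, ?_⟩
      rw [h]
      rintro a' (rfl | ha')
      · rw [hp] at h1'
        exact h1'
      · exact h2' a' ha'

theorem head_ne_root {k : ℕ} {a : W} (ha : a ∈ T.clockedSet c k) : T.vertex c a ≠ T.root c := by
  induction k with
  | zero => exact ha.elim
  | succ k ih =>
    rcases clocked_cases (T := T) (c := c) k with ⟨_, _, _, _, h⟩ | ⟨_, _, _, _, h⟩ |
      ⟨_, _, _, _, h⟩ | ⟨b, _, hb, _, h⟩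
    · exact ih (h ▸ ha)
    · exact ih (h ▸ ha)
    · exact ih (h ▸ ha)
    · rw [h] at ha
      rcases ha with rfl | ha
      · exact fun h => hb (Or.inl h)
      · exact ih ha

/-- An arrow whose head has been reached is not selected any more. -/
theorem mem_of_reached {k l : ℕ} {w : W} (hw : T.Reached c k (T.vertex c w))
    (hl : w ∈ T.clockedSet c l) : w ∈ T.clockedSet c k := by
  rcases le_total l k with hlk | hkl
  · exact clockedSet_mono hlk hl
  induction l, hkl using Nat.le_induction with
  | base => exact hl
  | succ l hkl ih =>
    rcases clocked_cases (T := T) (c := c) l with ⟨_, _, _, _, h⟩ | ⟨_, _, _, _, h⟩ |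
      ⟨_, _, _, _, h⟩ | ⟨b, _, hb, _, h⟩
    · exact ih (h ▸ hl)
    · exact ih (h ▸ hl)
    · exact ih (h ▸ hl)
    · rw [h] at hl
      rcases hl with rfl | hl
      · exact absurd (hw.mono hkl) hb
      · exact ih hl

theorem eq_of_head_eq {k : ℕ} {a a' : W} (ha : a ∈ T.clockedSet c k) (ha' : a' ∈ T.clockedSet c k)
    (h : T.vertex c a = T.vertex c a') : a = a' := by
  induction k with
  | zero => exact ha.elim
  | succ k ih =>
    rcases clocked_cases (T := T) (c := c) k with ⟨_, _, _, _, hk⟩ | ⟨_, _, _, _, hk⟩ |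
      ⟨_, _, _, _, hk⟩ | ⟨b, _, hb, _, hk⟩
    · exact ih (hk ▸ ha) (hk ▸ ha')
    · exact ih (hk ▸ ha) (hk ▸ ha')
    · exact ih (hk ▸ ha) (hk ▸ ha')
    · rw [hk] at ha ha'
      rcases ha with rfl | ha <;> rcases ha' with rfl | ha'
      · rfl
      · exact absurd (Or.inr ⟨a', ha', h.symm⟩) hb
      · exact absurd (Or.inr ⟨a, ha, h⟩) hb
      · exact ih ha ha'

theorem SelectedArrow.mono {k l : ℕ} (hkl : k ≤ l) {x y : T.Vertex}
    (h : T.SelectedArrow c k x y) : T.SelectedArrow c l x y := by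
  obtain ⟨w, hw, h⟩ := h
  exact ⟨w, clockedSet_mono hkl hw, h⟩

theorem reflTransGen_mono {k l : ℕ} (hkl : k ≤ l) {x y : T.Vertex}
    (h : Relation.ReflTransGen (T.SelectedArrow c k) x y) :
    Relation.ReflTransGen (T.SelectedArrow c l) x y :=
  Relation.ReflTransGen.mono (fun _ _ h => SelectedArrow.mono hkl h) _ _ h

theorem Reached.reflTransGen {k : ℕ} {v : T.Vertex} (hv : T.Reached c k v) :
    Relation.ReflTransGen (T.SelectedArrow c k) (T.root c) v := by
  induction k generalizing v with
  | zero =>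
    rcases hv with rfl | ⟨a, ha, -⟩
    · exact Relation.ReflTransGen.refl
    · exact ha.elim
  | succ k ih =>
    have hold : ∀ {v}, T.Reached c k v →
        Relation.ReflTransGen (T.SelectedArrow c (k + 1)) (T.root c) v :=
      fun hv => reflTransGen_mono k.le_succ (ih hv)
    rcases clocked_cases (T := T) (c := c) k with ⟨_, _, _, _, hk⟩ | ⟨_, _, _, _, hk⟩ |
      ⟨_, _, _, _, hk⟩ | ⟨b, hp, hb, _, hk⟩
    · exact hold (by unfold Reached at hv; rwa [hk] at hv)
    · exact hold (by unfold Reached at hv; rwa [hk] at hv)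
    · exact hold (by unfold Reached at hv; rwa [hk] at hv)
    · rcases hv with rfl | ⟨a, ha, rfl⟩
      · exact Relation.ReflTransGen.refl
      · rw [hk] at ha
        rcases ha with rfl | ha
        · have h1 := (reached_center_and_tail (T := T) (c := c) k).1
          rw [hp] at h1
          exact (hold h1).tail ⟨a, by rw [hk]; exact Set.mem_insert _ _, rfl, rfl⟩
        · exact hold (Or.inr ⟨a, ha, rfl⟩)

theorem SelectedArrow.ne_root {k : ℕ} {x y : T.Vertex} (h : T.SelectedArrow c k x y) :
    y ≠ T.root c := by
  obtain ⟨w, hw, -, rfl⟩ := h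
  exact head_ne_root hw

theorem SelectedArrow.tail_eq {k : ℕ} {x x' y : T.Vertex} (h : T.SelectedArrow c k x y)
    (h' : T.SelectedArrow c k x' y) : x = x' := by
  obtain ⟨w, hw, rfl, rfl⟩ := h
  obtain ⟨w', hw', rfl, h⟩ := h'
  rw [eq_of_head_eq hw hw' h.symm]

/-- A selected arrow is determined by its head, so a cycle through a vertex also passes through its
predecessor, and finally through the root, where no selected arrow ends. -/
theorem not_transGen_self {k : ℕ} {v : T.Vertex} (hv : T.Reached c k v) :
    ¬ Relation.TransGen (T.SelectedArrow c k) v v := by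
  induction hv.reflTransGen with
  | refl =>
    intro h
    obtain ⟨x, -, hx⟩ := (Relation.TransGen.tail'_iff).1 h
    exact hx.ne_root rfl
  | tail _ hxy ih =>
    intro h
    obtain ⟨z, hz, hzy⟩ := (Relation.TransGen.tail'_iff).1 h
    rw [hzy.tail_eq hxy] at hz
    exact ih (by
      obtain ⟨w, hw, rfl, -⟩ := hxy
      exact (reached_center_and_tail k).2 w hw) (Relation.TransGen.head' hxy hz)

/-- The greedy search has completed the turn about the head of a selected arrow, or still is at a
descendant of it. -/
theorem met_or_ancestor {k : ℕ} {a : W} (ha : a ∈ T.clockedSet c k) :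
    (∃ j < k, T.clockedPos c j = Sum.inl a) ∨
      Relation.ReflTransGen (T.SelectedArrow c k) (T.vertex c a)
        (T.center c (T.clockedPos c k)) := by
  induction k with
  | zero => exact ha.elim
  | succ k ih =>
    have ih' : a ∈ T.clockedSet c k → (∃ j < k + 1, T.clockedPos c j = Sum.inl a) ∨
      Relation.ReflTransGen (T.SelectedArrow c k) (T.vertex c a)
        (T.center c (T.clockedPos c k)) := fun h =>
      (ih h).imp (fun ⟨j, hj, h⟩ => ⟨j, hj.trans k.lt_succ_self, h⟩) id
    rcases clocked_cases (T := T) (c := c) k with ⟨w, hp, hw, hp', h⟩ | ⟨w, hp, hw, hp', h⟩ |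
      ⟨b, hp, hb, hp', h⟩ | ⟨b, hp, hb, hp', h⟩
    · rw [h] at ha
      refine (ih' ha).elim Or.inl fun hanc => ?_
      rw [hp] at hanc
      -- Backtracking along `w` leaves the descendants of the head of `a` only if `w = a`, and then
      -- `a` is being met.
      rcases hanc.cases_tail with heq | ⟨y, hay, hyw⟩
      · have := eq_of_head_eq hw ha heq
        subst this
        exact Or.inl ⟨k, k.lt_succ_self, hp⟩
      · right
        rw [hp', center_backtrack, ← hyw.tail_eq ⟨w, hw, rfl, rfl⟩]
        exact reflTransGen_mono k.le_succ hay
    · rw [h] at ha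
      refine (ih' ha).imp id fun hanc => ?_
      rw [hp', center_turn]
      rw [hp] at hanc
      exact reflTransGen_mono k.le_succ hanc
    · rw [h] at ha
      refine (ih' ha).imp id fun hanc => ?_
      rw [hp', center_backtrack]
      rw [hp] at hanc
      exact reflTransGen_mono k.le_succ hanc
    · rw [h] at ha
      rw [hp', center_turn]
      rcases ha with rfl | ha
      · exact Or.inr Relation.ReflTransGen.refl
      · refine (ih' ha).imp id fun hanc => ?_
        rw [hp] at hanc
        exact (reflTransGen_mono k.le_succ hanc).tail
          ⟨b, by rw [h]; exact Set.mem_insert _ _, rfl, rfl⟩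

theorem met_of_mem {k : ℕ} {a : W} (hp : T.clockedPos c k = Sum.inr (T.glue c a))
    (ha : a ∈ T.clockedSet c k) : ∃ j < k, T.clockedPos c j = Sum.inl a := by
  refine (met_or_ancestor ha).resolve_right fun h => ?_
  rw [hp] at h
  exact not_transGen_self (Or.inr ⟨a, ha, rfl⟩)
    (Relation.TransGen.tail' h ⟨a, ha, rfl, rfl⟩)

theorem exists_clockedPos_eq_tail {k : ℕ} {a : W} (ha : a ∈ T.clockedSet c k) :
    ∃ j, T.clockedPos c j = Sum.inr (T.glue c a) := by
  induction k with
  | zero => exact ha.elim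
  | succ k ih =>
    rcases clocked_cases (T := T) (c := c) k with ⟨_, _, _, _, h⟩ | ⟨_, _, _, _, h⟩ |
      ⟨_, _, _, _, h⟩ | ⟨b, hb, _, _, h⟩
    · exact ih (h ▸ ha)
    · exact ih (h ▸ ha)
    · exact ih (h ▸ ha)
    · rw [h] at ha
      rcases ha with rfl | ha
      · exact ⟨k, hb⟩
      · exact ih ha

/-- Backtracking skips the black triangle at the tail of the arrow, but this triangle was visited
when the arrow was selected. -/
theorem exists_clockedPos_before_white {k : ℕ} {w : W} (hp : T.clockedPos c k = Sum.inl w) :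
    w = T.outer ∨ ∃ j, T.clockedPos c j = Sum.inr (T.glue (c + 1) w) := by
  cases k with
  | zero => exact Or.inl (Sum.inl_injective hp).symm
  | succ k =>
    right
    rcases clocked_cases (T := T) (c := c) k with ⟨u, _, hu, h, _⟩ | ⟨_, _, _, h, _⟩ |
      ⟨u, hu, _, h, _⟩ | ⟨_, _, _, h, _⟩
    · rw [hp] at h
      rw [Sum.inl_injective h, Equiv.apply_symm_apply]
      exact exists_clockedPos_eq_tail hu
    · rw [hp] at h; cases h
    · rw [hp] at h
      rw [Sum.inl_injective h, Equiv.apply_symm_apply]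
      exact ⟨k, hu⟩
    · rw [hp] at h; cases h

theorem exists_clockedPos_before_black {k : ℕ} {w : W}
    (hp : T.clockedPos c k = Sum.inr (T.glue (c + 2) w)) :
    w ∈ T.clockedArborescence c ∨ ∃ j, T.clockedPos c j = Sum.inl w := by
  cases k with
  | zero => rw [clockedPos_zero] at hp; cases hp
  | succ k =>
    rcases clocked_cases (T := T) (c := c) k with ⟨u, _, hu, h, _⟩ | ⟨u, hu, _, h, _⟩ |
      ⟨u, hu, _, h, _⟩ | ⟨u, _, _, h, h'⟩
    · rw [hp] at h; cases h
    · rw [hp] at h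
      rw [(T.glue (c + 2)).injective (Sum.inr_injective h)]
      exact Or.inr ⟨k, hu⟩
    · rw [hp] at h; cases h
    · rw [hp] at h
      rw [(T.glue (c + 2)).injective (Sum.inr_injective h)]
      exact Or.inl ⟨k + 1, by
        change u ∈ T.clockedSet c (k + 1)
        rw [h']; exact Set.mem_insert _ _⟩

variable (T c) in
-- The search never halts, but its increasing selection stabilizes. After that, its course is a turn
-- around the finished tree.
theorem exists_clockedSet_eq [Finite W] :
    ∃ K, T.clockedSet c K = T.clockedArborescence c ∧
      ∀ k, K ≤ k → T.clockedSet c k = T.clockedSet c K := by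
  obtain ⟨K, hK⟩ := WellFoundedGT.monotone_chain_condition
    ⟨T.clockedSet c, clockedSet_mono⟩
  have hK' : ∀ k, K ≤ k → T.clockedSet c k = T.clockedSet c K := fun k hk => (hK k hk).symm
  refine ⟨K, Set.Subset.antisymm (fun w hw => ⟨K, hw⟩) ?_, hK'⟩
  rintro w ⟨k, hk⟩
  rcases le_total k K with h | h
  · exact clockedSet_mono h hk
  · exact hK' k h ▸ hk

/-- Once all arrows have been selected, the search turns about a vertex until it meets a selected
arrow. -/
theorem exists_clockedPos_rot {K : ℕ}
    (hK : ∀ k, K ≤ k → T.clockedSet c k = T.clockedSet c K)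
    {k : ℕ} (hk : K ≤ k) {w : W} (hp : T.clockedPos c k = Sum.inl w)
    (i : ℕ) : (∃ j, k ≤ j ∧ T.clockedPos c j = Sum.inl ((T.rot c ^ i) w)) ∨
      ∃ j, k ≤ j ∧ ∃ a ∈ T.clockedSet c K, T.vertex c a = T.vertex c w ∧
        T.clockedPos c j = Sum.inl a := by
  induction i with
  | zero => exact Or.inl ⟨k, le_rfl, hp⟩
  | succ i ih =>
    rcases ih with ⟨j, hkj, hj⟩ | h
    · have hv : T.vertex c ((T.rot c ^ i) w) = T.vertex c w :=
        T.vertex_eq_iff.2 (Equiv.Perm.SameCycle.symm ⟨i, by norm_cast⟩)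
      rcases clocked_cases (T := T) (c := c) j with ⟨u, hu, huA, -, -⟩ | ⟨u, hu, -, hu', -⟩ |
        ⟨u, hu, -, -, -⟩ | ⟨u, hu, -, -, -⟩
      · rw [hK j (hk.trans hkj)] at huA
        rw [hj] at hu
        rw [← Sum.inl_injective hu] at huA
        exact Or.inr ⟨j, hkj, _, huA, hv, hj⟩
      · left
        rw [hj] at hu
        rw [← Sum.inl_injective hu] at hu'
        have hrot : T.glue (c + 2) ((T.rot c ^ i) w) = T.glue (c + 1) ((T.rot c ^ (i + 1)) w) := by
          rw [pow_succ', Equiv.Perm.mul_apply, Gluing.glue_rot]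
        rw [hrot] at hu'
        rcases clocked_cases (T := T) (c := c) (j + 1) with ⟨z, hz, -, -, -⟩ | ⟨z, hz, -, -, -⟩ |
          ⟨z, hz, -, hz', -⟩ | ⟨z, hz, hzr, -, hz'⟩
        · rw [hu'] at hz; cases hz
        · rw [hu'] at hz; cases hz
        · rw [hu'] at hz
          rw [← Sum.inr_injective hz, Equiv.symm_apply_apply] at hz'
          exact ⟨j + 2, by omega, hz'⟩
        · exfalso
          rw [hK (j + 1 + 1) (by omega), ← hK (j + 1) (by omega)] at hz'
          exact hzr (Or.inr ⟨z, hz' ▸ Set.mem_insert _ _, rfl⟩)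
      · rw [hj] at hu; cases hu
      · rw [hj] at hu; cases hu
    · exact Or.inr h

theorem exists_clockedPos_white {K : ℕ}
    (hK : ∀ k, K ≤ k → T.clockedSet c k = T.clockedSet c K)
    {k : ℕ} (hk : K ≤ k) : ∃ j, k ≤ j ∧ ∃ w,
    T.clockedPos c j = Sum.inl w ∧ T.vertex c w = T.center c (T.clockedPos c k) := by
  rcases clocked_cases (T := T) (c := c) k with ⟨z, hz, -, -, -⟩ | ⟨z, hz, -, -, -⟩ |
    ⟨z, hz, -, hz', -⟩ | ⟨z, hz, hzr, -, hz'⟩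
  · exact ⟨k, le_rfl, z, hz, by rw [hz]; rfl⟩
  · exact ⟨k, le_rfl, z, hz, by rw [hz]; rfl⟩
  · exact ⟨k + 1, k.le_succ, _, hz', by rw [hz]; rfl⟩
  · exfalso
    rw [hK (k + 1) (by omega), ← hK k (by omega)] at hz'
    exact hzr (Or.inr ⟨z, hz' ▸ Set.mem_insert _ _, rfl⟩)

/-- Once all arrows have been selected, the search returns to the root. -/
theorem exists_center_eq_root [Finite W] {K : ℕ}
    (hK : ∀ k, K ≤ k → T.clockedSet c k = T.clockedSet c K) {k : ℕ} (hk : K ≤ k) :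
    ∃ j, k ≤ j ∧ T.center c (T.clockedPos c j) = T.root c := by
  have h1 : T.Reached c K (T.center c (T.clockedPos c k)) := by
    have := (reached_center_and_tail (T := T) (c := c) k).1
    unfold Reached at this
    rwa [hK k hk] at this
  replace h1 := h1.reflTransGen
  generalize hu : T.center c (T.clockedPos c k) = u at h1
  induction h1 generalizing k with
  | refl => exact ⟨k, le_rfl, hu⟩
  | @tail x y hx hxy ih =>
    obtain ⟨a, ha, rfl, rfl⟩ := hxy
    obtain ⟨j, hkj, w, hw, hwk⟩ := exists_clockedPos_white hK hk
    rw [hu] at hwk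
    obtain ⟨i, hi⟩ := (T.vertex_eq_iff.1 hwk).exists_nat_pow_eq
    have h2 : ∃ l, j ≤ l ∧ T.clockedPos c l = Sum.inl a := by
      rcases exists_clockedPos_rot hK (hk.trans hkj) hw i with ⟨l, hl, h⟩ | ⟨l, hl, a', ha', h, h'⟩
      · exact ⟨l, hl, hi ▸ h⟩
      · exact ⟨l, hl, eq_of_head_eq ha' ha (h.trans hwk) ▸ h'⟩
    obtain ⟨l, hl, hp⟩ := h2
    have h3 : T.center c (T.clockedPos c (l + 1)) = T.arrowTail c a := by
      rcases clocked_cases (T := T) (c := c) l with ⟨z, hz, -, hz', -⟩ | ⟨z, hz, hzA, -, -⟩ |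
        ⟨z, hz, -, -, -⟩ | ⟨z, hz, -, -, -⟩
      · rw [hp] at hz
        rw [hz', Sum.inl_injective hz]; rfl
      · rw [hp] at hz
        rw [← Sum.inl_injective hz, hK l (by omega)] at hzA
        exact absurd ha hzA
      · rw [hp] at hz; cases hz
      · rw [hp] at hz; cases hz
    obtain ⟨m, hm, hm'⟩ := ih (k := l + 1) (by omega) h3
    exact ⟨m, by omega, hm'⟩

/-! ### Completeness of the greedy search -/

section Finite

variable [Finite W]

/-- The search completes the turn about the head of every selected arrow. -/
theorem exists_clockedPos_eq_head {a : W} (ha : a ∈ T.clockedArborescence c) :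
    ∃ j, T.clockedPos c j = Sum.inl a := by
  obtain ⟨K, hKA, hK⟩ := exists_clockedSet_eq T c
  obtain ⟨k, hk, hroot⟩ := exists_center_eq_root hK le_rfl
  rw [← hKA, ← hK k hk] at ha
  rcases met_or_ancestor ha with ⟨j, -, h⟩ | h
  · exact ⟨j, h⟩
  · rw [hroot] at h
    rcases h.cases_tail with h | ⟨x, -, h⟩
    · exact absurd h.symm (head_ne_root ha)
    · exact absurd rfl h.ne_root

/-- About the root, a late turn is never interrupted by a selected arrow ending there. About any
other vertex, the turn is traced backwards from its last triangle, the one carrying the arrow that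
led to the vertex. -/
theorem exists_clockedPos_eq_of_reached {k : ℕ} {b : B} (hb : T.Reached c k (T.blackVertex c b)) :
    ∃ j, T.clockedPos c j = Sum.inr b := by
  rcases hb with hb | ⟨a, ha, hb⟩
  · obtain ⟨K, -, hK⟩ := exists_clockedSet_eq T c
    obtain ⟨k, hk, hroot⟩ := exists_center_eq_root hK le_rfl
    obtain ⟨j, hkj, w, hw, hwk⟩ := exists_clockedPos_white hK hk
    obtain ⟨u, rfl⟩ := (T.glue (c + 2)).surjective b
    rw [T.blackVertex_glue (by simp)] at hb
    obtain ⟨i, hi⟩ := (T.vertex_eq_iff.1 ((hwk.trans hroot).trans hb.symm)).exists_nat_pow_eq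
    have hnot : ∀ {a l}, a ∈ T.clockedSet c l → T.vertex c a ≠ T.vertex c w := fun ha h =>
      head_ne_root ha (h.trans (hwk.trans hroot))
    rcases exists_clockedPos_rot hK (hk.trans hkj) hw i with ⟨l, hl, h⟩ | ⟨l, hl, a', ha', h, h'⟩
    · rw [hi] at h
      have hv : T.vertex c u = T.vertex c w := hb.trans (hwk.trans hroot).symm
      rcases clocked_cases (T := T) (c := c) l with ⟨z, hz, hzA, -, -⟩ | ⟨z, hz, -, hz', -⟩ |
        ⟨z, hz, -, -, -⟩ | ⟨z, hz, -, -, -⟩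
      · rw [h] at hz
        rw [← Sum.inl_injective hz] at hzA
        exact absurd hv (hnot hzA)
      · rw [h] at hz
        rw [← Sum.inl_injective hz] at hz'
        exact ⟨_, hz'⟩
      · rw [h] at hz; cases hz
      · rw [h] at hz; cases hz
    · exact absurd h (hnot ha')
  -- Every triangle met in the turn was preceded by a visit to the black triangle before it, and
  -- that one by the white triangle before. The exception is the start next to a newly selected
  -- arrow, whose own triangle is met at the end of the turn.
  · have key : ∀ i : ℕ, ∃ j, T.clockedPos c j = Sum.inl (((T.rot c)⁻¹ ^ i) a) := by
      intro i
      have hv : ∀ i : ℕ, T.vertex c (((T.rot c)⁻¹ ^ i) a) = T.vertex c a := fun i =>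
        T.vertex_eq_iff.2 (Equiv.Perm.SameCycle.symm ⟨-i, by simp⟩)
      induction i with
      | zero => exact exists_clockedPos_eq_head ⟨k, ha⟩
      | succ i ih =>
        obtain ⟨j, hj⟩ := ih
        rcases exists_clockedPos_before_white hj with h | ⟨l, hl⟩
        · have := hv i
          rw [h] at this
          exact absurd this.symm (head_ne_root ha)
        · have hrot : T.glue (c + 1) (((T.rot c)⁻¹ ^ i) a) =
              T.glue (c + 2) (((T.rot c)⁻¹ ^ (i + 1)) a) := by
            rw [← Gluing.glue_rot, pow_succ', Equiv.Perm.mul_apply]; simp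
          rw [hrot] at hl
          rcases exists_clockedPos_before_black hl with h | h
          · exact exists_clockedPos_eq_head h
          · exact h
    obtain ⟨u, rfl⟩ := (T.glue (c + 1)).surjective b
    rw [T.blackVertex_glue (by simp)] at hb
    obtain ⟨i, hi⟩ : ∃ i : ℕ, ((T.rot c)⁻¹ ^ i) a = u := by
      have := (T.vertex_eq_iff.1 hb)
      rw [← Equiv.Perm.sameCycle_inv] at this
      exact this.exists_nat_pow_eq
    obtain ⟨j, hj⟩ := key i
    rw [hi] at hj
    rcases exists_clockedPos_before_white hj with h | h
    · rw [h] at hb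
      exact absurd hb (head_ne_root ha)
    · exact h

/-- The greedy search reaches every vertex of its colour. -/
theorem exists_reached (w : W) : ∃ k, T.Reached c k (T.vertex c w) := by
  have hclosed : ∀ w, (∃ k, T.Reached c k (T.arrowTail c w)) → ∃ k, T.Reached c k (T.vertex c w) := by
    rintro w ⟨k, hk⟩
    obtain ⟨j, hj⟩ := exists_clockedPos_eq_of_reached hk
    rcases clocked_cases (T := T) (c := c) j with ⟨z, hz, -, -, -⟩ | ⟨z, hz, -, -, -⟩ |
      ⟨z, hz, hzr, -, -⟩ | ⟨z, hz, -, -, hz'⟩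
    · rw [hj] at hz; cases hz
    · rw [hj] at hz; cases hz
    · rw [hj] at hz
      rw [(T.glue c).injective (Sum.inr_injective hz)]
      exact ⟨j, hzr⟩
    · rw [hj] at hz
      rw [(T.glue c).injective (Sum.inr_injective hz)]
      exact ⟨j + 1, Or.inr ⟨z, hz' ▸ Set.mem_insert _ _, rfl⟩⟩
  let S : Set W := {w | ∃ k, T.Reached c k (T.vertex c w)}
  let g : Equiv.Perm W := (T.glue c).trans (T.glue (c + 1)).symm
  have hsub : g ⁻¹' S ⊆ S := fun w hw => hclosed w hw
  -- The permutation `g` moves each triangle to one at the tail of its arrow. A set closed under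
  -- arrows from tail to head is, by finiteness, also closed backwards; this is the balance of in-
  -- and out-degrees.
  have heq : g ⁻¹' S = S := by
    refine Set.eq_of_subset_of_ncard_le hsub ?_
    rw [← Set.ncard_image_of_injective (g ⁻¹' S) g.injective, Set.image_preimage_eq _ g.surjective]
  have hiff : ∀ b d, (∃ k, T.Reached c k (T.vertex c ((T.glue d).symm b))) ↔
      ∃ k, T.Reached c k (T.blackVertex c b) := by
    intro b d
    by_cases hd : d = c
    · subst hd
      have : (T.glue d).symm b ∈ g ⁻¹' S ↔ (T.glue d).symm b ∈ S := by rw [heq]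
      refine this.symm.trans ?_
      simp only [Set.mem_preimage, S, g, Set.mem_ofPred_eq, Equiv.trans_apply,
        Equiv.apply_symm_apply]
      rfl
    · rw [T.vertex_glue_symm hd]
  exact T.connected.induction (p := fun w => ∃ k, T.Reached c k (T.vertex c w))
    (fun b e d h => (hiff b d).2 ((hiff b e).1 h)) (w := T.outer) ⟨0, Or.inl rfl⟩ w

theorem exists_clockedPos_eq_black (b : B) : ∃ j, T.clockedPos c j = Sum.inr b := by
  obtain ⟨k, hk⟩ := exists_reached (T := T) (c := c) ((T.glue (c + 1)).symm b)
  exact exists_clockedPos_eq_of_reached hk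

variable (T c) in
theorem isSpanningArborescence_clocked :
    T.IsSpanningArborescence c (T.clockedArborescence c) := by
  obtain ⟨K, hKA, hK⟩ := exists_clockedSet_eq T c
  have hall : ∀ v : T.Vertex, v.1 = c → T.Reached c K v := by
    rintro v rfl
    obtain ⟨w, hw⟩ := T.exists_vertex_eq v
    obtain ⟨k, hk⟩ := exists_reached (T := T) (c := v.1) w
    rw [hw] at hk
    rcases le_total k K with h | h
    · exact hk.mono h
    · unfold Reached at hk
      rwa [hK k h] at hk
  rw [← hKA]
  refine ⟨fun v hv => (hall v hv).reflTransGen, fun v hv hvr => ?_, fun w hw => head_ne_root hw⟩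
  obtain ⟨a, ha, hav⟩ := (hall v hv).resolve_left hvr
  exact ⟨a, ⟨ha, hav⟩, fun a' ⟨ha', h⟩ => eq_of_head_eq ha' ha (h.trans hav.symm)⟩

end Finite

end PlanarTrinity

/-- The rank is the length of a shortest path from `o`; here `P n v` says that some path has length
`n`. -/
theorem exists_rank_of_reflTransGen {V : Type*} (R : V → V → Prop) (o : V) :
    ∃ r : V → ℕ, ∀ v, Relation.ReflTransGen R o v → v ≠ o → ∃ u, R u v ∧ r u < r v := by
  let P : ℕ → V → Prop := fun n => Nat.rec (· = o) (fun _ p v => ∃ u, p u ∧ R u v) n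
  have hP : ∀ v, Relation.ReflTransGen R o v → ∃ n, P n v := by
    intro v hv
    induction hv with
    | refl => exact ⟨0, rfl⟩
    | tail _ h ih =>
      obtain ⟨n, hn⟩ := ih
      exact ⟨n + 1, _, hn, h⟩
  refine ⟨fun v => sInf {n | P n v}, fun v hv hvo => ?_⟩
  have h1 : P (sInf {n | P n v}) v := Nat.sInf_mem (s := {n | P n v}) (hP v hv)
  dsimp only
  generalize sInf {n | P n v} = n at h1
  cases n with
  | zero => exact absurd h1 hvo
  | succ n =>
    obtain ⟨u, hu, huv⟩ := h1
    exact ⟨u, huv, Nat.lt_succ_of_le (Nat.sInf_le hu)⟩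

namespace PlanarTrinity

variable {W B : Type*} {T : PlanarTrinity W B} {c : Color}

/-! ### States that extend an arborescence -/

variable (T) in
theorem card_nonroot_eq [Finite W] :
    Nat.card {v : T.Vertex // ∀ c, v ≠ T.root c} = Nat.card {w : W // w ≠ T.outer} := by
  have h1 : Nat.card {w : W // w ≠ T.outer} + 1 = Nat.card W := by
    have := Set.ncard_add_ncard_compl ({T.outer} : Set W)
    rw [Set.ncard_singleton, ← Nat.card_coe_set_eq ({T.outer}ᶜ : Set W)] at this
    rw [← this, add_comm]; rfl
  have h2 : Nat.card {v : T.Vertex // ∀ c, v ≠ T.root c} + 3 = Nat.card T.Vertex := by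
    have := Set.ncard_add_ncard_compl (Set.range T.root)
    rw [← Set.image_univ, Set.ncard_image_of_injective _ T.root_injective, Set.ncard_univ,
      Set.image_univ, ← Nat.card_coe_set_eq ((Set.range T.root)ᶜ)] at this
    rw [← this, add_comm]
    congr 1
    · simp
    · refine Nat.card_congr (Equiv.subtypeEquivRight fun v => ?_)
      simp [eq_comm]
  have h3 := T.eulerTwo
  unfold Gluing.EulerTwo at h3
  omega

/-- Two vertices are joined by the edge of colour `c` of a white triangle that is not in `A`. -/
def CoEdge (T : PlanarTrinity W B) (c : Color) (A : Set W) (x y : T.Vertex) : Prop :=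
  ∃ w ∉ A, ∃ d e, d ≠ c ∧ e ≠ c ∧ d ≠ e ∧ T.vertex d w = x ∧ T.vertex e w = y

/-- An arborescence whose complementary edges connect all vertices of the other colours extends to
a state. -/
theorem exists_state_of_coEdge [Finite W] {A : Set W} (hA : T.IsSpanningArborescence c A)
    (hconn : ∀ v : T.Vertex, v.1 ≠ c →
      Relation.ReflTransGen (T.CoEdge c A) (T.root (c + 1)) v) :
    ∃ t : T.State, ∀ w, t.Matches w (T.vertex c w) ↔ w ∈ A := by
  obtain ⟨r, hr⟩ := exists_rank_of_reflTransGen (T.CoEdge c A) (T.root (c + 1))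
  -- A vertex of colour `c` gets the triangle of its incoming arrow, any other vertex the triangle
  -- of an uncrossed edge to a vertex of smaller rank. Injectivity suffices because both sides have
  -- the same cardinality.
  have hg : ∀ v : {v : T.Vertex // ∀ c, v ≠ T.root c}, ∃ w, T.vertex v.1.1 w = v.1 ∧
      (v.1.1 = c ↔ w ∈ A) ∧ (v.1.1 ≠ c → ∃ d, d ≠ c ∧ d ≠ v.1.1 ∧ r (T.vertex d w) < r v.1) := by
    rintro ⟨v, hv⟩
    by_cases hc : v.1 = c
    · obtain ⟨w, ⟨hw, hwv⟩, -⟩ := hA.2.1 v hc (hv c)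
      exact ⟨w, by rw [hc]; exact hwv, by simp [hc, hw], fun h => absurd hc h⟩
    · obtain ⟨u, ⟨w, hw, d, e, hd, he, hde, rfl, rfl⟩, hlt⟩ := hr v (hconn v hc) (hv _)
      exact ⟨w, rfl, by simp [hw, he], fun _ => ⟨d, hd, hde, hlt⟩⟩
  choose g hg1 hg2 hg3 using hg
  have hout : ∀ v, g v ≠ T.outer := fun v h => by
    have := hg1 v
    rw [h] at this
    exact v.2 _ this.symm
  let G : {v : T.Vertex // ∀ c, v ≠ T.root c} → {w : W // w ≠ T.outer} := fun v => ⟨g v, hout v⟩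
  have hinj : Function.Injective G := by
    intro v v' h
    have h : g v = g v' := congrArg Subtype.val h
    by_cases hcol : v.1.1 = v'.1.1
    · apply Subtype.ext
      rw [← hg1 v, ← hg1 v', hcol, h]
    · exfalso
      by_cases hc : g v ∈ A
      · exact hcol (((hg2 v).2 hc).trans ((hg2 v').2 (h ▸ hc)).symm)
      · have hv : v.1.1 ≠ c := fun h' => hc ((hg2 v).1 h')
        have hv' : v'.1.1 ≠ c := fun h' => hc (h ▸ (hg2 v').1 h')
        obtain ⟨d, hd, hdv, hlt⟩ := hg3 v hv
        obtain ⟨d', hd', hdv', hlt'⟩ := hg3 v' hv'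
        have key : ∀ c d x y : Color, d ≠ c → d ≠ x → x ≠ c → y ≠ c → x ≠ y → d = y := by
          have : ∀ c d x y : Color, d = c ∨ d = x ∨ x = c ∨ y = c ∨ x = y ∨ d = y := by decide
          intro c d x y
          have := this c d x y
          tauto
        -- If both ends of an uncrossed edge chose the same triangle, each would have smaller rank
        -- than the other.
        have e1 := key c d v.1.1 v'.1.1 hd hdv hv hv' hcol
        have e2 := key c d' v'.1.1 v.1.1 hd' hdv' hv' hv (Ne.symm hcol)
        rw [e1, h, hg1 v'] at hlt
        rw [e2, ← h, hg1 v] at hlt'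
        exact lt_asymm hlt hlt'
  have hbij : Function.Bijective G :=
    hinj.bijective_of_nat_card_le (T.card_nonroot_eq).ge
  let t : T.State := ⟨(Equiv.ofBijective G hbij).symm, by
    intro w
    obtain ⟨v, rfl⟩ := hbij.2 w
    refine ⟨v.1.1, ?_⟩
    rw [show G v = Equiv.ofBijective G hbij v from rfl, Equiv.symm_apply_apply]
    exact (hg1 v).symm⟩
  have ht : ∀ v, t.Matches (g v) v.1 := fun v => ⟨hout v, by
    change ((Equiv.ofBijective G hbij).symm (Equiv.ofBijective G hbij v)).1 = v.1
    rw [Equiv.symm_apply_apply]⟩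
  refine ⟨t, fun w => ⟨fun hw => ?_, fun hw => ?_⟩⟩
  · have h1 := ht ⟨_, hw.ne_root⟩
    rw [hw.triangle_eq h1]
    exact (hg2 _).1 rfl
  · have hwo : w ≠ T.outer := fun h => hA.2.2 w hw (by rw [h]; rfl)
    obtain ⟨v, hv⟩ := hbij.2 ⟨w, hwo⟩
    have hv : g v = w := congrArg Subtype.val hv
    have h1 := ht v
    rw [hv, ← hg1 v, hv, (hg2 v).2 (hv ▸ hw)] at h1
    exact h1

theorem coEdge_of_notMem {A : Set W} {w : W} (hw : w ∉ A) {d e : Color} (hd : d ≠ c) (he : e ≠ c)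
    (hde : d ≠ e) : T.CoEdge c A (T.vertex d w) (T.vertex e w) :=
  ⟨w, hw, d, e, hd, he, hde, rfl, rfl⟩

theorem notMem_clockedArborescence {k : ℕ} {w : W} (hr : T.Reached c k (T.vertex c w))
    (hw : w ∉ T.clockedSet c k) : w ∉ T.clockedArborescence c :=
  fun ⟨_, h⟩ => hw (mem_of_reached hr h)

/-- The vertices that the greedy search passes on its right side are connected by edges that are
not crossed by selected arrows. -/
theorem reflTransGen_coEdge_clockedPos (k : ℕ) :
    (∀ w, T.clockedPos c k = Sum.inl w → Relation.ReflTransGen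
      (T.CoEdge c (T.clockedArborescence c)) (T.root (c + 1)) (T.vertex (c + 2) w)) ∧
    ∀ b, T.clockedPos c k = Sum.inr b → Relation.ReflTransGen
      (T.CoEdge c (T.clockedArborescence c)) (T.root (c + 1)) (T.blackVertex (c + 1) b) := by
  induction k using Nat.strong_induction_on with
  | _ k ih =>
    cases k with
    | zero =>
      rw [clockedPos_zero]
      refine ⟨fun w hw => ?_, fun b hb => by cases hb⟩
      rw [← Sum.inl_injective hw]
      have hout : T.outer ∉ T.clockedArborescence c := fun ⟨k, hk⟩ =>
        head_ne_root (k := k) (a := T.outer) hk rfl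
      exact Relation.ReflTransGen.single
        (coEdge_of_notMem hout (by simp) (by simp) (by simp))
    | succ k =>
      have hcen := (reached_center_and_tail (T := T) (c := c) k).1
      rcases clocked_cases (T := T) (c := c) k with ⟨w, hp, hw, hp', -⟩ | ⟨w, hp, hw, hp', -⟩ |
        ⟨a, hp, ha, hp', -⟩ | ⟨a, hp, ha, hp', -⟩ <;> rw [hp'] <;> rw [hp] at hcen
      · refine ⟨fun u hu => ?_, fun b hb => by cases hb⟩
        rw [← Sum.inl_injective hu, T.vertex_glue_symm (by simp), T.blackVertex_glue (by simp)]
        exact (ih k k.lt_succ_self).1 w hp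
      · refine ⟨fun u hu => (by cases hu), fun b hb => ?_⟩
        rw [← Sum.inr_injective hb, T.blackVertex_glue (by simp)]
        exact ((ih k k.lt_succ_self).1 w hp).tail
          (coEdge_of_notMem (notMem_clockedArborescence hcen hw) (by simp) (by simp) (by simp))
      · refine ⟨fun u hu => ?_, fun b hb => by cases hb⟩
        rw [← Sum.inl_injective hu, T.vertex_glue_symm (by simp), T.blackVertex_glue (by simp)]
        -- A selected arrow at which the search does not branch off again has been backtracked
        -- before, and the required vertex was on the right then. An arrow that is not selected is
        -- never selected later, so its edge may be used.
        by_cases haA : a ∈ T.clockedSet c k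
        · obtain ⟨j, hj, hjp⟩ := met_of_mem hp haA
          exact (ih j (hj.trans k.lt_succ_self)).1 a hjp
        · have h1 := (ih k k.lt_succ_self).2 _ hp
          rw [T.blackVertex_glue (by simp)] at h1
          exact h1.tail
            (coEdge_of_notMem (notMem_clockedArborescence ha haA) (by simp) (by simp) (by simp))
      · refine ⟨fun u hu => (by cases hu), fun b hb => ?_⟩
        have h1 := (ih k k.lt_succ_self).2 _ hp
        rw [T.blackVertex_glue (by simp)] at h1
        rw [← Sum.inr_injective hb, T.blackVertex_glue (by simp)]
        exact h1

variable (T c) in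
/-- Some state contains the clocked arborescence of colour `c`. -/
theorem exists_state_clocked [Finite W] :
    ∃ t : T.State, ∀ w, t.Matches w (T.vertex c w) ↔ w ∈ T.clockedArborescence c := by
  refine exists_state_of_coEdge (T.isSpanningArborescence_clocked c) fun v hv => ?_
  obtain ⟨b, hb⟩ := T.exists_blackVertex_eq v
  obtain ⟨j, hj⟩ := exists_clockedPos_eq_black (T := T) (c := c) b
  rcases Color.cases c v.1 with h | h | h
  · exact absurd h hv
  · rw [← hb, h]
    exact (reflTransGen_coEdge_clockedPos j).2 b hj
  · rw [← hb, h]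
    rcases clocked_cases (T := T) (c := c) j with ⟨w, hp, -, -, -⟩ | ⟨w, hp, -, -, -⟩ |
      ⟨a, hp, -, hp', -⟩ | ⟨a, hp, -, -, ha⟩ <;> rw [hj] at hp
    · cases hp
    · cases hp
    · have h1 := (reflTransGen_coEdge_clockedPos (j + 1)).1 _ hp'
      rwa [← Sum.inr_injective hp, T.vertex_glue_symm (by simp)] at h1
    · obtain ⟨i, hi⟩ := exists_clockedPos_eq_head (T := T) (c := c) (a := a)
        ⟨j + 1, by
          change a ∈ T.clockedSet c (j + 1)
          rw [ha]; exact Set.mem_insert _ _⟩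
      have h1 := (reflTransGen_coEdge_clockedPos i).1 _ hi
      rwa [Sum.inr_injective hp, T.blackVertex_glue (by simp)]

/-! ### The clocked state -/

variable {s t : T.State}

/-- Heights vanish around vertices that are reached along arrows contained in both states. -/
theorem IsHeight.eq_zero_of_reached [Finite W] {h : B → ℚ} (hh : IsHeight s t h) {k : ℕ}
    (hs : ∀ w ∈ T.clockedSet c k, s.Matches w (T.vertex c w))
    (ht : ∀ w ∈ T.clockedSet c k, t.Matches w (T.vertex c w)) {b : B}
    (hb : T.Reached c k (T.blackVertex c b)) : h b = 0 := by
  have h1 := hb.reflTransGen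
  generalize hv : T.blackVertex c b = v at h1
  clear hb
  induction h1 generalizing b with
  | refl => exact hh.eq_zero_of_blackVertex_eq_root hv
  | tail _ hxy ih =>
    obtain ⟨a, ha, rfl, rfl⟩ := hxy
    have h0 : h (T.glue c a) = 0 := ih rfl
    have hcol : ∀ e, h (T.glue e a) = 0 := by
      intro e
      rw [← h0]
      refine T.eq_of_faceDiff_eq_zero (fun d => ?_) e c
      rw [hh.faceDiff_eq, Pi.sub_apply, State.chain_apply_color _ (hs a ha).ne_outer,
        State.chain_apply_color _ (hs a ha).ne_outer, (hs a ha).color_eq, (ht a ha).color_eq,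
        sub_self]
    -- Around the head of `a`, which both states match to `a`, the height is bounded by its value
    -- right after `a`. With the states exchanged, this gives both inequalities.
    have key : ∀ {s t : T.State} {h : B → ℚ}, IsHeight s t h → (∀ e, h (T.glue e a) = 0) →
        s.Matches a (T.vertex c a) → h b ≤ 0 := by
      intro s t h hh hcol hs
      rw [← hcol (c + 2)]
      refine T.le_of_faceDiff_nonneg (fun u hu hua => ?_) hv
      rw [hh.faceDiff_eq, Pi.sub_apply]
      have h1 : s.chain (u, c) = 0 := by
        rw [State.chain, if_neg]
        intro h1
        rw [hu] at h1
        exact hua (h1.triangle_eq hs)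
      rw [h1, sub_zero, State.chain]
      split_ifs <;> norm_num
    have h1 := key hh hcol (hs a ha)
    have h2 := key hh.neg (by simpa using hcol) (ht a ha)
    simp only [Pi.neg_apply] at h2
    linarith

/-- The vertex `v` is a root or matched to a white triangle that the greedy search has met. -/
def Settled (s : T.State) (c : Color) (k : ℕ) (v : T.Vertex) : Prop :=
  (∃ d, v = T.root d) ∨ ∃ j < k, ∃ u, T.clockedPos c j = Sum.inl u ∧ s.Matches u v

theorem Settled.mono {k l : ℕ} (hkl : k ≤ l) {v : T.Vertex} (h : Settled s c k v) :
    Settled s c l v :=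
  h.imp id fun ⟨j, hj, h⟩ => ⟨j, hj.trans_le hkl, h⟩

/-- The search keeps vertices of the other two colours on its right. The invariant says that those
of colour `c + 1` are roots or have partners already met, and that from a vertex of colour `c + 2`
the edge of its partner leads to such a vertex. This prevents a newly selected arrow from lying in a
triangle that `s` matches to colour `c + 1`. -/
theorem matches_and_settled_of_forall_not_move [Finite W] (hs : ∀ σ u, ¬ T.ClockwiseMove σ s u) (k : ℕ) :
    (∀ a ∈ T.clockedSet c k, s.Matches a (T.vertex c a)) ∧
    (∀ w, T.clockedPos c k = Sum.inl w → ∀ u, s.Matches u (T.vertex (c + 2) w) →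
      Settled s c k (T.vertex (c + 1) u)) ∧
    ∀ b, T.clockedPos c k = Sum.inr b → Settled s c k (T.blackVertex (c + 1) b) := by
  induction k using Nat.strong_induction_on with
  | _ k ih =>
    cases k with
    | zero =>
      rw [clockedPos_zero, clockedSet_zero]
      refine ⟨fun a ha => ha.elim, fun w hw u hu => ?_, fun b hb => by cases hb⟩
      rw [← Sum.inl_injective hw] at hu
      exact absurd rfl (hu.ne_root (c + 2))
    | succ k =>
      have hcen := (reached_center_and_tail (T := T) (c := c) k).1
      obtain ⟨ihA, ihw, ihb⟩ := ih k k.lt_succ_self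
      have hmem : ∀ {w}, T.Reached c k (T.vertex c w) → s.Matches w (T.vertex c w) →
          w ∈ T.clockedSet c k := by
        rintro w (hr | ⟨a, ha, haw⟩) hw
        · exact absurd hr (hw.ne_root c)
        · have h1 := ihA a ha
          rw [haw] at h1
          rwa [hw.triangle_eq h1]
      rcases clocked_cases (T := T) (c := c) k with ⟨w, hp, hw, hp', hA⟩ | ⟨w, hp, hw, hp', hA⟩ |
        ⟨a, hp, ha, hp', hA⟩ | ⟨a, hp, ha, hp', hA⟩ <;> rw [hp', hA] <;> rw [hp] at hcen
      · refine ⟨ihA, fun u hu z hz => ?_, fun b hb => by cases hb⟩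
        rw [← Sum.inl_injective hu, T.vertex_glue_symm (by simp), T.blackVertex_glue (by simp)] at hz
        exact (ihw w hp z hz).mono k.le_succ
      · refine ⟨ihA, fun u hu => (by cases hu), fun b hb => ?_⟩
        rw [← Sum.inr_injective hb, T.blackVertex_glue (by simp)]
        by_cases hwo : w = T.outer
        · exact Or.inl ⟨c + 1, by rw [hwo]; rfl⟩
        · have h1 := s.matches_color hwo
          -- Colour `c` would make `w` selected, since its vertex has been reached; colour `c + 1`
          -- makes `w` the partner, met right now; colour `c + 2` is covered by the invariant at
          -- `w`.
          rcases Color.cases c (s.color w) with h | h | h <;> rw [h] at h1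
          · exact absurd (hmem hcen h1) hw
          · exact Or.inr ⟨k, k.lt_succ_self, w, hp, h1⟩
          · exact (ihw w hp w h1).mono k.le_succ
      · refine ⟨ihA, fun u hu z hz => ?_, fun b hb => by cases hb⟩
        rw [← Sum.inl_injective hu, T.vertex_glue_symm (by simp), T.blackVertex_glue (by simp)] at hz
        have hy := ihb _ hp
        rw [T.blackVertex_glue (by simp)] at hy
        have hmet : (∃ j < k, T.clockedPos c j = Sum.inl a) →
            Settled s c (k + 1) (T.vertex (c + 1) z) := fun ⟨j, hj, hja⟩ =>
          ((ih j (by omega)).2.1 a hja z hz).mono (by omega)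
        by_cases hao : a = T.outer
        · rw [hao] at hz
          exact absurd rfl (hz.ne_root (c + 2))
        · have h1 := s.matches_color hao
          rcases Color.cases c (s.color a) with h | h | h <;> rw [h] at h1
          · exact hmet (met_of_mem hp (hmem ha h1))
          · rcases hy with ⟨d, hd⟩ | ⟨j, hj, u, hju, hu⟩
            · exact absurd hd (h1.ne_root d)
            · rw [hu.triangle_eq h1] at hju
              exact hmet ⟨j, hj, hju⟩
          · rw [hz.triangle_eq h1]
            exact hy.mono k.le_succ
      · have hy := ihb _ hp
        rw [T.blackVertex_glue (by simp)] at hy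
        refine ⟨?_, fun u hu => (by cases hu), fun b hb => ?_⟩
        · have hao : a ≠ T.outer := fun h => ha (Or.inl (by rw [h]; rfl))
          have h1 := s.matches_color hao
          suffices hca : s.color a = c by
            rintro x (rfl | hx)
            · rwa [hca] at h1
            · exact ihA x hx
          rcases Color.cases c (s.color a) with h | h | h <;> rw [h] at h1
          · exact h
          · exfalso
            rcases hy with ⟨d, hd⟩ | ⟨j, hj, u, hju, hu⟩
            · exact h1.ne_root d hd
            -- The triangle `a` would have been met before, so the head of its arrow would have been
            -- reached.
            · rw [hu.triangle_eq h1] at hju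
              have h2 := (reached_center_and_tail (T := T) (c := c) j).1
              rw [hju] at h2
              exact ha (h2.mono hj.le)
          · exfalso
            obtain ⟨t, ht⟩ := T.exists_state_clocked c
            obtain ⟨h', hh⟩ := exists_isHeight s t
            have hta : t.Matches a (T.vertex c a) := (ht a).2 ⟨k + 1, by
              change a ∈ T.clockedSet c (k + 1)
              rw [hA]; exact Set.mem_insert _ _⟩
            have h0 : h' (T.glue c a) = 0 :=
              hh.eq_zero_of_reached ihA (fun w hw => (ht w).2 ⟨k, hw⟩) hcen
            have h2 := hh.apply_sub_apply a (c + 2)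
            rw [State.chain_apply_color _ hao, State.chain_apply_color _ hao, h,
              hta.color_eq] at h2
            simp only [Color.add_two_add_one, Color.add_two_add_two, h0] at h2
            simp at h2
            obtain ⟨σ, u, hu⟩ := hh.exists_move (b := T.glue (c + 1) a) (by rw [h2]; norm_num)
            exact hs σ u hu
        · rw [← Sum.inr_injective hb, T.blackVertex_glue (by simp)]
          exact hy.mono k.le_succ

/-- A state that admits no clockwise move is the clocked state. -/
theorem isClockedState_of_forall_not_move [Finite W] (hs : ∀ σ u, ¬ T.ClockwiseMove σ s u) :
    T.IsClockedState s := by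
  intro c w
  have hsub : ∀ a ∈ T.clockedArborescence c, s.Matches a (T.vertex c a) :=
    fun a ⟨k, hk⟩ => (matches_and_settled_of_forall_not_move hs k).1 a hk
  refine ⟨fun hw => ?_, hsub w⟩
  obtain ⟨a, ⟨ha, haw⟩, -⟩ :=
    (T.isSpanningArborescence_clocked c).2.1 (T.vertex c w) rfl (hw.ne_root c)
  have h1 := hsub a ha
  rw [show T.vertex c a = T.vertex c w from haw] at h1
  rwa [hw.triangle_eq h1]

end PlanarTrinity

/-! ### Commuting moves -/

/-- `LabeledPath M s l t`: performing the moves with the labels in `l` leads from `s` to `t`. -/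
inductive LabeledPath {S L : Type*} (M : L → S → S → Prop) : S → List L → S → Prop
  | nil (s : S) : LabeledPath M s [] s
  | cons {σ : L} {l : List L} {s t u : S} :
      M σ s t → LabeledPath M t l u → LabeledPath M s (σ :: l) u

/-- Moves are determined by their label and their source, and different moves from the same source
commute. -/
structure IsCommuting {S L : Type*} (M : L → S → S → Prop) : Prop where
  target_eq : ∀ {σ s t u}, M σ s t → M σ s u → t = u
  exists_join : ∀ {σ τ s t u}, M σ s t → M τ s u → σ ≠ τ → ∃ v, M τ t v ∧ M σ u v

namespace LabeledPath

variable {S L : Type*} {M : L → S → S → Prop} {s t u x y : S} {l l' : List L} {σ : L}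

theorem append (h : LabeledPath M s l t) (h' : LabeledPath M t l' u) :
    LabeledPath M s (l ++ l') u := by
  induction h with
  | nil => exact h'
  | cons h _ ih => exact cons h (ih h')

theorem single (h : M σ s t) : LabeledPath M s [σ] t := cons h (nil t)

theorem reverse (h : LabeledPath M s l t) :
    LabeledPath (fun σ s t => M σ t s) t l.reverse s := by
  induction h with
  | nil s => exact nil s
  | cons h _ ih =>
    rw [List.reverse_cons]
    exact ih.append (single (M := fun σ s t => M σ t s) h)

theorem eq_of_nil (h : LabeledPath M s [] t) : s = t := by cases h; rfl

theorem eq_of_not_move (h : LabeledPath M s l t) (hs : ∀ σ t, ¬ M σ s t) : s = t := by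
  cases h with
  | nil => rfl
  | cons h => exact absurd h (hs _ _)

/-- A move and a path from the same source can be completed. -/
theorem strip (hM : IsCommuting M) (hy : M σ x y) (ht : LabeledPath M x l t) :
    (∃ l', LabeledPath M y l' t ∧ l.Perm (σ :: l')) ∨
      σ ∉ l ∧ ∃ t' l', M σ t t' ∧ LabeledPath M y l' t' ∧ l'.Perm l := by
  induction ht generalizing y with
  | nil x => exact Or.inr ⟨by simp, y, [], hy, nil y, List.Perm.refl _⟩
  | @cons τ l x u t hu ht ih =>
    -- Equal labels have equal targets; otherwise the commuting square is filled in and the argument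
    -- continues from its far side.
    by_cases hστ : σ = τ
    · subst hστ
      rw [← hM.target_eq hy hu] at ht
      exact Or.inl ⟨l, ht, List.Perm.refl _⟩
    · obtain ⟨v, hyv, huv⟩ := hM.exists_join hy hu hστ
      rcases ih huv with ⟨l', hl', hp⟩ | ⟨hσ, t', l', htt', hl', hp⟩
      · exact Or.inl ⟨τ :: l', cons hyv hl', (hp.cons τ).trans (List.Perm.swap σ τ l')⟩
      · exact Or.inr ⟨by simp [hστ, hσ], t', τ :: l', htt', cons hyv hl', hp.cons τ⟩

/-- Two paths from the same source can be completed, performing on each of them the moves that it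
lacks. -/
theorem exists_join [DecidableEq L] (hM : IsCommuting M) (hs : LabeledPath M x l s)
    (ht : LabeledPath M x l' t) :
    ∃ j k k', LabeledPath M s k j ∧ LabeledPath M t k' j ∧
      ∀ ρ, k.count ρ = l'.count ρ - l.count ρ ∧ k'.count ρ = l.count ρ - l'.count ρ := by
  induction hs generalizing t l' with
  | nil x => exact ⟨t, l', [], ht, nil t, by simp⟩
  | @cons σ l x y s hy hs ih =>
    rcases strip hM hy ht with ⟨l₁, h₁, hp⟩ | ⟨hσ, t', l₁, htt', h₁, hp⟩
    · obtain ⟨j, k, k', hk, hk', hc⟩ := ih h₁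
      refine ⟨j, k, k', hk, hk', fun ρ => ?_⟩
      have h := hc ρ
      rw [hp.count_eq, List.count_cons, List.count_cons]
      omega
    · obtain ⟨j, k, k', hk, hk', hc⟩ := ih h₁
      refine ⟨j, k, σ :: k', hk, cons htt' hk', fun ρ => ?_⟩
      have h := hc ρ
      rw [hp.count_eq] at h
      rw [List.count_cons, List.count_cons]
      by_cases hρ : σ = ρ
      · subst hρ
        rw [List.count_eq_zero.2 hσ] at h ⊢
        simp only [beq_self_eq_true, if_true]
        omega
      · simp only [beq_iff_eq, hρ, if_false]
        omega

/-- All paths to a state that admits no move have the same labels. -/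
theorem perm_of_not_move (hM : IsCommuting M) (ht : ∀ σ u, ¬ M σ t u) (h : LabeledPath M s l t)
    (h' : LabeledPath M s l' t) : l.Perm l' := by
  induction h generalizing l' with
  | nil s =>
    cases h' with
    | nil => exact List.Perm.refl _
    | cons h => exact absurd h (ht _ _)
  | cons hy _ ih =>
    rcases strip hM hy h' with ⟨l₁, h₁, hp⟩ | ⟨-, t', -, htt', -, -⟩
    · exact ((ih ht h₁).cons _).trans hp.symm
    · exact absurd htt' (ht _ _)

end LabeledPath

theorem exists_path_to_sink {S L : Type*} [Finite S] {M : L → S → S → Prop} {r : S → ℚ}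
    (hr : ∀ σ s t, M σ s t → r s < r t) (s : S) :
    ∃ l t, LabeledPath M s l t ∧ ∀ σ u, ¬ M σ t u := by
  have : IsTrans S (fun t s => r s < r t) := ⟨fun _ _ _ h h' => h'.trans h⟩
  have : Std.Irrefl (fun t s : S => r s < r t) := ⟨fun _ h => lt_irrefl _ h⟩
  have wf := Finite.wellFounded_of_trans_of_irrefl (fun t s : S => r s < r t)
  induction s using wf.induction with
  | _ s ih =>
    by_cases h : ∀ σ u, ¬ M σ s u
    · exact ⟨[], s, LabeledPath.nil s, h⟩
    · push Not at h
      obtain ⟨σ, u, hu⟩ := h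
      obtain ⟨l, t, hl, ht⟩ := ih u (hr σ s u hu)
      exact ⟨σ :: l, t, LabeledPath.cons hu hl, ht⟩

/-- Finitely many states with commuting moves in both directions, without cycles and with only one
state that admits no move, form a distributive lattice. -/
theorem exists_distribLattice {S L : Type*} [Finite S] [DecidableEq L] {M : L → S → S → Prop}
    (hM : IsCommuting M) (hM' : IsCommuting fun σ s t => M σ t s) {r : S → ℚ}
    (hr : ∀ σ s t, M σ s t → r s < r t) {m : S} (hm : ∀ s, (∀ σ t, ¬ M σ s t) ↔ s = m) :
    ∃ (D : DistribLattice S) (a : S) (φ : S → L → ℕ),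
      (∀ s t, D.le s t ↔ ∃ l, LabeledPath M s l t) ∧
      (∀ s, D.le a s) ∧
      (∀ s, (∀ σ t, ¬ M σ t s) ↔ s = a) ∧
      (∀ s, (∃ l, LabeledPath M a l s) ∧ ∀ l, LabeledPath M a l s → ∀ σ, l.count σ = φ s σ) ∧
      Function.Injective φ ∧
      (∀ s t, D.le s t ↔ φ s ≤ φ t) ∧
      (∀ s t, φ (D.inf s t) = φ s ⊓ φ t) ∧
      (∀ s t, φ (D.sup s t) = φ s ⊔ φ t) ∧
      (∀ s, D.le s m) := by
  have hup : ∀ s, ∃ l, LabeledPath M s l m := fun s => by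
    obtain ⟨l, t, hl, ht⟩ := exists_path_to_sink hr s
    rw [hm] at ht
    exact ⟨l, ht ▸ hl⟩
  obtain ⟨-, a, -, ha⟩ := exists_path_to_sink (M := fun σ s t => M σ t s) (r := fun s => - r s)
    (fun σ s t h => neg_lt_neg (hr σ t s h)) m
  -- Two sources have paths to `m`; completing the reversed paths leaves no room for any move at
  -- their ends.
  have hdown : ∀ s, (∀ σ t, ¬ M σ t s) → s = a := by
    intro s hs
    obtain ⟨l, hl⟩ := hup s
    obtain ⟨l', hl'⟩ := hup a
    obtain ⟨j, k, k', hk, hk', -⟩ := LabeledPath.exists_join hM' hl.reverse hl'.reverse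
    exact (hk.eq_of_not_move hs).trans (hk'.eq_of_not_move ha).symm
  have hfrom : ∀ s, ∃ l, LabeledPath M a l s := by
    intro s
    obtain ⟨l, t, hl, ht⟩ := exists_path_to_sink (M := fun σ s t => M σ t s) (r := fun s => - r s)
      (fun σ s t h => neg_lt_neg (hr σ t s h)) s
    rw [hdown t ht] at hl
    exact ⟨_, hl.reverse⟩
  -- Both paths are prolonged to the sink, where labels are unique up to order, and the common tail
  -- is cancelled.
  have hperm : ∀ {s t l l'}, LabeledPath M s l t → LabeledPath M s l' t → l.Perm l' := by
    intro s t l l' h h'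
    obtain ⟨k, hk⟩ := hup t
    exact (List.perm_append_right_iff k).1
      (LabeledPath.perm_of_not_move hM ((hm m).2 rfl) (h.append hk) (h'.append hk))
  choose p hp using hfrom
  let φ : S → L → ℕ := fun s σ => (p s).count σ
  have hφ : ∀ {s l}, LabeledPath M a l s → ∀ σ, l.count σ = φ s σ :=
    fun h σ => (hperm h (hp _)).count_eq σ
  have hadd : ∀ {s t l}, LabeledPath M s l t → ∀ σ, φ t σ = φ s σ + l.count σ := by
    intro s t l h σ
    rw [← hφ ((hp s).append h), List.count_append]
  have hle : ∀ s t, φ s ≤ φ t ↔ ∃ l, LabeledPath M s l t := by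
    intro s t
    constructor
    · intro h
      obtain ⟨j, k, k', hk, hk', hc⟩ := LabeledPath.exists_join hM (hp s) (hp t)
      have : k' = [] := by
        rw [List.eq_nil_iff_forall_not_mem]
        intro ρ
        rw [← List.count_eq_zero, (hc ρ).2, Nat.sub_eq_zero_iff_le]
        exact h ρ
      subst this
      rw [← hk'.eq_of_nil] at hk
      exact ⟨k, hk⟩
    · rintro ⟨l, hl⟩ σ
      rw [hadd hl]
      exact Nat.le_add_right _ _
  have hinj : Function.Injective φ := by
    intro s t h
    obtain ⟨l, hl⟩ := (hle s t).1 h.le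
    have : l = [] := by
      rw [List.eq_nil_iff_forall_not_mem]
      intro σ
      have := hadd hl σ
      rw [h] at this
      rw [← List.count_eq_zero]
      omega
    subst this
    exact hl.eq_of_nil
  have hsup : ∀ s t, ∃ j, φ j = φ s ⊔ φ t := by
    intro s t
    obtain ⟨j, k, k', hk, -, hc⟩ := LabeledPath.exists_join hM (hp s) (hp t)
    refine ⟨j, funext fun σ => ?_⟩
    rw [hadd hk, (hc σ).1]
    change φ s σ + (φ t σ - φ s σ) = max (φ s σ) (φ t σ)
    omega
  -- The reversed paths from `m` are completed to `j`. Going down from `s` removes the truncated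
  -- difference of `φ s` and `φ t`, which leaves the minimum.
  have hinf : ∀ s t, ∃ j, φ j = φ s ⊓ φ t := by
    intro s t
    obtain ⟨l, hl⟩ := hup s
    obtain ⟨l', hl'⟩ := hup t
    obtain ⟨j, k, k', hk, -, hc⟩ := LabeledPath.exists_join hM' hl.reverse hl'.reverse
    refine ⟨j, funext fun σ => ?_⟩
    have h1 := hadd hk.reverse σ
    have h2 := hadd hl σ
    have h3 := hadd hl' σ
    have h4 := (hc σ).1
    rw [List.count_reverse] at h1
    rw [List.count_reverse, List.count_reverse] at h4
    change φ j σ = min (φ s σ) (φ t σ)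
    omega
  choose sup hsup using hsup
  choose inf hinf using hinf
  let D : DistribLattice S := {
    le := fun s t => φ s ≤ φ t
    lt := fun s t => φ s < φ t
    le_refl := fun s => le_rfl
    le_trans := fun s t u h h' => h.trans h'
    lt_iff_le_not_ge := fun s t => lt_iff_le_not_ge
    le_antisymm := fun s t h h' => hinj (h.antisymm h')
    sup := sup
    inf := inf
    le_sup_left := fun s t => by rw [hsup]; exact le_sup_left
    le_sup_right := fun s t => by rw [hsup]; exact le_sup_right
    sup_le := fun s t u h h' => by rw [hsup]; exact sup_le h h'
    inf_le_left := fun s t => by rw [hinf]; exact inf_le_left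
    inf_le_right := fun s t => by rw [hinf]; exact inf_le_right
    le_inf := fun s t u h h' => by rw [hinf]; exact le_inf h h'
    -- Distributivity is inherited from `L → ℕ` along `φ`.
    le_sup_inf := fun s t u => by
      change φ (inf (sup s t) (sup s u)) ≤ φ (sup s (inf t u))
      rw [hinf, hsup, hsup, hsup, hinf]
      exact le_sup_inf }
  refine ⟨D, a, φ, hle, fun s => (hle a s).2 ⟨_, hp s⟩, fun s => ⟨hdown s, ?_⟩,
    fun s => ⟨⟨_, hp s⟩, fun l hl σ => hφ hl σ⟩, hinj, fun s t => Iff.rfl, hinf, hsup,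
    fun s => (hle s m).2 (hup s)⟩
  rintro rfl
  exact ha

theorem exists_equiv_sum_of_compl {X J K : Type*} {A : Set X} (i : J ≃ A) (k : K ≃ (Aᶜ : Set X)) :
    ∃ f : X ≃ K ⊕ J, (∀ x, f (i x) = Sum.inr x) ∧ ∀ x, f (k x) = Sum.inl x := by
  have hbij : Function.Bijective (Sum.elim (fun x => (k x : X)) (fun x => (i x : X))) := by
    constructor
    · rintro (x | x) (y | y) h
      · exact congrArg _ (k.injective (Subtype.ext h))
      · exact absurd (show (k x : X) ∈ A by rw [show (k x : X) = i y from h]; exact (i y).2) (k x).2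
      · exact absurd (show (k y : X) ∈ A by rw [← show (i x : X) = k y from h]; exact (i x).2)
          (k y).2
      · exact congrArg _ (i.injective (Subtype.ext h))
    · intro x
      by_cases hx : x ∈ A
      · exact ⟨Sum.inr (i.symm ⟨x, hx⟩), by simp⟩
      · exact ⟨Sum.inl (k.symm ⟨x, hx⟩), by simp⟩
  refine ⟨(Equiv.ofBijective _ hbij).symm, fun x => ?_, fun x => ?_⟩
  · rw [Equiv.symm_apply_eq]; rfl
  · rw [Equiv.symm_apply_eq]; rfl

theorem Option.exists_equiv_ne_none (J : Type*) :
    ∃ e : J ≃ {x : Option J // x ≠ none}, ∀ x, (e x : Option J) = some x := by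
  refine ⟨Equiv.ofBijective (fun x => ⟨some x, by simp⟩) ⟨fun x y h => ?_, ?_⟩, fun x => rfl⟩
  · simpa using h
  · rintro ⟨_ | x, hx⟩
    · exact absurd rfl hx
    · exact ⟨x, rfl⟩

namespace Gluing

variable {W B : Type*} {T : Gluing W B}

/-! ### Cutting along a cycle of length three -/

/-- The black triangles in `D` and the white triangles in `I` form the inner side of the cycle given
by the edges of colours `c` of the triangles `tri c`. -/
structure IsInside (T : Gluing W B) (D : Set B) (I : Set W) (tri : Color → W) : Prop where
  glue_mem : ∀ w ∈ I, ∀ c, T.glue c w ∈ D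
  glue_mem_iff : ∀ w ∉ I, ∀ c, T.glue c w ∈ D ↔ w = tri c
  tri_notMem : ∀ c, tri c ∉ I

variable {D : Set B} {I : Set W} {tri : Color → W}

/-- The inner summand. -/
theorem IsInside.exists_inner (h : T.IsInside D I tri) {J F : Type*} (i : J ≃ I) (j : F ≃ D) :
    ∃ T₂ : Gluing (Option J) F, (∀ c, (j (T₂.glue c none) : B) = T.glue c (tri c)) ∧
      ∀ c x, (j (T₂.glue c (some x)) : B) = T.glue c (i x) := by
  have htri : ∀ c, T.glue c (tri c) ∈ D := fun c =>
    (h.glue_mem_iff _ (h.tri_notMem c) c).2 rfl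
  let G : Color → Option J → F := fun c x => x.elim (j.symm ⟨T.glue c (tri c), htri c⟩)
    fun x => j.symm ⟨T.glue c (i x), h.glue_mem _ (i x).2 c⟩
  have hG0 : ∀ c, (j (G c none) : B) = T.glue c (tri c) := fun c => by simp [G]
  have hG1 : ∀ c x, (j (G c (some x)) : B) = T.glue c (i x) := fun c x => by simp [G]
  have hbij : ∀ c, Function.Bijective (G c) := by
    intro c
    constructor
    · intro x y hxy
      have hxy : (j (G c x) : B) = j (G c y) := by rw [hxy]
      rcases x with _ | x <;> rcases y with _ | y
      · rfl
      · rw [hG0, hG1] at hxy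
        exact absurd ((T.glue c).injective hxy ▸ (i y).2) (h.tri_notMem c)
      · rw [hG0, hG1] at hxy
        exact absurd ((T.glue c).injective hxy ▸ (i x).2) (h.tri_notMem c)
      · rw [hG1, hG1] at hxy
        exact congrArg some (i.injective (Subtype.ext ((T.glue c).injective hxy)))
    · intro b
      by_cases hw : (T.glue c).symm (j b) ∈ I
      · refine ⟨some (i.symm ⟨_, hw⟩), j.injective (Subtype.ext ?_)⟩
        rw [hG1]; simp
      · refine ⟨none, j.injective (Subtype.ext ?_)⟩
        rw [hG0, ← (h.glue_mem_iff _ hw c).1 (by simp)]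
        simp
  exact ⟨⟨fun c => Equiv.ofBijective _ (hbij c)⟩, hG0, hG1⟩

/-- The outer summand. -/
theorem IsInside.exists_outer (h : T.IsInside D I tri) {J F : Type*} (i : J ≃ (Iᶜ : Set W))
    (j : F ≃ (Dᶜ : Set B)) :
    ∃ T₁ : Gluing J (Option F), (∀ c x, (i x : W) = tri c → T₁.glue c x = none) ∧
      ∀ c x y, T.glue c (i x) = j y → T₁.glue c x = some y := by
  classical
  let G : Color → J → Option F := fun c x =>
    if hx : T.glue c (i x) ∈ D then none else some (j.symm ⟨T.glue c (i x), hx⟩)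
  have hG0 : ∀ c x, (i x : W) = tri c → G c x = none := fun c x hx =>
    dif_pos ((h.glue_mem_iff _ (i x).2 c).2 hx)
  have hG1 : ∀ c x y, T.glue c (i x) = j y → G c x = some y := fun c x y hx => by
    have : T.glue c (i x) ∉ D := fun h' => (j y).2 (hx ▸ h')
    simp only [G, dif_neg this, Option.some_inj]
    rw [Equiv.symm_apply_eq]
    exact Subtype.ext hx
  have hG : ∀ c x, (G c x = none ∧ (i x : W) = tri c) ∨
      ∃ y, G c x = some y ∧ T.glue c (i x) = j y := by
    intro c x
    by_cases hx : T.glue c (i x) ∈ D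
    · have := (h.glue_mem_iff _ (i x).2 c).1 hx
      exact Or.inl ⟨hG0 c x this, this⟩
    · have hy : T.glue c (i x) = j (j.symm ⟨_, hx⟩) := by simp
      exact Or.inr ⟨_, hG1 c x _ hy, hy⟩
  have hbij : ∀ c, Function.Bijective (G c) := by
    intro c
    constructor
    · intro x y hxy
      rcases hG c x with ⟨h1, h2⟩ | ⟨z, h1, h2⟩ <;> rcases hG c y with ⟨h3, h4⟩ | ⟨z', h3, h4⟩ <;>
        rw [h1, h3] at hxy
      · exact i.injective (Subtype.ext (h2.trans h4.symm))
      · cases hxy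
      · cases hxy
      · cases hxy
        exact i.injective (Subtype.ext ((T.glue c).injective (h2.trans h4.symm)))
    · rintro (_ | y)
      · exact ⟨i.symm ⟨tri c, h.tri_notMem c⟩, hG0 c _ (by simp)⟩
      · have hw : (T.glue c).symm (j y) ∉ I := fun hw =>
          (j y).2 (by simpa using h.glue_mem _ hw c)
        exact ⟨i.symm ⟨_, hw⟩, hG1 c _ y (by simp)⟩
  exact ⟨⟨fun c => Equiv.ofBijective _ (hbij c)⟩, hG0, hG1⟩

section Summands

variable {J F J' F' : Type*} {i : J ≃ I} {j : F ≃ D} {T₂ : Gluing (Option J) F}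
  {i' : J' ≃ (Iᶜ : Set W)} {j' : F' ≃ (Dᶜ : Set B)} {T₁ : Gluing J' (Option F')}

theorem IsInside.connected_inner (h : T.IsInside D I tri) (hT : T.Connected)
    (h0 : ∀ c, (j (T₂.glue c none) : B) = T.glue c (tri c))
    (h1 : ∀ c x, (j (T₂.glue c (some x)) : B) = T.glue c (i x)) : T₂.Connected := by
  classical
  refine connected_of_induction T₂ fun p hp x x' hx => ?_
  -- Everything outside is collapsed to the new white triangle `none`.
  let q : W → Prop := fun w => if hw : w ∈ I then p (some (i.symm ⟨w, hw⟩)) else p none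
  have hq0 : ∀ {w}, w ∉ I → (q w ↔ p none) := fun hw => by simp [q, hw]
  have hq1 : ∀ x, q (i x) ↔ p (some x) := fun x => by simp [q]
  have hD : ∀ b c, q ((T.glue c).symm (j b)) ↔ p ((T₂.glue c).symm b) := by
    intro b c
    obtain ⟨y, rfl⟩ := (T₂.glue c).surjective b
    rcases y with _ | y
    · simp [h0, hq0 (h.tri_notMem c)]
    · simp [h1, hq1]
  have key : ∀ b c d, q ((T.glue c).symm b) → q ((T.glue d).symm b) := by
    intro b c d hb
    by_cases hbD : b ∈ D
    · obtain ⟨b', hb'⟩ := j.surjective ⟨b, hbD⟩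
      have hb' : (j b' : B) = b := by rw [hb']
      rw [← hb', hD] at hb ⊢
      exact hp _ _ _ hb
    · have hn : ∀ c, (T.glue c).symm b ∉ I := fun c hc =>
        hbD (by simpa using h.glue_mem _ hc c)
      rw [hq0 (hn _)] at hb ⊢
      exact hb
  let rep : Option J → W := fun x => x.elim (tri 0) fun x => i x
  have hrep : ∀ x, q (rep x) ↔ p x := by
    rintro (_ | x)
    · exact hq0 (h.tri_notMem 0)
    · exact hq1 x
  exact (hrep x').1 (hT.induction (p := q) key ((hrep x).2 hx) (rep x'))

theorem IsInside.connected_outer (h : T.IsInside D I tri) (hT : T.Connected)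
    (h0 : ∀ c x, (i' x : W) = tri c → T₁.glue c x = none)
    (h1 : ∀ c x y, T.glue c (i' x) = j' y → T₁.glue c x = some y) : T₁.Connected := by
  classical
  have : Nonempty J' := ⟨i'.symm ⟨tri 0, h.tri_notMem 0⟩⟩
  refine connected_of_induction T₁ fun p hp x x' hx => ?_
  let o : J' := i'.symm ⟨tri 0, h.tri_notMem 0⟩
  -- The inside is collapsed to `o`, a neighbour of the new black triangle `none`.
  let q : W → Prop := fun w => if hw : w ∈ I then p o else p (i'.symm ⟨w, hw⟩)
  have hq0 : ∀ {w}, w ∈ I → (q w ↔ p o) := fun hw => by simp [q, hw]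
  have hq1 : ∀ x, q (i' x) ↔ p x := fun x => by
    have : (i' x : W) ∉ I := (i' x).2
    simp [q, this]
  have htri : ∀ c x, (i' x : W) = tri c → (p x ↔ p o) := by
    intro c x hx
    have e1 : x = (T₁.glue c).symm none := by rw [← h0 c x hx]; simp
    have e2 : o = (T₁.glue 0).symm none := by rw [← h0 0 o (by simp [o])]; simp
    rw [e1, e2]
    exact ⟨hp _ _ _, hp _ _ _⟩
  have key : ∀ b c d, q ((T.glue c).symm b) → q ((T.glue d).symm b) := by
    intro b c d hb
    by_cases hbD : b ∈ D
    · have hin : ∀ c, q ((T.glue c).symm b) ↔ p o := by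
        intro c
        by_cases hw : (T.glue c).symm b ∈ I
        · exact hq0 hw
        · have h2 := (h.glue_mem_iff _ hw c).1 (by simpa using hbD)
          have h3 : (i' (i'.symm ⟨_, hw⟩) : W) = (T.glue c).symm b := by simp
          rw [← h3, hq1]
          exact htri c _ (h3.trans h2)
      rw [hin] at hb ⊢
      exact hb
    · have hn : ∀ c, (T.glue c).symm b ∉ I := fun c hc =>
        hbD (by simpa using h.glue_mem _ hc c)
      have hin : ∀ c, q ((T.glue c).symm b) ↔
          p ((T₁.glue c).symm (some (j'.symm ⟨b, hbD⟩))) := by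
        intro c
        have h3 : (i' (i'.symm ⟨_, hn c⟩) : W) = (T.glue c).symm b := by simp
        rw [← h3, hq1, ← h1 c (i'.symm ⟨_, hn c⟩) (j'.symm ⟨b, hbD⟩) (by simp)]
        simp
      rw [hin] at hb ⊢
      exact hp _ _ _ hb
  have h2 := hT.induction (p := q) key ((hq1 x).2 hx) (i' x')
  exact (hq1 x').1 h2

theorem IsInside.iso_connectedSum (h : T.IsInside D I tri)
    (h0 : ∀ c, (j (T₂.glue c none) : B) = T.glue c (tri c))
    (h1 : ∀ c x, (j (T₂.glue c (some x)) : B) = T.glue c (i x))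
    (h0' : ∀ c x, (i' x : W) = tri c → T₁.glue c x = none)
    (h1' : ∀ c x y, T.glue c (i' x) = j' y → T₁.glue c x = some y) :
    Iso T (connectedSum T₁ none T₂ none) := by
  obtain ⟨e, he⟩ := Option.exists_equiv_ne_none J
  obtain ⟨e', he'⟩ := Option.exists_equiv_ne_none F'
  obtain ⟨f, hf, hf'⟩ := exists_equiv_sum_of_compl (e.symm.trans i) i'
  obtain ⟨g, hg, hg'⟩ := exists_equiv_sum_of_compl j (e'.symm.trans j')
  have hf2 : ∀ x, f (i x) = Sum.inr (e x) := fun x => by rw [← hf]; simp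
  have hg2 : ∀ y, g (j' y) = Sum.inl (e' y) := fun y => by rw [← hg']; simp
  refine ⟨f, g, fun c w => ?_⟩
  by_cases hw : w ∈ I
  · obtain ⟨x, hx⟩ : ∃ x, (i x : W) = w := ⟨i.symm ⟨w, hw⟩, by simp⟩
    subst hx
    rw [hf2, ← h1, hg]
    change _ = Sum.inr (T₂.glue c (e x))
    rw [he]
  · obtain ⟨x, hx⟩ : ∃ x, (i' x : W) = w := ⟨i'.symm ⟨w, hw⟩, by simp⟩
    subst hx
    rw [hf']
    by_cases hD : T.glue c (i' x) ∈ D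
    · have htri := (h.glue_mem_iff _ hw c).1 hD
      rw [htri, ← h0, hg]
      simp [connectedSum, h0' c x htri]
    · have hy : T.glue c (i' x) = j' (j'.symm ⟨_, hD⟩) := by simp
      rw [hy, hg2]
      have hne : T₁.glue c x ≠ none := by rw [h1' c x _ hy]; simp
      have h3 : (connectedSum T₁ none T₂ none).glue c (Sum.inl x) =
          Sum.inl ⟨T₁.glue c x, hne⟩ := by simp [connectedSum, hne]
      rw [h3]
      congr 1
      apply Subtype.ext
      rw [he']
      exact (h1' c x _ hy).symm

/-- Vertices of the inner summand map onto those of the region. Because the cycle closes up, the new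
white triangle can be given the three vertices of the cycle, which makes the map well defined. -/
theorem card_regionVertices_le_of_inner [Finite J]
    (hcyc : ∀ c, T.vertex c (tri (c + 1)) = T.vertex c (tri (c + 2)))
    (h0 : ∀ c, (j (T₂.glue c none) : B) = T.glue c (tri c))
    (h1 : ∀ c x, (j (T₂.glue c (some x)) : B) = T.glue c (i x)) :
    (T.regionVertices D).ncard ≤ Nat.card T₂.Vertex := by
  let φ : Color → Option J → T.Vertex := fun c x =>
    x.elim (T.vertex c (tri (c + 1))) fun x => T.vertex c (i x)
  have hφ : ∀ c d x, d ≠ c → T.blackVertex c (j (T₂.glue d x)) = φ c x := by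
    rintro c d (_ | x) hd
    · rw [h0, T.blackVertex_glue hd]
      rcases Color.cases c d with rfl | rfl | rfl
      exacts [absurd rfl hd, rfl, (hcyc c).symm]
    · rw [h1, T.blackVertex_glue hd]
      rfl
  have hrot : ∀ c x, φ c (T₂.rot c x) = φ c x := by
    intro c x
    rw [← hφ c (c + 1) _ (by simp), glue_rot, hφ c (c + 2) _ (by simp)]
  have hsame : ∀ c x x', T₂.vertex c x = T₂.vertex c x' → φ c x = φ c x' := by
    intro c x x' hx
    obtain ⟨n, rfl⟩ := (T₂.vertex_eq_iff.1 hx).exists_nat_pow_eq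
    clear hx
    induction n with
    | zero => rfl
    | succ n ih => rw [pow_succ', Equiv.Perm.mul_apply, hrot, ← ih]
  choose rep hrep using T₂.exists_vertex_eq
  have hsub : T.regionVertices D ⊆ (fun v => φ v.1 (rep v)) '' Set.univ := by
    rintro v ⟨b, hb, hv⟩
    obtain ⟨b', hb'⟩ := j.surjective ⟨b, hb⟩
    have hb' : (j b' : B) = b := by rw [hb']
    obtain ⟨x, rfl⟩ := (T₂.glue (v.1 + 1)).surjective b'
    refine ⟨T₂.vertex v.1 x, trivial, ?_⟩
    have h2 := hsame v.1 _ x (hrep (T₂.vertex v.1 x))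
    change φ v.1 (rep (T₂.vertex v.1 x)) = v
    rw [h2, ← hφ v.1 (v.1 + 1) _ (by simp), hb', hv]
  calc (T.regionVertices D).ncard
      ≤ ((fun v => φ v.1 (rep v)) '' Set.univ).ncard := Set.ncard_le_ncard hsub (Set.toFinite _)
    _ ≤ (Set.univ : Set T₂.Vertex).ncard := Set.ncard_image_le
    _ = Nat.card T₂.Vertex := Set.ncard_univ _

end Summands

/-- In an irreducible trinity, one side of a cycle of length three is trivial. -/
theorem Irreducible.eq_empty [Finite W] (hirr : T.Irreducible) (hT : T.Connected)
    (h : T.IsInside D I tri) (htri : Function.Injective tri)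
    (hcyc : ∀ c, T.vertex c (tri (c + 1)) = T.vertex c (tri (c + 2)))
    (hcard : I.ncard + 3 ≤ (T.regionVertices D).ncard) : I = ∅ := by
  have : Finite B := Finite.of_equiv W (T.glue 0)
  -- Irreducibility quantifies over summands in `Type`, so the pieces are transported to `Fin n`.
  have i := (Finite.equivFin I).symm
  have i' := (Finite.equivFin (Iᶜ : Set W)).symm
  have j := (Finite.equivFin D).symm
  have j' := (Finite.equivFin (Dᶜ : Set B)).symm
  obtain ⟨T₂, h0, h1⟩ := h.exists_inner i j
  obtain ⟨T₁, h0', h1'⟩ := h.exists_outer i' j'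
  have hc2 := h.connected_inner hT h0 h1
  -- The inner summand has `I.ncard + 1` white triangles. By `hcard` it has at least two more
  -- vertices than that, and by `card_vertex_le` at most two more.
  have hE : T₂.EulerTwo := by
    have e1 := T₂.card_vertex_le hc2
    have e2 := card_regionVertices_le_of_inner hcyc h0 h1
    have e3 : Nat.card (Option (Fin (Nat.card I))) = I.ncard + 1 := by
      simp [Nat.card_coe_set_eq]
    unfold EulerTwo
    omega
  rcases hirr.2 _ _ _ _ T₁ none T₂ none inferInstance inferInstance
    (h.connected_outer hT h0' h1') hc2 hE (h.iso_connectedSum h0 h1 h0' h1') with h2 | h2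
  -- The outer summand contains the three distinct triangles of the cycle.
  · exfalso
    have e1 : (⟨tri 0, h.tri_notMem 0⟩ : (Iᶜ : Set W)) = ⟨tri 1, h.tri_notMem 1⟩ := by
      rw [Nat.card_eq_one_iff_unique] at h2
      have := h2.1
      exact i'.symm.injective (Subsingleton.elim _ _)
    have := htri (congrArg Subtype.val e1)
    revert this
    decide
  · have e3 : Nat.card (Option (Fin (Nat.card I))) = I.ncard + 1 := by
      simp [Nat.card_coe_set_eq]
    rw [e3] at h2
    exact (Set.ncard_eq_zero (Set.toFinite I)).1 (by omega)

end Gluing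

/-! ### Moves of irreducible trinities -/

namespace PlanarTrinity

variable {W B : Type*} {T : PlanarTrinity W B} {s t : T.State} {σ : T.Site}

/-- The moves of an irreducible trinity are about black triangles. -/
theorem ClockwiseMove.exists_eq_blackSite [Finite W] (hm : T.ClockwiseMove σ s t)
    (hirr : T.Irreducible) : ∃ b, σ = T.blackSite b := by
  classical
  obtain ⟨h, -, -, hD⟩ := hm.exists_isHeight
  set D : Set B := {b | h b = 1} with hDdef
  have hK := hm.isClockwise.isTurn
  have hsub : (σ.triangles : Set W) ⊆ T.regionTriangles D :=
    fun w hw => hD.mem_regionTriangles hw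
  have hKcard : (σ.triangles : Set W).ncard = 3 := by
    rw [Set.ncard_coe_finset, Site.triangles,
      Finset.card_image_of_injective _ hm.isClockwise.tri_injective]
    rfl
  have hcard := Set.ncard_sdiff_add_ncard_of_subset hsub
  have hin : T.IsInside D (T.regionTriangles D \ σ.triangles) σ.tri := by
    refine ⟨fun w hw c => ?_, fun w hw c => ⟨fun hc => ?_, ?_⟩, fun c hc => ?_⟩
    · obtain ⟨⟨d, hd⟩, hwK⟩ := hw
      exact hD.glue_mem w hwK d c hd
    · have hwK : w ∈ σ.triangles := by
        by_contra hwK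
        exact hw ⟨⟨c, hc⟩, hwK⟩
      rw [hD.glue_mem_iff w hwK] at hc
      obtain ⟨d, rfl⟩ := Site.mem_triangles.1 hwK
      rw [hm.isClockwise.color_tri, Color.add_one_add_two] at hc
      rw [hc]
    · rintro rfl
      rw [hD.glue_mem_iff _ (Site.mem_triangles.2 ⟨c, rfl⟩), hm.isClockwise.color_tri,
        Color.add_one_add_two]
    · exact hc.2 (Site.mem_triangles.2 ⟨c, rfl⟩)
  have hempty := hirr.eq_empty T.connected hin hm.isClockwise.tri_injective σ.cycle (by
    have := (hK.card_regionTriangles_le hD).1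
    omega)
  have hfaces := hD.card_faces
  rw [hempty, Set.ncard_empty] at hcard
  -- Only the three triangles of the cycle remain, and `card_faces` then leaves a single black
  -- triangle.
  have hD1 : D.ncard = 1 := by
    rw [← Set.ncard_coe_finset] at hfaces
    omega
  obtain ⟨b, hb⟩ := Set.ncard_eq_one.1 hD1
  refine ⟨b, Site.ext (funext fun c => ?_)⟩
  have h1 : T.glue c (σ.tri c) ∈ D := (hin.glue_mem_iff _ (hin.tri_notMem c) c).2 rfl
  rw [hb, Set.mem_singleton_iff] at h1
  change σ.tri c = (T.glue c).symm b
  rw [← h1, Equiv.symm_apply_apply]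

/-! ### The clock theorem -/

variable (T)

theorem isCommuting_clockwiseMove : IsCommuting T.ClockwiseMove :=
  ⟨fun h h' => h.target_eq h', fun h h' hne => h.exists_join h' hne⟩

theorem isCommuting_clockwiseMove_symm : IsCommuting fun σ s t => T.ClockwiseMove σ t s :=
  ⟨fun h h' => h.source_eq h', fun h h' hne => h.exists_meet h' hne⟩

variable {T}

theorem labeledPath_iff {l : List T.Site} :
    LabeledPath T.ClockwiseMove s l t ↔ T.ClockwisePath s l t := by
  constructor
  · intro h
    induction h with
    | nil s => exact ClockwisePath.nil s
    | cons h _ ih => exact ClockwisePath.cons h ih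
  · intro h
    induction h with
    | nil s => exact LabeledPath.nil s
    | cons h _ ih => exact LabeledPath.cons h ih

theorem ClockwisePath.reachable [Finite W] {l : List T.Site} (h : T.ClockwisePath s l t) :
    T.transitionGraph.Reachable s t := by
  obtain ⟨r, hr⟩ := exists_strictMono_moves (T := T)
  induction h with
  | nil => exact SimpleGraph.Reachable.refl _
  | @cons σ l s t u h _ ih =>
    refine SimpleGraph.Reachable.trans (SimpleGraph.Adj.reachable ?_) ih
    rw [transitionGraph, SimpleGraph.fromRel_adj]
    exact ⟨fun hst => lt_irrefl (r s) (by simpa [hst] using hr σ s t h), Or.inl ⟨σ, h⟩⟩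

end PlanarTrinity

theorem theorem4p2 {W B : Type*} [Finite W] (T : PlanarTrinity W B) :
    T.transitionGraph.Connected ∧
    (∃ (L : DistribLattice T.State) (a m : T.State) (φ : T.State → T.Site → ℕ),
      -- the order: going up is performing clockwise moves
      (∀ s t, L.le s t ↔ ∃ l, T.ClockwisePath s l t) ∧
      -- `a` is the unique minimum, and the lattice operations are those of the multiplicities
      (∀ s, L.le a s) ∧
      (∀ s, (∀ σ t, ¬ T.ClockwiseMove σ t s) ↔ s = a) ∧
      T.IsMultiplicity a φ ∧
      Function.Injective φ ∧
      (∀ s t, L.le s t ↔ φ s ≤ φ t) ∧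
      (∀ s t, φ (L.inf s t) = φ s ⊓ φ t) ∧
      (∀ s t, φ (L.sup s t) = φ s ⊔ φ t) ∧
      -- `m` is the unique maximum, and it is the clocked state
      (∀ s, L.le s m) ∧
      (∀ s, (∀ σ t, ¬ T.ClockwiseMove σ s t) ↔ s = m) ∧
      (∀ c, T.IsSpanningArborescence c (T.clockedArborescence c)) ∧
      T.IsClockedState m) ∧
    -- in the irreducible case all clock moves are about black triangles
    (T.Irreducible → ∀ σ s t, T.ClockwiseMove σ s t → ∃ b, σ = T.blackSite b) := by
  classical
  obtain ⟨r, hr⟩ := PlanarTrinity.exists_strictMono_moves (T := T)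
  -- Existence of a state: any colour would do.
  obtain ⟨s₀, -⟩ := T.exists_state_clocked 0
  obtain ⟨-, m, -, hm⟩ := exists_path_to_sink hr s₀
  have hm' : ∀ s, (∀ σ t, ¬ T.ClockwiseMove σ s t) ↔ s = m := fun s =>
    ⟨fun hs => PlanarTrinity.eq_of_forall_not_move hs hm, fun h => h ▸ hm⟩
  obtain ⟨D, a, φ, h1, h2, h3, h4, h5, h6, h7, h8, h9⟩ := exists_distribLattice
    T.isCommuting_clockwiseMove T.isCommuting_clockwiseMove_symm hr hm'
  simp only [PlanarTrinity.labeledPath_iff] at h1 h4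
  refine ⟨?_, ⟨D, a, m, φ, h1, h2, h3, h4, h5, h6, h7, h8, h9, hm',
    fun c => T.isSpanningArborescence_clocked c, PlanarTrinity.isClockedState_of_forall_not_move hm⟩,
    fun hirr σ s t h => h.exists_eq_blackSite hirr⟩
  have : Nonempty T.State := ⟨m⟩
  refine SimpleGraph.Connected.mk fun s t => ?_
  obtain ⟨l, hl⟩ := (h1 s m).1 (h9 s)
  obtain ⟨l', hl'⟩ := (h1 t m).1 (h9 t)
  exact hl.reachable.trans hl'.reachable.symm
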